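/- **Conventions.** $\mathbb F$ is a finite field and $\log$ is to base $2$. For words $x,y\in\mathbb F^I$ let $\mathrm{dist}(x,y)$ be the fraction of coordinates on which $x$ and $y$ differ; for a string of sets $S\in\binom{\mathbb F}{\ell}^{I}$ let $\mathrm{dist}(x,S)$ be the fraction of $i\in I$ with $x_i\notin S_i$. The relative distance of a code $C$ is the largest $\delta$ with $\mathrm{dist}(C(x),C(y))\ge\delta$ for all messages $x\ne y$. A code $C:\mathbb F^k\to\mathbb F^n$ is *systematic* if every message is the prefix of its codeword, and *$(\alpha,\ell,L)$-list recoverable* if for every $S\in\binom{\mathbb F}{\ell}^n$ at most $L$ messages $x$ satisfy $\mathrm{dist}(C(x),S)\le\alpha$. If $C$ is linear with generating matrix $G$, then $C^{\otimes t}:\mathbb F^{k^t}\to\mathbb F^{n^t}$ (coordinates are $t$-tuples) is defined by $C^{\otimes 1}=C$ and $C^{\otimes t}=C\otimes C^{\otimes(t-1)}$, where $(C_1\otimes C_2)(M)=G_1MG_2^{T}$; and $C^{\otimes t}(\widehat C)$ denotes $x\mapsto C^{\otimes t}(\widehat C(x))$. A code $E:\mathbb F^{k}\to\mathbb F^{N}$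 is *$(Q,\alpha)$-locally decodable* if there is a randomized algorithm that, on input $i\in[k]$ and with oracle access to $w\in\mathbb F^{N}$, makes at most $Q$ queries, and outputs $x_i$ with probability at least $\frac23$ whenever $\mathrm{dist}(E(x),w)\le\alpha$. It is *$(Q,\alpha,\ell,L)$-locally list recoverable* if there is a randomized preprocessing algorithm $A$ that (without input or oracle) outputs at most $L$ descriptions of randomized algorithms $A_1,A_2,\dots$, each of which, on input $i\in[k]$ and with oracle access to $S\in\binom{\mathbb F}{\ell}^{N}$, makes at most $Q$ queries, such that for every $S$ and every $x$ with $\mathrm{dist}(E(x),S)\le\alpha$, with probability at least $\frac23$ over the randomness of $A$, there is a $j$ such that for all $i\in[k]$, $\Pr[A_j(i)=x_i]\ge\frac23$. The preprocessing time is the running time of $A$ (including writing the descriptions); the running time is the maximal running time of the $A_j$. Algorithms are programs of a first-order list-processing language (pairs, words, symbols of $\mathbb F$; local bindings, conditionals, unbounded loops) with unit cost for each elementary operation, including oracle queries. Reading an element of $\{0,\dots,M-1\}$ from the uniform random tape costs additionally the bit length of $M$, and the time includes writing the output. The program may depend on the codes and the parameters. A global list recovery algorithm for $C$ is a deterministic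 algorithm that, given all of $S\in\binom{\mathbb F}{\ell}^{n}$, outputs a list of at most $L$ codewords containing every codeword within distance $\alpha$ of $S$. **Lemma 5.4.** There is an absolute constant $c\ge 1$ such that the following holds. Let $n\ge 2$, $L\ge 2$, $k,\widehat k,t,\ell\ge1$ and $\widehat Q\ge 0$ be integers and let $\alpha,\widehat\alpha\in(0,1]$. Let $C:\mathbb F^{k}\to\mathbb F^n$ be a systematic linear code of rate $\rho=k/n$ and relative distance $\delta$ that is $(\alpha,\ell,L)$-list recoverable, and let $\widehat C:\mathbb F^{\widehat k}\to\mathbb F^{k^t}$ be $(\widehat Q,\widehat\alpha)$-locally decodable. Put $$X=\frac{\log^t L}{(\alpha\widehat\alpha)^{ct}\,(\rho\delta)^{ct^2}} .$$ Then $\widetilde C:=C^{\otimes t}(\widehat C):\mathbb F^{\widehat k}\to\mathbb F^{n^t}$ is $(\widetilde Q,\widetilde\alpha,\ell,\widetilde L)$-locally list recoverable with $$\widetilde\alpha=\alpha\,\widehat\alpha\,\rho^t\,\delta^{ct},\qquad \widetilde Q=\widehat Q\cdot n\cdot X,\qquad \widetilde L=2^{X},$$ by an algorithm with preprocessing time at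 most $2^{X}\cdot\log n$. Moreover, if $C$ has a global list recovery algorithm with parameters $(\alpha,\ell,L)$ and running time $T$, and $\widehat C$ has a $(\widehat Q,\widehat\alpha)$-local decoder with running time $\widehat T$, then there is a local list recovery algorithm for $\widetilde C$ with the parameters and the preprocessing time above and with running time at most $\widehat T+\widehat Q\cdot T\cdot X$. -/

import Mathlib

namespace LocalRec

/-! ### Words, codes, tensor powers -/

section Codes

variable {F : Type*} {ι κ : Type*}

/-- Relative distance between two words: the fraction of coordinates where they differ. -/
noncomputable def wordDist (x y : ι → F) : ℝ :=
  (Nat.card {i // x i ≠ y i} : ℝ) / (Nat.card ι : ℝ)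

/-- The fraction of coordinates `i` with `x i ∉ S i`. -/
noncomputable def listDist (x : ι → F) (S : ι → Finset F) : ℝ :=
  (Nat.card {i // x i ∉ S i} : ℝ) / (Nat.card ι : ℝ)

/-- `δ` is the relative distance of the code `C`: the largest number that bounds from below the
distance between the codewords of any two distinct messages. -/
def IsRelDist (C : (κ → F) → (ι → F)) (δ : ℝ) : Prop :=
  IsGreatest {d : ℝ | ∀ x y, x ≠ y → d ≤ wordDist (C x) (C y)} δ

/-- Every message is the prefix of its codeword. -/
def Systematic {k n : ℕ} (C : (Fin k → F) → (Fin n → F)) : Prop :=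
  ∃ h : k ≤ n, ∀ x i, C x (Fin.castLE h i) = x i

/-- `(α, ℓ, L)`-list recoverability: for all input sets of size `ℓ`, at most `L` messages
have a codeword within relative distance `α`. -/
def ListRecoverable (C : (κ → F) → (ι → F)) (α : ℝ) (ℓ L : ℕ) : Prop :=
  ∀ S : ι → Finset F, (∀ i, (S i).card = ℓ) →
    Set.encard {x : κ → F | listDist (C x) S ≤ α} ≤ L

variable [CommSemiring F]

/-- The encoding `M ↦ G₁ M G₂ᵀ` of the tensor product of the codes generated by `G₁`, `G₂`. -/
def tensorEncode {ι' κ' : Type*} [Fintype κ] [Fintype κ']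
    (G₁ : Matrix ι κ F) (G₂ : Matrix ι' κ' F) (M : Matrix κ κ' F) : Matrix ι ι' F :=
  G₁ * M * G₂.transpose

/-- The generating matrix of the `t`-th tensor power of the code generated by `G`; message and
codeword coordinates are `t`-tuples. -/
def tensorGen {n k : ℕ} (G : Matrix (Fin n) (Fin k) F) :
    (t : ℕ) → Matrix (Fin t → Fin n) (Fin t → Fin k) F
  | 0 => fun _ _ => 1
  | t + 1 => fun i j => G (i 0) (j 0) * tensorGen G t (Fin.tail i) (Fin.tail j)

/-- The `t`-th tensor power of a linear code. -/
def tensorPow {n k : ℕ} (C : (Fin k → F) →ₗ[F] (Fin n → F)) (t : ℕ)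
    (x : (Fin t → Fin k) → F) : (Fin t → Fin n) → F :=
  (tensorGen (LinearMap.toMatrix' C) t).mulVec x

/-- The first tensor power of `C` is `C`. -/
theorem tensorPow_one {n k : ℕ} (C : (Fin k → F) →ₗ[F] (Fin n → F))
    (x : (Fin 1 → Fin k) → F) (i : Fin 1 → Fin n) :
    tensorPow C 1 x i = C (fun j => x (fun _ => j)) (i 0) := by
  have h : C (fun j => x (fun _ => j)) =
      (LinearMap.toMatrix' C).mulVec (fun j => x (fun _ => j)) := by
    rw [← Matrix.toLin'_apply, Matrix.toLin'_toMatrix']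
  rw [h, tensorPow, Matrix.mulVec, Matrix.mulVec, dotProduct, dotProduct]
  refine Fintype.sum_equiv (Equiv.funUnique (Fin 1) (Fin k)) _ _ fun j => ?_
  have hj : (fun _ => j 0 : Fin 1 → Fin k) = j := by
    funext s; rw [Subsingleton.elim s 0]
  simp [tensorGen, hj]

/-- The `(t + 1)`-st tensor power of `C` is the tensor product of `C` and its `t`-th power. -/
theorem tensorPow_succ {n k t : ℕ} (C : (Fin k → F) →ₗ[F] (Fin n → F))
    (x : (Fin (t + 1) → Fin k) → F) (a : Fin n) (i : Fin t → Fin n) :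
    tensorPow C (t + 1) x (Fin.cons a i) =
      tensorEncode (LinearMap.toMatrix' C) (tensorGen (LinearMap.toMatrix' C) t)
        (Matrix.of fun b j => x (Fin.cons b j)) a i := by
  have h (j : Fin t → Fin k) :
      (LinearMap.toMatrix' C * Matrix.of fun b j => x (Fin.cons b j)) a j =
        ∑ b, LinearMap.toMatrix' C a b * x (Fin.cons b j) := Matrix.mul_apply
  have h' : tensorEncode (LinearMap.toMatrix' C) (tensorGen (LinearMap.toMatrix' C) t)
      (Matrix.of fun b j => x (Fin.cons b j)) a i =
        ∑ j, (∑ b, LinearMap.toMatrix' C a b * x (Fin.cons b j)) *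
          tensorGen (LinearMap.toMatrix' C) t i j := by
    simp only [← h]
    exact Matrix.mul_apply
  have h'' : tensorPow C (t + 1) x (Fin.cons a i) =
      ∑ j, tensorGen (LinearMap.toMatrix' C) (t + 1) (Fin.cons a i) j * x j := rfl
  rw [h', h'', ← (Fin.consEquiv (fun _ : Fin (t + 1) => Fin k)).sum_comp,
    Fintype.sum_prod_type, Finset.sum_comm]
  refine Finset.sum_congr rfl fun j _ => ?_
  rw [Finset.sum_mul]
  refine Finset.sum_congr rfl fun b _ => ?_
  have e : (Fin.consEquiv (fun _ : Fin (t + 1) => Fin k)) (b, j) = Fin.cons b j := rfl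
  rw [e]
  simp only [tensorGen, Fin.cons_zero, Fin.tail_cons]
  ring

end Codes

/-! ### A machine model with a step count

Algorithms are programs of a small first-order language over list structures (binary trees), with
unit cost per elementary operation, unbounded loops, an oracle and a random tape. Programs are
written with de Bruijn variables: `var 0` is the most recently bound value. -/

/-- Data: the empty list, machine words, alphabet symbols, and ordered pairs. -/
inductive Val (F : Type*) where
  | nil : Val F
  | nat : ℕ → Val F
  | sym : F → Val F
  | pair : Val F → Val F → Val F

/-- The time to write a value down completely (words are written in binary). -/
def Val.size {F : Type*} : Val F → ℕ
  | .nil => 1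
  | .nat m => 1 + Nat.size m
  | .sym _ => 1
  | .pair u v => 1 + u.size + v.size

/-- Unary operations: components of a pair, the kind of a value, and the field operations
`-a`, `a⁻¹`. -/
inductive Op1 where
  | fst | snd | kind | neg | inv

/-- Binary operations: pairing; comparison of atoms; addition, truncated subtraction and order of
words; addition and multiplication in the field. -/
inductive Op2 where
  | pair | eq | add | sub | lt | fadd | fmul

section Machine

variable {F : Type*}

/-- The word stored in a value, `0` if there is none. -/
def Val.toNat : Val F → ℕ
  | .nat m => m
  | _ => 0

/-- The truth values are the empty list (false) and everything else (true). -/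
def Val.ofProp (p : Prop) [Decidable p] : Val F := if p then .nat 1 else .nil

/-- Unary operations; the result on an argument of the wrong kind is the empty list. -/
def Op1.app [Field F] : Op1 → Val F → Val F
  | .fst, .pair u _ => u
  | .snd, .pair _ v => v
  | .kind, .nil => .nat 0
  | .kind, .nat _ => .nat 1
  | .kind, .sym _ => .nat 2
  | .kind, .pair _ _ => .nat 3
  | .neg, .sym a => .sym (-a)
  | .inv, .sym a => .sym a⁻¹
  | _, _ => .nil

open Classical in
/-- Binary operations; the result on arguments of the wrong kind is the empty list. -/
noncomputable def Op2.app [Field F] : Op2 → Val F → Val F → Val F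
  | .pair, u, v => .pair u v
  | .eq, .nil, .nil => .nat 1
  | .eq, .nat a, .nat b => .ofProp (a = b)
  | .eq, .sym a, .sym b => .ofProp (a = b)
  | .add, .nat a, .nat b => .nat (a + b)
  | .sub, .nat a, .nat b => .nat (a - b)
  | .lt, .nat a, .nat b => .ofProp (a < b)
  | .fadd, .sym a, .sym b => .sym (a + b)
  | .fmul, .sym a, .sym b => .sym (a * b)
  | _, _, _ => .nil

/-- Programs. `bind e b` evaluates `e` and runs `b` with the value as `var 0`. `loop b` repeats
`b`, whose `var 0` is the current state, until the first component of its value is false; the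
second component is the next state and, at the end, the value of the loop. `query e` asks the
oracle; `coin e` reads a cell of the random tape. -/
inductive Prog (F : Type*) where
  | var : ℕ → Prog F
  | nil : Prog F
  | nat : ℕ → Prog F
  | sym : F → Prog F
  | op1 : Op1 → Prog F → Prog F
  | op2 : Op2 → Prog F → Prog F → Prog F
  | ite : Prog F → Prog F → Prog F → Prog F
  | bind : Prog F → Prog F → Prog F
  | loop : Prog F → Prog F
  | query : Prog F → Prog F
  | coin : Prog F → Prog F

/-- `Eval O R M σ p v τ q`: with oracle `O`, random tape `R` over the alphabet `{0, …, M - 1}` and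
values `σ` of the variables, the program `p` halts with value `v` after `τ` steps and `q` oracle
queries. Every node that is evaluated costs one step, and reading a cell of the random tape costs
in addition the bit length of `M`. -/
inductive Eval [Field F] (O : Val F → Val F) (R : ℕ → ℕ) (M : ℕ) :
    List (Val F) → Prog F → Val F → ℕ → ℕ → Prop where
  | var (σ : List (Val F)) (i : ℕ) : Eval O R M σ (.var i) (σ.getD i .nil) 1 0
  | nil (σ : List (Val F)) : Eval O R M σ .nil .nil 1 0
  | nat (σ : List (Val F)) (m : ℕ) : Eval O R M σ (.nat m) (.nat m) 1 0
  | sym (σ : List (Val F)) (a : F) : Eval O R M σ (.sym a) (.sym a) 1 0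
  | op1 {σ : List (Val F)} {o : Op1} {e : Prog F} {v : Val F} {τ q : ℕ} :
      Eval O R M σ e v τ q → Eval O R M σ (.op1 o e) (o.app v) (τ + 1) q
  | op2 {σ : List (Val F)} {o : Op2} {e e' : Prog F} {v v' : Val F} {τ τ' q q' : ℕ} :
      Eval O R M σ e v τ q → Eval O R M σ e' v' τ' q' →
        Eval O R M σ (.op2 o e e') (o.app v v') (τ + τ' + 1) (q + q')
  | iteTrue {σ : List (Val F)} {e a b : Prog F} {u v : Val F} {τ τ' q q' : ℕ} :
      Eval O R M σ e u τ q → u ≠ .nil → Eval O R M σ a v τ' q' →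
        Eval O R M σ (.ite e a b) v (τ + τ' + 1) (q + q')
  | iteFalse {σ : List (Val F)} {e a b : Prog F} {v : Val F} {τ τ' q q' : ℕ} :
      Eval O R M σ e .nil τ q → Eval O R M σ b v τ' q' →
        Eval O R M σ (.ite e a b) v (τ + τ' + 1) (q + q')
  | bind {σ : List (Val F)} {e b : Prog F} {u v : Val F} {τ τ' q q' : ℕ} :
      Eval O R M σ e u τ q → Eval O R M (u :: σ) b v τ' q' →
        Eval O R M σ (.bind e b) v (τ + τ' + 1) (q + q')
  | loopStop {σ : List (Val F)} {b : Prog F} {s u : Val F} {τ q : ℕ} :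
      Eval O R M (s :: σ) b u τ q → Op1.fst.app u = .nil →
        Eval O R M (s :: σ) (.loop b) (Op1.snd.app u) (τ + 1) q
  | loopStep {σ : List (Val F)} {b : Prog F} {s u v : Val F} {τ τ' q q' : ℕ} :
      Eval O R M (s :: σ) b u τ q → Op1.fst.app u ≠ .nil →
        Eval O R M (Op1.snd.app u :: σ) (.loop b) v τ' q' →
        Eval O R M (s :: σ) (.loop b) v (τ + τ' + 1) (q + q')
  | query {σ : List (Val F)} {e : Prog F} {v : Val F} {τ q : ℕ} :
      Eval O R M σ e v τ q → Eval O R M σ (.query e) (O v) (τ + 1) (q + 1)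
  | coin {σ : List (Val F)} {e : Prog F} {v : Val F} {τ q : ℕ} :
      Eval O R M σ e v τ q →
        Eval O R M σ (.coin e) (.nat (R v.toNat)) (τ + 1 + Nat.size M) q

/-- A randomized algorithm: a program and a random tape of `tapeLen` independent uniform elements
of `{0, …, base - 1}` (`base = 2`: fair coins; `tapeLen = 0`: no randomness). -/
structure Alg (F : Type*) where
  prog : Prog F
  tapeLen : ℕ
  base : ℕ
  base_pos : 0 < base

/-- The contents of the random tape. -/
abbrev Alg.Tape (A : Alg F) : Type := Fin A.tapeLen → Fin A.base

/-- The random tape as a memory; cells beyond its end hold `0`. -/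
def Alg.cells (A : Alg F) (ω : A.Tape) (j : ℕ) : ℕ :=
  if h : j < A.tapeLen then (ω ⟨j, h⟩ : ℕ) else 0

/-- With oracle `O` and tape `ω`, the algorithm `A` on input `inp` outputs `out` in time `τ`, which
includes the time for writing the output, with `q` oracle queries. -/
def Alg.Run [Field F] (A : Alg F) (O : Val F → Val F) (ω : A.Tape) (inp out : Val F)
    (τ q : ℕ) : Prop :=
  ∃ s, Eval O (A.cells ω) A.base [inp] A.prog out s q ∧ τ = s + out.size

/-- With oracle `O` and tape `ω`, the algorithm `A` on input `inp` outputs `out`. -/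
def Alg.Outputs [Field F] (A : Alg F) (O : Val F → Val F) (ω : A.Tape) (inp out : Val F) : Prop :=
  ∃ τ q, A.Run O ω inp out τ q

/-- The algorithm halts on every random tape, within time `T`. -/
def Alg.TimeLE [Field F] (A : Alg F) (O : Val F → Val F) (inp : Val F) (T : ℝ) : Prop :=
  ∀ ω, ∃ out τ q, A.Run O ω inp out τ q ∧ (τ : ℝ) ≤ T

/-- The algorithm halts on every random tape, after at most `Q` oracle queries. -/
def Alg.QueriesLE [Field F] (A : Alg F) (O : Val F → Val F) (inp : Val F) (Q : ℝ) : Prop :=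
  ∀ ω, ∃ out τ q, A.Run O ω inp out τ q ∧ (q : ℝ) ≤ Q

/-- Probability over the uniform random tape. -/
noncomputable def Alg.prob (A : Alg F) (E : A.Tape → Prop) : ℝ :=
  (Nat.card {ω // E ω} : ℝ) / (Nat.card A.Tape : ℝ)

/-- Lists as values. -/
def encList : List (Val F) → Val F
  | [] => .nil
  | v :: l => .pair v (encList l)

/-- Strings of symbols as values. -/
def encSyms (l : List F) : Val F := encList (l.map .sym)

/-- A coordinate of a word indexed by `t`-tuples, as the list of its components. -/
def encIdx {t n : ℕ} (i : Fin t → Fin n) : Val F :=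
  encList (List.ofFn fun s => .nat (i s : ℕ))

theorem encList_injective : Function.Injective (encList (F := F)) := by
  intro l
  induction l with
  | nil => intro l' h; cases l' with
    | nil => rfl
    | cons => simp [encList] at h
  | cons a l ih => intro l' h; cases l' with
    | nil => simp [encList] at h
    | cons b l' =>
      simp only [encList, Val.pair.injEq] at h
      rw [h.1, ih h.2]

/-- Distinct coordinates have distinct encodings. -/
theorem encIdx_injective {t n : ℕ} :
    Function.Injective (encIdx (F := F) : (Fin t → Fin n) → Val F) := by
  intro i j h
  have h' := List.ofFn_injective (encList_injective h)
  funext s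
  have hs := congrFun h' s
  simp only [Val.nat.injEq] at hs
  exact Fin.ext hs

open Classical in
/-- Oracle access to a word whose entries are given as values: on (the encoding of) a coordinate
the answer is the entry there, and on anything else it is the empty list. -/
noncomputable def oracle {t n : ℕ} (f : (Fin t → Fin n) → Val F) (v : Val F) : Val F :=
  if h : ∃ i, v = encIdx i then f h.choose else .nil

theorem oracle_encIdx {t n : ℕ} (f : (Fin t → Fin n) → Val F) (i : Fin t → Fin n) :
    oracle f (encIdx i) = f i := by
  have h : ∃ j : Fin t → Fin n, (encIdx i : Val F) = encIdx j := ⟨i, rfl⟩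
  rw [oracle, dif_pos h, ← encIdx_injective h.choose_spec]

/-- No oracle. -/
def noOracle (_ : Val F) : Val F := .nil

/-- Oracle access to a string of symbols. -/
noncomputable def wordOracle {t n : ℕ} (w : (Fin t → Fin n) → F) : Val F → Val F :=
  oracle fun i => .sym (w i)

/-- Oracle access to a string of lists of symbols; one query returns one list. -/
noncomputable def listOracle {t n : ℕ} (l : (Fin t → Fin n) → List F) : Val F → Val F :=
  oracle fun i => encSyms (l i)

/-- `l` is a string of lists that enumerate, in some order and without repetition, the entries of
a string of sets of size `ℓ`. -/
def Presents {ι : Type*} (l : ι → List F) (S : ι → Finset F) (ℓ : ℕ) : Prop :=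
  ∀ i, (l i).Nodup ∧ (l i).length = ℓ ∧ ∀ a, a ∈ l i ↔ a ∈ S i

/-! ### Decoding and list recovery algorithms -/

/-- `A` is a (deterministic) `(α, ℓ, L)`-list recovery algorithm for `C` with running time `T`:
given the whole string of input lists, it outputs at most `L` codewords, and all codewords that
are `α`-close to the input are among them. -/
def GlobalRecoverer [Field F] {k n : ℕ} (C : (Fin k → F) → (Fin n → F)) (α : ℝ) (ℓ L T : ℕ)
    (A : Alg F) : Prop :=
  A.tapeLen = 0 ∧
  ∀ (S : Fin n → Finset F) (l : Fin n → List F), Presents l S ℓ →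
    ∃ out : List (Fin n → F),
      out.length ≤ L ∧ (∀ c ∈ out, c ∈ Set.range C) ∧
      (∀ x, listDist (C x) S ≤ α → C x ∈ out) ∧
      ∀ ω, ∃ τ q, A.Run noOracle ω (encList (List.ofFn fun i => encSyms (l i)))
        (encList (out.map fun c => encSyms (List.ofFn c))) τ q ∧ τ ≤ T

/-- `A` is a local decoder for `E`: on input `i` and with oracle access to a word it makes at most
`Q` queries, and if the word is `α`-close to the codeword of `x`, then it outputs `x i` with
probability at least `2 / 3`. -/
def LocalDecoder [Field F] {k m t : ℕ} (E : (Fin k → F) → (Fin t → Fin m) → F) (Q : ℕ) (α : ℝ)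
    (A : Alg F) : Prop :=
  (∀ (w : (Fin t → Fin m) → F) (i : Fin k), A.QueriesLE (wordOracle w) (.nat i) Q) ∧
  ∀ (x : Fin k → F) (w : (Fin t → Fin m) → F), wordDist (E x) w ≤ α → ∀ i : Fin k,
    2 / 3 ≤ A.prob fun ω => A.Outputs (wordOracle w) ω (.nat i) (.sym (x i))

/-- The local decoder `A` has running time at most `T`. -/
def LocalDecoderTime [Field F] (k m t : ℕ) (A : Alg F) (T : ℝ) : Prop :=
  ∀ (w : (Fin t → Fin m) → F) (i : Fin k), A.TimeLE (wordOracle w) (.nat i) T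

/-- `(Q, α)`-local decodability. -/
def LocallyDecodable [Field F] {k m t : ℕ} (E : (Fin k → F) → (Fin t → Fin m) → F) (Q : ℕ)
    (α : ℝ) : Prop :=
  ∃ A : Alg F, LocalDecoder E Q α A

/-- `(A, D)` is a `(Q, α, ℓ, L)`-local list recovery algorithm for `E`. The preprocessing `A` has
neither input nor oracle; it outputs a list of at most `L` descriptions. The description `a` stands
for the randomized local algorithm that runs `D` on `a` and a message coordinate, with oracle
access to the input lists. -/
def LocalListRecoverer [Field F] {k n t : ℕ} (E : (Fin k → F) → (Fin t → Fin n) → F)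
    (Q α : ℝ) (ℓ : ℕ) (L : ℝ) (A D : Alg F) : Prop :=
  (∀ ω, ∃ as : List (Val F), A.Outputs noOracle ω .nil (encList as) ∧ (as.length : ℝ) ≤ L ∧
    ∀ a ∈ as, ∀ (S : (Fin t → Fin n) → Finset F) (l : (Fin t → Fin n) → List F),
      Presents l S ℓ → ∀ i : Fin k, D.QueriesLE (listOracle l) (.pair a (.nat i)) Q) ∧
  ∀ (S : (Fin t → Fin n) → Finset F) (l : (Fin t → Fin n) → List F), Presents l S ℓ →
    ∀ x : Fin k → F, listDist (E x) S ≤ α →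
      2 / 3 ≤ A.prob fun ω => ∃ as : List (Val F), A.Outputs noOracle ω .nil (encList as) ∧
        ∃ a ∈ as, ∀ i : Fin k,
          2 / 3 ≤ D.prob fun ω' => D.Outputs (listOracle l) ω' (.pair a (.nat i)) (.sym (x i))

/-- The preprocessing time is at most `T`. -/
def PreprocessingTime [Field F] (A : Alg F) (T : ℝ) : Prop :=
  A.TimeLE noOracle .nil T

/-- All local algorithms that the preprocessing may output have running time at most `T`. -/
def LocalRecoveryTime [Field F] (k n t ℓ : ℕ) (A D : Alg F) (T : ℝ) : Prop :=
  ∀ ω (as : List (Val F)), A.Outputs noOracle ω .nil (encList as) → ∀ a ∈ as,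
    ∀ (S : (Fin t → Fin n) → Finset F) (l : (Fin t → Fin n) → List F), Presents l S ℓ →
      ∀ i : Fin k, D.TimeLE (listOracle l) (.pair a (.nat i)) T

end Machine

end LocalRec

open LocalRec

/-! Let t = s + 1 and let W be the codeword of x under `C^{⊗t}(Ĉ)`, close to the input lists. A
column of W in the first direction is a codeword of C, so list recovery of that column yields at
most L candidates, with the true one among them unless the column has more than αn entries outside
their lists. Distinct candidates differ on a δ fraction of the rows, so m random rows single out the
true one once W is known where the column meets these rows. Each sampled row is a slice of dimension
t - 1, in which W is recovered recursively. In dimension one the index of the true candidate is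
taken from advice. The recursion ends in m^s one-dimensional columns, so there are L^(m^s) possible
advice strings: the preprocessing draws the sampled rows and lists the descriptions for all of them.

With the right advice the recovery at a coordinate fails only if its column is far from the lists,
if the sample does not separate the true column from another candidate in more than 2θ rows, or if
more than θ of the m recursive answers are wrong (`not_wrong_succ`). Markov's inequality for the
last event gives `wrong_le`. Summation over all samplings and all systematic coordinates gives the
recursion of `numWrong_le`: a sampled row is uniform among the n slices, so the errors of the slices
are averaged and grow by the factor m / (θ + 1) ≤ 8/δ per level. The bad samples and the bad
coordinates each contribute at most α'/6 to the average fraction of errors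
(`exists_sampling_parameters`, `badCoeff_mul_numBad_le`), where α' is the radius of `Ĉ`. By Markov
again, with probability 2/3 over the preprocessing at most an α' fraction of the systematic part is
wrong. The systematic part of W is `Ĉ(x)`, so the local decoder of `Ĉ` succeeds when its queries are
answered by this recovery.

Two facts keep the parameters within the stated form. Since n ≥ 2, the Singleton bound gives ρδ ≤
9/16 (`rate_mul_dist_le`), so the power of ρδ in X pays for every factor that depends on t alone.
The growth (8/δ)^s of the errors is offset by ρ if ρ is small, and otherwise by powers of δ, which
is then bounded away from 1 (`badCoeff_le`). For k = 1 neither applies, but then there is less than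
one bad coordinate, hence none.

The costs come from explicit programs; `Comp.simulate` embeds the given decoder and the given list
recovery algorithm. -/

namespace LocalRec

/-! ### Evaluation: determinism and cost bounds -/

section Evaluation

variable {F : Type*} [Field F] {O : Val F → Val F} {R : ℕ → ℕ} {M : ℕ}

/-- The value and the cost of a program are determined by the oracle and the tape. -/
theorem Eval.det {σ : List (Val F)} {p : Prog F} {v v' : Val F} {τ τ' q q' : ℕ}
    (h : Eval O R M σ p v τ q) (h' : Eval O R M σ p v' τ' q') : v = v' ∧ τ = τ' ∧ q = q' := by
  induction h generalizing v' τ' q' with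
  | var | nil | nat | sym => cases h'; simp
  | op1 _ ih => cases h' with | op1 h => obtain ⟨rfl, rfl, rfl⟩ := ih h; simp
  | op2 _ _ ih ih' =>
    cases h' with
    | op2 h h' => obtain ⟨rfl, rfl, rfl⟩ := ih h; obtain ⟨rfl, rfl, rfl⟩ := ih' h'; simp
  | iteTrue _ hu _ ih ih' =>
    cases h' with
    | iteTrue h _ h' => obtain ⟨rfl, rfl, rfl⟩ := ih h; obtain ⟨rfl, rfl, rfl⟩ := ih' h'; simp
    | iteFalse h h' => exact absurd (ih h).1 hu
  | iteFalse _ _ ih ih' =>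
    cases h' with
    | iteTrue h hu h' => exact absurd (ih h).1.symm hu
    | iteFalse h h' => obtain ⟨_, rfl, rfl⟩ := ih h; obtain ⟨rfl, rfl, rfl⟩ := ih' h'; simp
  | bind _ _ ih ih' =>
    cases h' with
    | bind h h' => obtain ⟨rfl, rfl, rfl⟩ := ih h; obtain ⟨rfl, rfl, rfl⟩ := ih' h'; simp
  | loopStop _ hu ih =>
    cases h' with
    | loopStop h _ => obtain ⟨rfl, rfl, rfl⟩ := ih h; simp
    | loopStep h hu' h' => obtain ⟨rfl, rfl, rfl⟩ := ih h; exact absurd hu hu'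
  | loopStep _ hu _ ih ih' =>
    cases h' with
    | loopStop h hu' => obtain ⟨rfl, rfl, rfl⟩ := ih h; exact absurd hu' hu
    | loopStep h _ h' =>
      obtain ⟨rfl, rfl, rfl⟩ := ih h; obtain ⟨rfl, rfl, rfl⟩ := ih' h'; simp
  | query _ ih => cases h' with | query h => obtain ⟨rfl, rfl, rfl⟩ := ih h; simp
  | coin _ ih => cases h' with | coin h => obtain ⟨rfl, rfl, rfl⟩ := ih h; simp

theorem Eval.queries_le {σ : List (Val F)} {p : Prog F} {v : Val F} {τ q : ℕ}
    (h : Eval O R M σ p v τ q) : q ≤ τ := by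
  induction h <;> omega

/-- A computation without queries does not depend on the oracle. -/
theorem Eval.of_queries_eq_zero {σ : List (Val F)} {p : Prog F} {v : Val F} {τ q : ℕ}
    (h : Eval O R M σ p v τ q) (hq : q = 0) (O' : Val F → Val F) : Eval O' R M σ p v τ q := by
  induction h with
  | var => exact .var ..
  | nil => exact .nil ..
  | nat => exact .nat ..
  | sym => exact .sym ..
  | op1 _ ih => exact .op1 (ih hq)
  | op2 _ _ ih ih' => exact .op2 (ih (by omega)) (ih' (by omega))
  | iteTrue _ hu _ ih ih' => exact .iteTrue (ih (by omega)) hu (ih' (by omega))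
  | iteFalse _ _ ih ih' => exact .iteFalse (ih (by omega)) (ih' (by omega))
  | bind _ _ ih ih' => exact .bind (ih (by omega)) (ih' (by omega))
  | loopStop _ hu ih => exact .loopStop (ih hq) hu
  | loopStep _ hu _ ih ih' => exact .loopStep (ih (by omega)) hu (ih' (by omega))
  | query => omega
  | coin _ ih => exact .coin (ih hq)

/-- The program `p` halts with value `v` after at most `τ` steps and at most `q` queries. -/
def Comp (O : Val F → Val F) (R : ℕ → ℕ) (M : ℕ) (σ : List (Val F)) (p : Prog F) (v : Val F)
    (τ q : ℕ) : Prop :=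
  ∃ τ' q', Eval O R M σ p v τ' q' ∧ τ' ≤ τ ∧ q' ≤ q

namespace Comp

variable {σ : List (Val F)} {e e' a b : Prog F} {u v v' s : Val F} {τ τ' q q' : ℕ}

theorem mono (h : Comp O R M σ e v τ q) (hτ : τ ≤ τ') (hq : q ≤ q') : Comp O R M σ e v τ' q' := by
  obtain ⟨x, y, h, hx, hy⟩ := h
  exact ⟨x, y, h, hx.trans hτ, hy.trans hq⟩

theorem var (i : ℕ) (h : σ.getD i .nil = v) : Comp O R M σ (.var i) v 1 0 :=
  ⟨1, 0, h ▸ .var σ i, le_rfl, le_rfl⟩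

theorem nil : Comp O R M σ .nil .nil 1 0 := ⟨1, 0, .nil σ, le_rfl, le_rfl⟩

theorem nat (m : ℕ) : Comp O R M σ (.nat m) (.nat m) 1 0 := ⟨1, 0, .nat σ m, le_rfl, le_rfl⟩

theorem sym (c : F) : Comp O R M σ (.sym c) (.sym c) 1 0 := ⟨1, 0, .sym σ c, le_rfl, le_rfl⟩

theorem op1 (o : Op1) (h : Comp O R M σ e u τ q) (hv : o.app u = v) :
    Comp O R M σ (.op1 o e) v (τ + 1) q := by
  obtain ⟨x, y, h, hx, hy⟩ := h
  subst hv
  exact ⟨_, _, .op1 h, by omega, hy⟩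

theorem op2 (o : Op2) (h : Comp O R M σ e u τ q) (h' : Comp O R M σ e' v τ' q')
    (hv : o.app u v = v') : Comp O R M σ (.op2 o e e') v' (τ + τ' + 1) (q + q') := by
  obtain ⟨x, y, h, hx, hy⟩ := h
  obtain ⟨x', y', h', hx', hy'⟩ := h'
  subst hv
  exact ⟨_, _, .op2 h h', by omega, by omega⟩

theorem iteTrue (h : Comp O R M σ e u τ q) (hu : u ≠ .nil) (h' : Comp O R M σ a v τ' q') :
    Comp O R M σ (.ite e a b) v (τ + τ' + 1) (q + q') := by
  obtain ⟨x, y, h, hx, hy⟩ := h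
  obtain ⟨x', y', h', hx', hy'⟩ := h'
  exact ⟨_, _, .iteTrue h hu h', by omega, by omega⟩

theorem iteFalse (h : Comp O R M σ e .nil τ q) (h' : Comp O R M σ b v τ' q') :
    Comp O R M σ (.ite e a b) v (τ + τ' + 1) (q + q') := by
  obtain ⟨x, y, h, hx, hy⟩ := h
  obtain ⟨x', y', h', hx', hy'⟩ := h'
  exact ⟨_, _, .iteFalse h h', by omega, by omega⟩

theorem bind (h : Comp O R M σ e u τ q) (h' : Comp O R M (u :: σ) b v τ' q') :
    Comp O R M σ (.bind e b) v (τ + τ' + 1) (q + q') := by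
  obtain ⟨x, y, h, hx, hy⟩ := h
  obtain ⟨x', y', h', hx', hy'⟩ := h'
  exact ⟨_, _, .bind h h', by omega, by omega⟩

theorem loopStop (h : Comp O R M (s :: σ) b u τ q) (hu : Op1.fst.app u = .nil) :
    Comp O R M (s :: σ) (.loop b) (Op1.snd.app u) (τ + 1) q := by
  obtain ⟨x, y, h, hx, hy⟩ := h
  exact ⟨_, _, .loopStop h hu, by omega, by omega⟩

theorem loopStep (h : Comp O R M (s :: σ) b u τ q) (hu : Op1.fst.app u ≠ .nil)
    (h' : Comp O R M (Op1.snd.app u :: σ) (.loop b) v τ' q') :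
    Comp O R M (s :: σ) (.loop b) v (τ + τ' + 1) (q + q') := by
  obtain ⟨x, y, h, hx, hy⟩ := h
  obtain ⟨x', y', h', hx', hy'⟩ := h'
  exact ⟨_, _, .loopStep h hu h', by omega, by omega⟩

theorem query (h : Comp O R M σ e u τ q) (hv : O u = v) :
    Comp O R M σ (.query e) v (τ + 1) (q + 1) := by
  obtain ⟨x, y, h, hx, hy⟩ := h
  subst hv
  exact ⟨_, _, .query h, by omega, by omega⟩

theorem coin (h : Comp O R M σ e u τ q) :
    Comp O R M σ (.coin e) (.nat (R u.toNat)) (τ + 1 + Nat.size M) q := by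
  obtain ⟨x, y, h, hx, hy⟩ := h
  exact ⟨_, _, .coin h, by omega, hy⟩

end Comp

/-- The program `p`, written for an environment of size `d`, as a subprogram of a program with a
larger environment: queries are answered by the subprogram `Q`, the tape is read by `K`. -/
def simulate (Q : ℕ → Prog F) (K : Prog F → Prog F) : ℕ → Prog F → Prog F
  | d, .var j => if j < d then .var j else .nil
  | _, .nil => .nil
  | _, .nat m => .nat m
  | _, .sym a => .sym a
  | d, .op1 o e => .op1 o (simulate Q K d e)
  | d, .op2 o e e' => .op2 o (simulate Q K d e) (simulate Q K d e')
  | d, .ite e a b => .ite (simulate Q K d e) (simulate Q K d a) (simulate Q K d b)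
  | d, .bind e b => .bind (simulate Q K d e) (simulate Q K (d + 1) b)
  | d, .loop b => .loop (simulate Q K d b)
  | d, .query e => .bind (simulate Q K d e) (Q d)
  | d, .coin e => K (simulate Q K d e)

/-- By induction on the evaluation: each node is copied at its own cost, and only a query costs κ
more. Reading the tape through `K` must not be dearer than a coin of the original machine. -/
theorem Comp.simulate {O' : Val F → Val F} {R' : ℕ → ℕ} {M' : ℕ} {Q : ℕ → Prog F}
    {K : Prog F → Prog F} {ext : List (Val F)} {κ κ' : ℕ}
    (hQ : ∀ (v : Val F) (σ : List (Val F)),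
      Comp O' R' M' (v :: (σ ++ ext)) (Q σ.length) (O v) κ κ')
    (hK : ∀ (σ : List (Val F)) (e : Prog F) (v : Val F) (τ q : ℕ), Comp O' R' M' σ e v τ q →
      Comp O' R' M' σ (K e) (.nat (R v.toNat)) (τ + 1 + Nat.size M) q)
    {σ : List (Val F)} {p : Prog F} {v : Val F} {τ q : ℕ} (h : Eval O R M σ p v τ q) :
    Comp O' R' M' (σ ++ ext) (LocalRec.simulate Q K σ.length p) v (τ + q * κ) (q * κ') := by
  induction h with
  | var σ i =>
    rw [LocalRec.simulate]
    split_ifs with hi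
    · exact (Comp.var i (by rw [List.getD_append _ _ _ _ hi])).mono (by omega) (by omega)
    -- In its own environment such a variable reads the default `.nil`; in the larger one it would
    -- reach into `ext`. Hence the guard in `simulate`.
    · rw [List.getD_eq_default _ _ (by omega)]
      exact Comp.nil.mono (by omega) (by omega)
  | nil => exact Comp.nil.mono (by omega) (by omega)
  | nat σ m => exact (Comp.nat m).mono (by omega) (by omega)
  | sym σ c => exact (Comp.sym c).mono (by omega) (by omega)
  | op1 _ ih => exact (Comp.op1 _ ih rfl).mono (by ring_nf; rfl) le_rfl
  | op2 _ _ ih ih' => exact (Comp.op2 _ ih ih' rfl).mono (by ring_nf; rfl) (by ring_nf; rfl)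
  | iteTrue _ hu _ ih ih' => exact (Comp.iteTrue ih hu ih').mono (by ring_nf; rfl) (by ring_nf; rfl)
  | iteFalse _ _ ih ih' => exact (Comp.iteFalse ih ih').mono (by ring_nf; rfl) (by ring_nf; rfl)
  | bind _ _ ih ih' => exact (Comp.bind ih ih').mono (by ring_nf; rfl) (by ring_nf; rfl)
  | loopStop _ hu ih => exact (Comp.loopStop ih hu).mono (by ring_nf; rfl) (by ring_nf; rfl)
  | loopStep _ hu _ ih ih' =>
    exact (Comp.loopStep ih hu ih').mono (by ring_nf; rfl) (by ring_nf; rfl)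
  | query _ ih => exact (Comp.bind ih (hQ _ _)).mono (by ring_nf; rfl) (by ring_nf; rfl)
  | coin _ ih => exact (hK _ _ _ _ _ ih).mono (by ring_nf; rfl) le_rfl

end Evaluation

/-! ### Subprograms on lists -/

theorem getD_map_sym_ofFn {F : Type*} {n : ℕ} (c : Fin n → F) (i : Fin n) :
    ((List.ofFn c).map Val.sym).getD i .nil = .sym (c i) := by
  simp [List.getD]

section Subprograms

variable {F : Type*} [Field F] {O : Val F → Val F} {R : ℕ → ℕ} {M : ℕ}

/-- The list of the values of given programs. -/
def listProg : List (Prog F) → Prog F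
  | [] => .nil
  | p :: ps => .op2 .pair p (listProg ps)

theorem Comp.listProg_map {ι : Type*} {σ : List (Val F)} {p : ι → Prog F} {v : ι → Val F}
    {τ q : ℕ} (l : List ι) (h : ∀ j ∈ l, Comp O R M σ (p j) (v j) τ q) :
    Comp O R M σ (listProg (l.map p)) (encList (l.map v)) (l.length * (τ + 1) + 1)
      (l.length * q) := by
  induction l with
  | nil => exact Comp.nil.mono (by simp) (by simp)
  | cons a l ih =>
    refine (Comp.op2 .pair (h a (by simp)) (ih fun j hj => h j (by simp [hj])) rfl).mono ?_ ?_
    · simp only [List.length_cons]; ring_nf; rfl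
    · simp only [List.length_cons]; ring_nf; rfl

theorem Comp.listProg_ofFn {n : ℕ} {σ : List (Val F)} {p : Fin n → Prog F} {v : Fin n → Val F}
    {τ q : ℕ} (h : ∀ j, Comp O R M σ (p j) (v j) τ q) :
    Comp O R M σ (listProg (List.ofFn p)) (encList (List.ofFn v)) (n * (τ + 1) + 1) (n * q) := by
  simpa [List.ofFn_eq_map] using Comp.listProg_map (List.finRange n) fun j _ => h j

/-- With environment `i, l, …`: the entry of the list `l` at the position `i < N`, and the empty
list if there is none. -/
def nthProg : ℕ → Prog F
  | 0 => .nil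
  | N + 1 => .ite (.var 1)
      (.ite (.op2 .eq (.var 0) (.nat 0)) (.op1 .fst (.var 1))
        (.bind (.op1 .snd (.var 1)) (.bind (.op2 .sub (.var 1) (.nat 1)) (nthProg N)))) .nil

theorem comp_nthProg {N i : ℕ} (hi : i < N) (l : List (Val F)) (σ : List (Val F)) :
    Comp O R M (.nat i :: encList l :: σ) (nthProg N) (l.getD i .nil)
      (13 * min i l.length + 8) 0 := by
  induction N generalizing i l σ with
  | zero => omega
  | succ N ih =>
    cases l with
    | nil => exact (Comp.iteFalse (.var 1 rfl) .nil).mono (by omega) le_rfl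
    | cons v l =>
      cases i with
      | zero =>
        refine (Comp.iteTrue (.var 1 rfl) (by simp [encList]) (.iteTrue
          (.op2 (v' := .nat 1) .eq (.var 0 rfl) (.nat 0) (by simp [Op2.app, Val.ofProp])) (by simp)
          (.op1 .fst (.var 1 rfl) rfl))).mono (by omega) le_rfl
      | succ i =>
        refine (Comp.iteTrue (.var 1 rfl) (by simp [encList]) (.iteFalse
          (.op2 .eq (.var 0 rfl) (.nat 0) (by simp [Op2.app, Val.ofProp]))
          (.bind (u := encList l) (.op1 .snd (.var 1 rfl) rfl)
            (.bind (.op2 .sub (.var 1 rfl) (.nat 1) rfl)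
              (ih (i := i) (by omega) l _))))).mono ?_ le_rfl
        simp only [List.length_cons]
        omega

/-- With environment `l, r, …`: the list `l` with the first `d` entries of `r` moved, one by one,
to its front. -/
def revAppendProg : ℕ → Prog F
  | 0 => .var 0
  | d + 1 => .bind (.op1 .snd (.var 1))
      (.bind (.op2 .pair (.op1 .fst (.var 2)) (.var 1)) (revAppendProg d))

theorem comp_revAppendProg (l r : List (Val F)) (σ : List (Val F)) :
    Comp O R M (encList l :: encList r :: σ) (revAppendProg r.length) (encList (r.reverseAux l))
      (8 * r.length + 1) 0 := by
  induction r generalizing l σ with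
  | nil => exact (Comp.var 0 rfl).mono (by simp) le_rfl
  | cons v r ih =>
    refine (Comp.bind (u := encList r) (.op1 .snd (.var 1 rfl) rfl)
      (.bind (u := encList (v :: l))
        (.op2 .pair (.op1 .fst (.var 2 rfl) rfl) (.var 1 rfl) rfl) (ih _ _))).mono ?_ le_rfl
    simp only [List.length_cons]
    omega

/-- With environment `w, r, …`: the list of the oracle answers at the coordinates
`reverse r ++ a :: w` for `a < n`, where `d` is the length of `r`. -/
def columnProg (n d : ℕ) : Prog F :=
  listProg (List.ofFn fun a : Fin n => .query
    (.bind (.var 1) (.bind (.op2 .pair (.nat a) (.var 1)) (revAppendProg d))))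

theorem comp_columnProg {n : ℕ} (w r : List (Val F)) (σ : List (Val F)) (v : Fin n → Val F)
    (h : ∀ a : Fin n, O (encList (r.reverseAux (.nat a :: w))) = v a) :
    Comp O R M (encList w :: encList r :: σ) (columnProg n r.length) (encList (List.ofFn v))
      (n * (8 * r.length + 9) + 1) n := by
  refine (Comp.listProg_ofFn (τ := 8 * r.length + 8) (q := 1) fun a => ?_).mono (by ring_nf; rfl)
    (by simp)
  refine (Comp.query (.bind (.var 1 rfl) (.bind (u := encList (.nat a :: w))
    (.op2 .pair (.nat a) (.var 1 rfl) rfl) (comp_revAppendProg _ r _))) (h a)).mono ?_ (by omega)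
  omega

/-- The number of sampled coordinates on which a word differs from the sample. -/
noncomputable def mismatch {n : ℕ} (c : Fin n → F) (y : List (Fin n × F)) : ℕ :=
  open Classical in (y.map fun p => if c p.1 = p.2 then 0 else 1).sum

/-- The value that stores a sample. -/
def encSample {n : ℕ} (y : List (Fin n × F)) : Val F :=
  encList (y.map fun p => .pair (.nat p.1) (.sym p.2))

/-- With environment `y, c, …`: the number of mismatches of the word `c` of length `n` with the
sample `y`. -/
def mismatchProg (n : ℕ) : ℕ → Prog F
  | 0 => .nat 0
  | m + 1 => .op2 .add
      (.ite (.op2 .eq (.bind (.var 1) (.bind (.op1 .fst (.op1 .fst (.var 1))) (nthProg n)))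
        (.op1 .snd (.op1 .fst (.var 0)))) (.nat 0) (.nat 1))
      (.bind (.var 1) (.bind (.op1 .snd (.var 1)) (mismatchProg n m)))

theorem comp_nthProg_word {n : ℕ} (c : Fin n → F) (i : Fin n) (σ : List (Val F)) :
    Comp O R M (.nat i :: encSyms (List.ofFn c) :: σ) (nthProg n) (.sym (c i)) (13 * n + 8) 0 := by
  have h := comp_nthProg (O := O) (R := R) (M := M) i.2 ((List.ofFn c).map Val.sym) σ
  rw [getD_map_sym_ofFn] at h
  exact h.mono (by simp only [List.length_map, List.length_ofFn]; omega) le_rfl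

theorem comp_mismatchProg {n : ℕ} (c : Fin n → F) (y : List (Fin n × F)) (σ : List (Val F)) :
    Comp O R M (encSample y :: encSyms (List.ofFn c) :: σ) (mismatchProg n y.length)
      (.nat (mismatch c y)) (y.length * (13 * n + 26) + 1) 0 := by
  classical
  induction y generalizing σ with
  | nil => exact (Comp.nat 0).mono (by simp) le_rfl
  | cons p y ih =>
    have hc : Comp O R M (encSample (p :: y) :: encSyms (List.ofFn c) :: σ)
        (.op2 .eq (.bind (.var 1) (.bind (.op1 .fst (.op1 .fst (.var 1))) (nthProg n)))
        (.op1 .snd (.op1 .fst (.var 0)))) (.ofProp (c p.1 = p.2)) (13 * n + 18) 0 := by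
      refine (Comp.op2 .eq (.bind (.var 1 rfl) (.bind (.op1 .fst (.op1 .fst (.var 1 rfl) rfl) rfl)
        (comp_nthProg_word c p.1 _))) (.op1 .snd (.op1 .fst (.var 0 rfl) rfl) rfl) ?_).mono
        (by omega) le_rfl
      simp only [Op1.app, Op2.app]
      congr
    have hr : Comp O R M (encSample (p :: y) :: encSyms (List.ofFn c) :: σ)
        (.bind (.var 1) (.bind (.op1 .snd (.var 1)) (mismatchProg n y.length)))
        (.nat (mismatch c y)) (y.length * (13 * n + 26) + 6) 0 :=
      (Comp.bind (.var 1 rfl) (.bind (u := encSample y) (.op1 .snd (.var 1 rfl) rfl)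
        (ih _))).mono (by omega) le_rfl
    by_cases h : c p.1 = p.2
    · refine (Comp.op2 .add (.iteTrue hc (by simp [Val.ofProp, h]) (.nat 0)) hr ?_).mono ?_ le_rfl
      · simp [Op2.app, mismatch, h]
      · simp only [List.length_cons]; ring_nf; omega
    · rw [show (Val.ofProp (c p.1 = p.2) : Val F) = .nil by simp [Val.ofProp, h]] at hc
      refine (Comp.op2 .add (.iteFalse hc (.nat 1)) hr ?_).mono ?_ le_rfl
      · simp [Op2.app, mismatch, h]
      · simp only [List.length_cons]; ring_nf; omega

/-- A list of words as a value. -/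
def encWords {n : ℕ} (l : List (Fin n → F)) : Val F :=
  encList (l.map fun c => encSyms (List.ofFn c))

/-- A word or its absence as a value. -/
def encOption {n : ℕ} : Option (Fin n → F) → Val F
  | none => .nil
  | some c => encSyms (List.ofFn c)

/-- The first word of a list with at most `θ` mismatches with a sample. -/
noncomputable def select {n : ℕ} (θ : ℕ) (l : List (Fin n → F)) (y : List (Fin n × F)) :
    Option (Fin n → F) :=
  l.find? fun c => decide (mismatch c y ≤ θ)

/-- With environment `l, y, …`: the first word of the list `l` (of length at most `N`) with at
most `θ` mismatches with the sample `y` of size `m`. -/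
def selectProg (n m θ : ℕ) : ℕ → Prog F
  | 0 => .nil
  | N + 1 => .ite (.var 0)
      (.ite (.op2 .lt (.nat θ) (.bind (.op1 .fst (.var 0)) (.bind (.var 2) (mismatchProg n m))))
        (.bind (.var 1) (.bind (.op1 .snd (.var 1)) (selectProg n m θ N)))
        (.op1 .fst (.var 0))) .nil

theorem comp_selectProg {n θ N : ℕ} (l : List (Fin n → F)) (hl : l.length ≤ N)
    (y : List (Fin n × F)) (σ : List (Val F)) :
    Comp O R M (encWords l :: encSample y :: σ) (selectProg n y.length θ N)
      (encOption (select θ l y)) (l.length * (y.length * (13 * n + 26) + 16) + 3) 0 := by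
  induction l generalizing N σ with
  | nil =>
    cases N with
    | zero => exact Comp.nil.mono (by omega) le_rfl
    | succ N => exact (Comp.iteFalse (.var 0 rfl) .nil).mono (by simp) le_rfl
  | cons c l ih =>
    obtain ⟨N, rfl⟩ : ∃ N', N = N' + 1 := ⟨N - 1, by rw [List.length_cons] at hl; omega⟩
    have hm : Comp O R M (encWords (c :: l) :: encSample y :: σ)
        (.op2 .lt (.nat θ) (.bind (.op1 .fst (.var 0)) (.bind (.var 2) (mismatchProg n y.length))))
        (.ofProp (θ < mismatch c y)) (y.length * (13 * n + 26) + 8) 0 := by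
      refine (Comp.op2 .lt (.nat θ) (.bind (.op1 .fst (.var 0 rfl) rfl) (.bind (.var 2 rfl)
        (comp_mismatchProg c y _))) ?_).mono ?_ le_rfl
      · simp only [Op2.app]
      · omega
    by_cases h : θ < mismatch c y
    · have hs : select θ (c :: l) y = select θ l y := by simp [select, h]
      rw [hs]
      refine (Comp.iteTrue (.var 0 rfl) (by simp [encWords, encList]) (.iteTrue hm
        (by simp [Val.ofProp, h]) (.bind (.var 1 rfl) (.bind (u := encWords l)
        (.op1 .snd (.var 1 rfl) rfl) (ih (by simpa using hl) _))))).mono ?_ le_rfl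
      simp only [List.length_cons]; ring_nf; omega
    · have hs : select θ (c :: l) y = some c := by
        rw [select, List.find?_cons_of_pos (by simpa using h)]
      rw [hs]
      rw [show (Val.ofProp (θ < mismatch c y) : Val F) = .nil by simp [Val.ofProp, h]] at hm
      refine (Comp.iteTrue (.var 0 rfl) (by simp [encWords, encList]) (.iteFalse hm
        (.op1 .fst (.var 0 rfl) rfl))).mono ?_ le_rfl
      simp only [List.length_cons]; ring_nf; omega

/-- With environment `c, x, w, …`: the symbol of the word `c` at the first component of the
coordinate `w`, and `0` if `c` is absent. -/
def pickProg (n : ℕ) : Prog F :=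
  .bind (.bind (.op1 .fst (.var 2)) (nthProg n)) (.ite (.var 0) (.var 0) (.sym 0))

theorem comp_pickProg {n : ℕ} (c : Option (Fin n → F)) (i : Fin n) (x w : Val F)
    (σ : List (Val F)) :
    Comp O R M (encOption c :: x :: .pair (.nat i) w :: σ) (pickProg n)
      (.sym (c.elim 0 fun c => c i)) (13 * n + 16) 0 := by
  cases c with
  | none =>
    -- An absent word is stored as the empty list, all of whose entries read as `.nil`, so the test
    -- falls through to the symbol `0`.
    exact (Comp.bind (.bind (.op1 .fst (.var 2 rfl) rfl) (comp_nthProg i.2 [] _))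
      (.iteFalse (.var 0 rfl) (.sym 0))).mono (by simp) le_rfl
  | some c =>
    exact (Comp.bind (.bind (.op1 .fst (.var 2 rfl) rfl) (comp_nthProg_word c i _))
      (.iteTrue (.var 0 rfl) (by simp) (.var 0 rfl))).mono (by omega) le_rfl

end Subprograms

/-! ### Approximate local list recovery of tensor powers -/

/-- The coordinate `i` as a list of values. -/
def idxList {F : Type*} {t n : ℕ} (i : Fin t → Fin n) : List (Val F) := List.ofFn fun s => .nat (i s : ℕ)

theorem idxList_cons {F : Type*} {t n : ℕ} (a : Fin n) (i : Fin t → Fin n) :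
    idxList (F := F) (Fin.cons a i : Fin (t + 1) → Fin n) = .nat a :: idxList i := by
  simp [idxList, List.ofFn_succ]

theorem idxList_eq_cons {F : Type*} {t n : ℕ} (i : Fin (t + 1) → Fin n) :
    idxList (F := F) i = .nat (i 0) :: idxList (Fin.tail i) := by
  simp [idxList, List.ofFn_succ, Fin.tail]

section Recover

variable {F : Type*} [Field F] {n m s L θ : ℕ}

/-- The symbol at `i` of the word described by the sampled coordinates `R` and the advice `f`:
recover the list `g` of candidates for the column through `i`, and choose among them by the advice
(dimension one) or by the agreement with the recovered symbols in the sampled rows. -/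
noncomputable def recover (g : (Fin n → List F) → List (Fin n → F)) (θ : ℕ) :
    (s : ℕ) → (Fin s → Fin m → Fin n) → ((Fin s → Fin m) → Fin L) →
      ((Fin (s + 1) → Fin n) → List F) → (Fin (s + 1) → Fin n) → F
  | 0, _, f, l, i =>
    ((g fun a => l (Fin.cons a (Fin.tail i)))[(f Fin.elim0 : ℕ)]?).elim 0 fun c => c (i 0)
  | s + 1, R, f, l, i =>
    (select θ (g fun a => l (Fin.cons a (Fin.tail i))) (List.ofFn fun j =>
      (R 0 j, recover g θ s (Fin.tail R) (fun u => f (Fin.cons j u))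
        (fun i' => l (Fin.cons (R 0 j) i')) (Fin.tail i)))).elim 0 fun c => c (i 0)

/-- The description given by the sampled coordinates `R` and the advice `f`. -/
def encDesc : (s : ℕ) → (Fin s → Fin m → Fin n) → ((Fin s → Fin m) → Fin L) → Val F
  | 0, _, f => .nat (f Fin.elim0)
  | s + 1, R, f => encList (List.ofFn fun j =>
      .pair (.nat (R 0 j)) (encDesc s (Fin.tail R) fun u => f (Fin.cons j u)))

/-- With environment `x, i, a, r, …`: the candidates for the column through `i` behind the reversed
prefix `r` of length `d`; `G` is the list recovery program. -/
def candidatesProg (G : Prog F) (n d : ℕ) : Prog F :=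
  .bind (.bind (.var 3) (.bind (.op1 .snd (.var 2)) (columnProg n d))) G

/-- The second component of a list iterated `j` times. -/
def dropProg (e : Prog F) : ℕ → Prog F
  | 0 => e
  | j + 1 => .op1 .snd (dropProg e j)

/-- With environment `i, a, r, …`: the symbol at the coordinate `i` behind the reversed prefix `r`
of length `d`, for the description `a`. -/
def recoverProg (G : Prog F) (n m L θ : ℕ) : ℕ → ℕ → Prog F
  | 0, d => .bind (.var 1) (.bind
      (.bind (candidatesProg G n d) (.bind (.var 1) (nthProg L))) (pickProg n))
  | s + 1, d => .bind
      (listProg (List.ofFn fun j : Fin m =>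
        .bind (.op1 .fst (dropProg (.var 1) j))
          (.op2 .pair (.op1 .fst (.var 0))
            (.bind (.op2 .pair (.op1 .fst (.var 0)) (.var 3))
              (.bind (.op1 .snd (.var 1))
                (.bind (.op1 .snd (.var 3)) (recoverProg G n m L θ s (d + 1))))))))
      (.bind (.bind (candidatesProg G n d) (selectProg n m θ L)) (pickProg n))

variable {O : Val F → Val F} {R : ℕ → ℕ} {M : ℕ}

theorem comp_dropProg {σ : List (Val F)} {e : Prog F} {τ q : ℕ} (l : List (Val F))
    (he : Comp O R M σ e (encList l) τ q) (j : ℕ) (hj : j ≤ l.length) :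
    Comp O R M σ (dropProg e j) (encList (l.drop j)) (τ + j) q := by
  induction j with
  | zero => exact he
  | succ j ih =>
    refine (Comp.op1 .snd (ih (by omega)) ?_).mono (by omega) le_rfl
    rw [List.drop_eq_getElem_cons (by omega : j < l.length)]
    rfl

theorem comp_fst_dropProg {σ : List (Val F)} {e : Prog F} {τ q : ℕ} (v : Fin m → Val F)
    (he : Comp O R M σ e (encList (List.ofFn v)) τ q) (j : Fin m) :
    Comp O R M σ (.op1 .fst (dropProg e j)) (v j) (τ + j + 1) q := by
  refine Comp.op1 .fst (comp_dropProg _ he j (by simp [j.2.le])) ?_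
  rw [List.drop_eq_getElem_cons (by simp : (j : ℕ) < (List.ofFn v).length)]
  simp [encList, Op1.app]

variable {V : List F → Prop} {g : (Fin n → List F) → List (Fin n → F)} {G : Prog F} {T D : ℕ}

/-- The program `G` computes the function `g` without queries in time `2 * T`, and the lists that
it outputs are of size at most `L` and small enough to be written in time `T`. -/
structure ColumnProg (O : Val F → Val F) (R : ℕ → ℕ) (M : ℕ) (V : List F → Prop)
    (g : (Fin n → List F) → List (Fin n → F)) (G : Prog F) (L T : ℕ) : Prop where
  comp : ∀ l : Fin n → List F, (∀ a, V (l a)) → ∀ σ,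
    Comp O R M (encList (List.ofFn fun a => encSyms (l a)) :: σ) G (encWords (g l)) (2 * T) 0
  length_le : ∀ l : Fin n → List F, (∀ a, V (l a)) → (g l).length ≤ L
  length_mul_le : ∀ l : Fin n → List F, (∀ a, V (l a)) → (g l).length * n ≤ T

theorem comp_candidatesProg (hg : ColumnProg O R M V g G L T) (r : List (Val F))
    (l : (Fin (s + 1) → Fin n) → List F) (hl : ∀ i, V (l i))
    (hO : ∀ i, O (encList (r.reverseAux (idxList i))) = encSyms (l i))
    (i : Fin (s + 1) → Fin n) (x a : Val F) (σ : List (Val F)) :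
    Comp O R M (x :: encIdx i :: a :: encList r :: σ) (candidatesProg G n r.length)
      (encWords (g fun a => l (Fin.cons a (Fin.tail i))))
      (n * (8 * r.length + 9) + 2 * T + 7) n := by
  refine (Comp.bind (.bind (.var 3 rfl) (.bind (u := encList (idxList (Fin.tail i)))
    (.op1 .snd (.var 2 rfl) ?_) (comp_columnProg _ _ _ _ fun a => ?_)))
    (hg.comp (fun a => l (Fin.cons a (Fin.tail i))) (fun _ => hl _) _)).mono ?_ (by omega)
  · change Op1.app .snd (encList (idxList i)) = _
    rw [idxList_eq_cons]; rfl
  · rw [← idxList_cons, hO]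
  · omega

/-- A level makes m calls of the level below and one list recovery of its own, with n queries. If U
bounds the time below, the new bound is m * U plus T(8D + 130)m^(s+2), and the second summand covers
the overhead, which is quadratic in m. D bounds the length of the prefix that every oracle query
must restore. -/
theorem comp_recoverProg (hg : ColumnProg O R M V g G L T) (hn : 1 ≤ n) (hm : 1 ≤ m)
    (hT : n ≤ T)
    (S : Fin s → Fin m → Fin n) (f : (Fin s → Fin m) → Fin L) (r : List (Val F))
    (hr : r.length + s ≤ D)
    (l : (Fin (s + 1) → Fin n) → List F) (hl : ∀ i, V (l i))
    (hO : ∀ i, O (encList (r.reverseAux (idxList i))) = encSyms (l i))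
    (i : Fin (s + 1) → Fin n) (σ : List (Val F)) :
    Comp O R M (encIdx i :: encDesc s S f :: encList r :: σ)
      (recoverProg G n m L θ s r.length) (.sym (recover g θ s S f l i))
      (T * (8 * D + 130) * (s + 1) * m ^ (s + 1)) (n * (s + 1) * m ^ s) := by
  induction s generalizing r σ with
  | zero =>
    have hl' : ∀ a : Fin n, V (l (Fin.cons a (Fin.tail i))) := fun _ => hl _
    have hi : (encIdx i : Val F) = .pair (.nat (i 0)) (encList (idxList (Fin.tail i))) := by
      change encList (idxList i) = _
      rw [idxList_eq_cons]; rfl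
    set w := g fun a => l (Fin.cons a (Fin.tail i)) with hw
    have h1 := hg.length_mul_le _ hl'
    rw [← hw] at h1
    have h2 : w.length ≤ T := (Nat.le_mul_of_pos_right _ hn).trans h1
    have h3 : r.length ≤ D := by omega
    have hopt : (w.map fun c => encSyms (List.ofFn c)).getD (f Fin.elim0) .nil =
        encOption (w[(f Fin.elim0 : ℕ)]?) := by
      rw [List.getD, List.getElem?_map]
      cases w[(f Fin.elim0 : ℕ)]? <;> rfl
    have hnth := comp_nthProg (O := O) (R := R) (M := M) (f Fin.elim0).2
      (w.map fun c => encSyms (List.ofFn c))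
    rw [hopt] at hnth
    have hc := comp_candidatesProg hg r l hl hO i (encDesc 0 S f) (encDesc 0 S f) σ
    rw [hi] at hc ⊢
    refine (Comp.bind (.var 1 rfl) (.bind (.bind hc (.bind (.var 1 rfl) (hnth _)))
      (comp_pickProg _ _ _ _ _))).mono ?_ (by simp)
    simp only [List.length_map]
    have h4 : n * (8 * r.length + 9) ≤ T * (8 * D + 9) := Nat.mul_le_mul hT (by omega)
    have h5 : T * (8 * D + 130) ≤ T * (8 * D + 130) * (0 + 1) * m ^ (0 + 1) := by
      simpa using Nat.le_mul_of_pos_right _ hm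
    have h6 : T * (8 * D + 130) = T * (8 * D + 9) + 121 * T := by ring
    have h7 := min_le_right (f Fin.elim0 : ℕ) w.length
    omega
  | succ s ih =>
    have hl' : ∀ a : Fin n, V (l (Fin.cons a (Fin.tail i))) := fun _ => hl _
    have hi : (encIdx i : Val F) = .pair (.nat (i 0)) (encIdx (Fin.tail i)) := by
      change encList (idxList i) = _
      rw [idxList_eq_cons]; rfl
    set w := g fun a => l (Fin.cons a (Fin.tail i)) with hw
    have h1 := hg.length_mul_le _ hl'
    rw [← hw] at h1
    have h2 : w.length ≤ T := (Nat.le_mul_of_pos_right _ hn).trans h1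
    have h3 : r.length ≤ D := by omega
    set y : Fin m → F := fun j => recover g θ s (Fin.tail S) (fun u => f (Fin.cons j u))
        (fun i' => l (Fin.cons (S 0 j) i')) (Fin.tail i) with hy
    set smp : List (Fin n × F) := List.ofFn fun j => (S 0 j, y j) with hsmp
    have hlen : smp.length = m := by simp [hsmp]
    set U := T * (8 * D + 130) * (s + 1) * m ^ (s + 1) with hU
    set Q := n * (s + 1) * m ^ s with hQ
    have hs : Comp O R M (encIdx i :: encDesc (s + 1) S f :: encList r :: σ)
        (listProg (List.ofFn fun j : Fin m =>
        .bind (.op1 .fst (dropProg (.var 1) j))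
          (.op2 .pair (.op1 .fst (.var 0))
            (.bind (.op2 .pair (.op1 .fst (.var 0)) (.var 3))
              (.bind (.op1 .snd (.var 1))
                (.bind (.op1 .snd (.var 3)) (recoverProg G n m L θ s (r.length + 1))))))))
        (encSample smp) (m * (m + U + 17) + 1) (m * Q) := by
      have : (encSample smp : Val F) = encList (List.ofFn fun j =>
          .pair (.nat (S 0 j)) (.sym (y j))) := by
        rw [encSample, hsmp, List.map_ofFn]; rfl
      rw [this]
      refine (Comp.listProg_ofFn (τ := m + U + 16) (q := Q) fun j => ?_).mono
        (by ring_nf; omega) le_rfl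
      -- The recursive call works in the slice of a sampled row. The prefix is stored in reverse, so
      -- that passing to the slice is a single pairing.
      have hrec := ih (Fin.tail S) (fun u => f (Fin.cons j u)) (.nat (S 0 j) :: r)
        (by simp only [List.length_cons]; omega) (fun i' => l (Fin.cons (S 0 j) i'))
        (fun _ => hl _) (fun i' => by
          rw [← hO, idxList_cons]; rfl) (Fin.tail i)
      refine (Comp.bind (comp_fst_dropProg (fun j => .pair (.nat (S 0 j))
          (encDesc s (Fin.tail S) fun u => f (Fin.cons j u))) (.var 1 rfl) j)
        (.op2 .pair (.op1 .fst (.var 0 rfl) rfl)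
          (.bind (u := encList (.nat (S 0 j) :: r))
            (.op2 .pair (.op1 .fst (.var 0 rfl) rfl) (.var 3 rfl) rfl)
            (.bind (u := encDesc s (Fin.tail S) fun u => f (Fin.cons j u))
              (.op1 .snd (.var 1 rfl) rfl) (.bind (u := encIdx (Fin.tail i)) (.op1 .snd (.var 3 rfl) ?_) (hrec _)))) rfl)).mono ?_ ?_
      · rw [hi]; rfl
      · have := j.2
        omega
      · omega
    have hc := comp_candidatesProg hg r l hl hO i (encSample smp) (encDesc (s + 1) S f) σ
    have hsel := comp_selectProg (O := O) (R := R) (M := M) (θ := θ) w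
      (hg.length_le _ hl') smp
    rw [hlen] at hsel
    rw [hi] at hs hc ⊢
    refine (Comp.bind hs (.bind (.bind hc (hsel _)) (comp_pickProg _ _ _ _ _))).mono ?_ ?_
    · have h4 : n * (8 * r.length + 9) ≤ T * (8 * D + 9) := Nat.mul_le_mul hT (by omega)
      -- Comparing all candidates with the sample reads the whole list of words. This is affordable
      -- because that list was itself written within time T, so its length times n is at most T.
      have h5 : w.length * (m * (13 * n + 26) + 16) ≤ T * (39 * m + 16) := by
        calc w.length * (m * (13 * n + 26) + 16)
            = 13 * m * (w.length * n) + w.length * (26 * m + 16) := by ring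
          _ ≤ 13 * m * T + T * (26 * m + 16) := by gcongr
          _ = _ := by ring
      have h6 : T * (8 * D + 130) * (s + 1 + 1) * m ^ (s + 1 + 1)
          = m * U + T * (8 * D + 130) * m ^ (s + 1 + 1) := by rw [hU]; ring
      have h7 : T * (8 * D + 130) * (m * m) ≤ T * (8 * D + 130) * m ^ (s + 1 + 1) := by
        refine Nat.mul_le_mul_left _ ?_
        rw [← sq]
        exact Nat.pow_le_pow_right hm (by omega)
      have h8 : m * 1 ≤ m * m := Nat.mul_le_mul_left _ hm
      have h9 : T * (8 * D + 9) + T * (m * m) + T * (56 * m + 64) ≤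
          T * (8 * D + 130) * (m * m) := by
        have : 8 * D ≤ 8 * D * (m * m) := Nat.le_mul_of_pos_right _ (by omega)
        calc _ = T * (8 * D + m * m + 56 * m + 73) := by ring
          _ ≤ T * ((8 * D + 130) * (m * m)) := by
            refine Nat.mul_le_mul_left _ ?_
            rw [Nat.add_mul]
            omega
          _ = _ := by ring
      have h10 : m * m ≤ T * (m * m) := Nat.le_mul_of_pos_left _ (by omega)
      have h11 : m ≤ T * m := Nat.le_mul_of_pos_left _ (by omega)
      have h12 : m * (m + U + 17) = m * m + m * U + 17 * m := by ring
      have h13 : T * (39 * m + 16) = 39 * (T * m) + 16 * T := by ring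
      have h14 : T * (56 * m + 64) = 56 * (T * m) + 64 * T := by ring
      omega
    · have h6 : n * (s + 1 + 1) * m ^ (s + 1) = m * Q + n * m ^ (s + 1) := by rw [hQ]; ring
      have h7 : n ≤ n * m ^ (s + 1) := Nat.le_mul_of_pos_right _ (by positivity)
      omega

end Recover

/-! ### The list recovery algorithm for columns -/

theorem size_encWords {F : Type*} {n : ℕ} (l : List (Fin n → F)) :
    (encWords l : Val F).size = l.length * (2 * n + 2) + 1 := by
  have h (l : List F) : (encSyms l : Val F).size = 2 * l.length + 1 := by
    induction l with
    | nil => simp [encSyms, encList, Val.size]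
    | cons a l ih =>
      simp only [encSyms, List.map_cons, encList, Val.size, List.length_cons] at ih ⊢
      omega
  induction l with
  | nil => simp [encWords, encList, Val.size]
  | cons a l ih =>
    simp only [encWords, List.map_cons, encList, Val.size, List.length_cons, h,
      List.length_ofFn] at ih ⊢
    rw [ih]
    ring

section Column

variable {F : Type*} [Field F] {n k ℓ L T : ℕ} {α : ℝ}

/-- The list `l` enumerates a set of size `ℓ`. -/
def IsSetList (ℓ : ℕ) (l : List F) : Prop := l.Nodup ∧ l.length = ℓ

/-- A deterministic program as a subprogram without queries and coins. -/
def pureProg (p : Prog F) : Prog F :=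
  simulate (fun _ => .nil) (fun e => .bind e (.nat 0)) 1 p

/-- The factor 2 pays for the queries: there are at most τ of them, and replacing one by the answer
`.nil` costs one extra step. A coin costs at least two steps beyond its argument, enough for the
constant `0`. -/
theorem comp_pureProg {O : Val F → Val F} {R : ℕ → ℕ} {M N : ℕ} (hN : 0 < N) {p : Prog F}
    {u v : Val F} {τ q : ℕ} (h : Eval noOracle (fun _ => 0) N [u] p v τ q) (σ : List (Val F)) :
    Comp O R M (u :: σ) (pureProg p) v (2 * τ) 0 := by
  have hq := h.queries_le
  refine (Comp.simulate (σ := [u]) (ext := σ) (κ := 1) (κ' := 0) (fun _ _ => Comp.nil)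
    (fun σ e v τ q he => ?_) h).mono (by omega) (by omega)
  have : 0 < Nat.size N := Nat.size_pos.2 hN
  exact (Comp.bind he (.nat 0)).mono (by omega) le_rfl

/-- What the global list recovery algorithm for `C` computes. -/
structure ListRecovery (C : (Fin k → F) → (Fin n → F)) (α : ℝ) (ℓ : ℕ)
    (g : (Fin n → List F) → List (Fin n → F)) : Prop where
  mem_range : ∀ l : Fin n → List F, (∀ a, IsSetList ℓ (l a)) → ∀ c ∈ g l, c ∈ Set.range C
  mem : ∀ l : Fin n → List F, (∀ a, IsSetList ℓ (l a)) → ∀ c ∈ Set.range C,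
    (Nat.card {a // c a ∉ l a} : ℝ) ≤ α * n → c ∈ g l

theorem GlobalRecoverer.exists_columnProg {C : (Fin k → F) → (Fin n → F)} (hn : 1 ≤ n) {G : Alg F}
    (h : GlobalRecoverer C α ℓ L T G) :
    ∃ g, ListRecovery C α ℓ g ∧ ∀ (O : Val F → Val F) (R : ℕ → ℕ) (M : ℕ),
      ColumnProg O R M (IsSetList ℓ) g (pureProg G.prog) L T := by
  classical
  have key (l : Fin n → List F) : ∃ out : List (Fin n → F), (∀ a, IsSetList ℓ (l a)) →
      out.length ≤ L ∧ (∀ c ∈ out, c ∈ Set.range C) ∧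
      (∀ x, listDist (C x) (fun a => (l a).toFinset) ≤ α → C x ∈ out) ∧
      ∀ ω, ∃ τ q, G.Run noOracle ω (encList (List.ofFn fun i => encSyms (l i)))
        (encList (out.map fun c => encSyms (List.ofFn c))) τ q ∧ τ ≤ T := by
    by_cases hl : ∀ a, IsSetList ℓ (l a)
    · obtain ⟨out, ho⟩ := h.2 (fun a => (l a).toFinset) l
        fun a => ⟨(hl a).1, (hl a).2, fun b => by simp⟩
      exact ⟨out, fun _ => ho⟩
    · exact ⟨[], fun h => absurd h hl⟩
  choose g hg using key
  refine ⟨g, ⟨fun l hl => (hg l hl).2.1, ?_⟩, fun O R M => ⟨?_, fun l hl => (hg l hl).1, ?_⟩⟩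
  · rintro l hl _ ⟨x, rfl⟩ hx
    refine (hg l hl).2.2.1 x ?_
    have hn' : (0 : ℝ) < n := by exact_mod_cast hn
    rw [listDist, Nat.card_eq_fintype_card (α := Fin n), Fintype.card_fin, div_le_iff₀ hn']
    simpa using hx
  · intro l hl σ
    obtain ⟨τ, q, ⟨s, hs, rfl⟩, hτ⟩ := (hg l hl).2.2.2 fun _ => ⟨0, G.base_pos⟩
    -- A deterministic algorithm has an empty tape, so every coin reads `0`.
    have hc : (G.cells fun _ => ⟨0, G.base_pos⟩) = fun _ => 0 := by
      funext j
      simp [Alg.cells, h.1]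
    rw [hc] at hs
    exact (comp_pureProg G.base_pos hs σ).mono (by omega) le_rfl
  · intro l hl
    obtain ⟨τ, q, ⟨s, hs, rfl⟩, hτ⟩ := (hg l hl).2.2.2 fun _ => ⟨0, G.base_pos⟩
    change s + (encWords (g l) : Val F).size ≤ T at hτ
    rw [size_encWords] at hτ
    have : (g l).length * n ≤ (g l).length * (2 * n + 2) := Nat.mul_le_mul_left _ (by omega)
    omega

/-- Translating a valid list so that it contains 0, and using it at every coordinate, forces the
zero codeword into the output; writing one word already takes time n. This lets T absorb all
overheads linear in n. -/
theorem ListRecovery.le_time {C : (Fin k → F) →ₗ[F] (Fin n → F)}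
    {g : (Fin n → List F) → List (Fin n → F)} (hg : ListRecovery C α ℓ g) (hα : 0 < α)
    {O : Val F → Val F} {R : ℕ → ℕ} {M : ℕ} {G : Prog F}
    (hG : ColumnProg O R M (IsSetList ℓ) g G L T) (hℓ : 1 ≤ ℓ) {l : List F}
    (hl : IsSetList ℓ l) : n ≤ T := by
  obtain ⟨y, hy⟩ := List.exists_mem_of_length_pos (by rw [hl.2]; omega : 0 < l.length)
  have hl' : ∀ _ : Fin n, IsSetList ℓ (l.map (· - y)) := fun _ =>
    ⟨hl.1.map sub_left_injective, by rw [List.length_map, hl.2]⟩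
  have h0 : (0 : F) ∈ l.map (· - y) := List.mem_map.2 ⟨y, hy, sub_self y⟩
  have := hg.mem (fun _ => l.map (· - y)) hl' 0 ⟨0, map_zero C⟩ (by
    have : IsEmpty {a : Fin n // (0 : Fin n → F) a ∉ l.map (· - y)} := ⟨fun a => a.2 h0⟩
    rw [Nat.card_of_isEmpty, Nat.cast_zero]
    positivity)
  have h1 := hG.length_mul_le _ hl'
  exact (Nat.le_mul_of_pos_left _ (List.length_pos_of_mem this)).trans h1

end Column

/-! ### The local algorithm -/

section Local

variable {F : Type*} [Field F] {O : Val F → Val F} {R : ℕ → ℕ} {M : ℕ}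

/-- With environment `v, …`: whether `v` is a coordinate of a word indexed by `t`-tuples of elements
of `{0, …, k - 1}`. -/
def checkProg (k : ℕ) : ℕ → Prog F
  | 0 => .ite (.var 0) .nil (.nat 1)
  | t + 1 => .ite (.op2 .lt (.op1 .fst (.var 0)) (.nat k))
      (.bind (.op1 .snd (.var 0)) (checkProg k t)) .nil

theorem comp_checkProg_encIdx {k t : ℕ} (i : Fin t → Fin k) (σ : List (Val F)) :
    Comp O R M (encIdx i :: σ) (checkProg k t) (.nat 1) (8 * t + 3) 0 := by
  induction t generalizing σ with
  | zero => exact (Comp.iteFalse (.var 0 rfl) (.nat 1)).mono (by omega) le_rfl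
  | succ t ih =>
    have hi : (encIdx i : Val F) = .pair (.nat (i 0)) (encIdx (Fin.tail i)) := by
      change encList (idxList i) = _
      rw [idxList_eq_cons]; rfl
    rw [hi]
    refine (Comp.iteTrue (.op2 .lt (.op1 .fst (.var 0 rfl) rfl) (.nat k) rfl) ?_
      (.bind (u := encIdx (Fin.tail i)) (.op1 .snd (.var 0 rfl) rfl) (ih _ _))).mono
      (by omega) le_rfl
    simp [Op1.app, Op2.app, Val.ofProp]

/-- The local decoder may query values that are not coordinates. The word oracle answers `.nil` to
these, and the simulation has to agree with it. -/
theorem comp_checkProg_nil {k t : ℕ} (v : Val F) (h : ¬∃ i : Fin t → Fin k, v = encIdx i)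
    (σ : List (Val F)) : Comp O R M (v :: σ) (checkProg k t) .nil (8 * t + 3) 0 := by
  induction t generalizing v σ with
  | zero =>
    refine (Comp.iteTrue (.var 0 rfl) (fun hv => h ⟨Fin.elim0, ?_⟩) .nil).mono (by omega) le_rfl
    exact hv
  | succ t ih =>
    by_cases hv : ∃ a v', v = .pair (.nat a) v' ∧ a < k
    · obtain ⟨a, v', rfl, ha⟩ := hv
      refine (Comp.iteTrue (.op2 .lt (.op1 .fst (.var 0 rfl) rfl) (.nat k) rfl) ?_
        (.bind (u := v') (.op1 .snd (.var 0 rfl) rfl) (ih v' ?_ _))).mono (by omega) le_rfl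
      · simp [Op1.app, Op2.app, Val.ofProp, ha]
      · rintro ⟨i, rfl⟩
        refine h ⟨Fin.cons ⟨a, ha⟩ i, ?_⟩
        change _ = encList (idxList _)
        rw [idxList_cons]; rfl
    · refine (Comp.iteFalse (.op2 .lt (.op1 .fst (.var 0 rfl) rfl) (.nat k) ?_) .nil).mono
        (by omega) le_rfl
      -- For operands of the wrong kind the comparison yields `.nil`, so only a pair headed by a
      -- word needs an argument.
      rcases v with _ | _ | _ | ⟨u, w⟩ <;> try rfl
      rcases u with _ | a | _ | _ <;> try rfl
      have : ¬a < k := fun ha => hv ⟨a, w, rfl, ha⟩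
      simp [Op1.app, Op2.app, Val.ofProp, this]

variable {n k m s L θ T ℓ : ℕ}

/-- With environment `v, σ, a` where `σ` is of size `d`: the answer to the query `v` for the
description `a`. -/
def answerProg (G : Prog F) (n k m L θ s d : ℕ) : Prog F :=
  .ite (checkProg k (s + 1))
    (.bind .nil (.bind (.var (d + 2)) (.bind (.var 2) (recoverProg G n m L θ s 0)))) .nil

/-- The local algorithm runs the local decoder `B` and answers its queries by `answerProg`. -/
abbrev localAlg (B : Alg F) (G : Prog F) (n k m L θ s : ℕ) : Alg F :=
  { B with prog := .bind (.op1 .fst (.var 0)) (.bind (.op1 .snd (.var 1))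
      (simulate (answerProg G n k m L θ s) .coin 1 B.prog)) }

/-- The function that `recover` defines on the systematic coordinates is an honest word, fixed by
the description and the input lists. Hence the decoder's run with this word as oracle can be
transferred step by step, each query being replaced by a recovery. -/
theorem run_localAlg {B : Alg F} {G : Prog F} {V : List F → Prop}
    {g : (Fin n → List F) → List (Fin n → F)}
    (hg : ∀ (O : Val F → Val F) (R : ℕ → ℕ) (M : ℕ), ColumnProg O R M V g G L T)
    (hn : 1 ≤ n) (hm : 1 ≤ m) (hT : n ≤ T) (hk : k ≤ n)
    (S : Fin s → Fin m → Fin n) (f : (Fin s → Fin m) → Fin L)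
    (l : (Fin (s + 1) → Fin n) → List F) (hl : ∀ i, V (l i)) {ω : B.Tape} {i : ℕ} {out : Val F}
    {τ q : ℕ}
    (h : B.Run (wordOracle fun j : Fin (s + 1) → Fin k =>
      recover g θ s S f l fun a => Fin.castLE hk (j a)) ω (.nat i) out τ q) :
    ∃ τ' q', (localAlg B G n k m L θ s).Run (listOracle l) ω (.pair (encDesc s S f) (.nat i)) out
      τ' q' ∧ τ' ≤ τ + q * (T * (8 * s + 130) * (s + 1) * m ^ (s + 1) + 8 * s + 18) + 6 ∧
      q' ≤ q * (n * (s + 1) * m ^ s) := by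
  obtain ⟨x, hx, rfl⟩ := h
  have key := Comp.simulate (O' := listOracle l) (R' := B.cells ω) (M' := B.base)
    (Q := answerProg G n k m L θ s) (K := .coin) (σ := [.nat i])
    (ext := [encDesc s S f, .pair (encDesc s S f) (.nat i)])
    (κ := T * (8 * s + 130) * (s + 1) * m ^ (s + 1) + 8 * s + 18)
    (κ' := n * (s + 1) * m ^ s)
    (fun v σ => ?_) (fun σ e v τ q he => .coin he) hx
  · obtain ⟨τ', q', he, hτ', hq'⟩ := Comp.bind (σ := [.pair (encDesc s S f) (.nat i)])
      (.op1 (u := .pair (encDesc s S f) (.nat i)) (v := encDesc s S f) .fst (.var 0 rfl) rfl)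
      (.bind (u := .nat i) (.op1 .snd (.var 1 rfl) rfl) key)
    exact ⟨_, _, ⟨τ', he, rfl⟩, by omega, by omega⟩
  · by_cases hv : ∃ j : Fin (s + 1) → Fin k, v = encIdx j
    · obtain ⟨j, rfl⟩ := hv
      rw [wordOracle, oracle_encIdx]
      refine (Comp.iteTrue (comp_checkProg_encIdx j _) (by simp) (.bind .nil
        (.bind (u := encDesc s S f) (.var _ ?_) (.bind (u := encIdx j) (.var 2 rfl)
        (comp_recoverProg (hg _ _ _) hn hm hT S f [] (D := s) (by simp) l hl ?_
          (fun a => Fin.castLE hk (j a)) _))))).mono (by omega) (by omega)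
      -- The description is the first entry of `ext`: it lies behind the empty prefix just bound,
      -- the query, and the `σ.length` values of the decoder.
      · simp [List.getD]
      · exact oracle_encIdx _
    · rw [wordOracle, oracle, dif_neg hv]
      exact (Comp.iteFalse (comp_checkProg_nil _ hv _) .nil).mono (by omega) (by omega)

end Local

/-! ### The preprocessing algorithm -/

section Preprocessing

/-- The description for the advice `f` and the sampled coordinates on the random tape. -/
def descProg {F : Type*} {m L : ℕ} :
    (s : ℕ) → (Fin s → Fin m → ℕ) → ((Fin s → Fin m) → Fin L) → Prog F
  | 0, _, f => .nat (f Fin.elim0)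
  | s + 1, p, f => listProg (List.ofFn fun j =>
      .op2 .pair (.coin (.nat (p 0 j))) (descProg s (Fin.tail p) fun u => f (Fin.cons j u)))

theorem size_encList_ofFn_le {F : Type*} {m c : ℕ} (v : Fin m → Val F) (h : ∀ j, (v j).size ≤ c) :
    (encList (List.ofFn v)).size ≤ m * (c + 1) + 1 := by
  induction m with
  | zero => simp [encList, Val.size]
  | succ m ih =>
    rw [List.ofFn_succ, encList, Val.size]
    have h1 := ih (fun j => v j.succ) fun j => h _
    have h2 := h 0
    rw [Nat.add_mul]
    omega

theorem size_encList_map_le {F ι : Type*} {c : ℕ} (l : List ι) (v : ι → Val F)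
    (h : ∀ j, (v j).size ≤ c) : (encList (l.map v)).size ≤ l.length * (c + 1) + 1 := by
  induction l with
  | nil => simp [encList, Val.size]
  | cons a l ih =>
    rw [List.map_cons, encList, Val.size, List.length_cons, Nat.add_mul]
    have h2 := h a
    omega

variable {F : Type*} {n m s L : ℕ}

/-- The induction step shared by the size of a description and the time to produce it: m branches,
each with one coordinate of at most `n.size` bits. -/
theorem desc_cost_step (hm : 1 ≤ m) :
    m * ((n.size + L.size + 6) * (s + 1) * m ^ s + n.size + 4) + 1 ≤
      (n.size + L.size + 6) * (s + 1 + 1) * m ^ (s + 1) := by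
  set W := n.size + L.size + 6 with hW
  have h1 : W * (s + 1 + 1) * m ^ (s + 1) = m * (W * (s + 1) * m ^ s) + W * m ^ (s + 1) := by ring
  have h2 : W * m ≤ W * m ^ (s + 1) := Nat.mul_le_mul_left _ (Nat.le_self_pow (by omega) m)
  have h3 : W * m = n.size * m + L.size * m + 6 * m := by rw [hW]; ring
  have h4 : m * (W * (s + 1) * m ^ s + n.size + 4) =
    m * (W * (s + 1) * m ^ s) + n.size * m + 4 * m := by ring
  omega

theorem size_encDesc_le (hm : 1 ≤ m) (S : Fin s → Fin m → Fin n) (f : (Fin s → Fin m) → Fin L) :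
    (encDesc s S f : Val F).size ≤ (n.size + L.size + 6) * (s + 1) * m ^ s := by
  induction s with
  | zero =>
    have : Nat.size (f Fin.elim0) ≤ L.size := Nat.size_le_size (f Fin.elim0).2.le
    simp only [encDesc, Val.size, pow_zero, mul_one, zero_add]
    omega
  | succ s ih =>
    refine (size_encList_ofFn_le (c := (n.size + L.size + 6) * (s + 1) * m ^ s + n.size + 2) _
      fun j => ?_).trans ?_
    · have h1 := ih (Fin.tail S) fun u => f (Fin.cons j u)
      have h2 : Nat.size (S 0 j) ≤ n.size := Nat.size_le_size (S 0 j).2.le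
      simp only [Val.size]
      omega
    · refine le_trans ?_ (desc_cost_step (n := n) (L := L) (s := s) hm)
      exact Nat.add_le_add_right (Nat.mul_le_mul_left _ (by omega)) 1

/-- The tape is addressable memory, so a cell can be read repeatedly. All branches and all advice
strings therefore refer to the same sampled coordinates, at cost `n.size` per reading. -/
theorem comp_descProg [Field F] {O : Val F → Val F} {R : ℕ → ℕ} (hm : 1 ≤ m)
    (S : Fin s → Fin m → Fin n) (p : Fin s → Fin m → ℕ) (hp : ∀ a j, R (p a j) = S a j)
    (f : (Fin s → Fin m) → Fin L) (σ : List (Val F)) :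
    Comp O R n σ (descProg s p f) (encDesc s S f) ((n.size + L.size + 6) * (s + 1) * m ^ s) 0 := by
  induction s with
  | zero => exact (Comp.nat _).mono (by rw [pow_zero]; omega) le_rfl
  | succ s ih =>
    refine (Comp.listProg_ofFn fun j => Comp.op2 .pair (.coin (.nat _))
      (ih (Fin.tail S) (Fin.tail p) (fun a j => hp a.succ j) _) ?_).mono ?_ (by simp)
    · simp only [Val.toNat, hp]; rfl
    · refine le_trans (le_of_eq ?_) (desc_cost_step (n := n) (L := L) (s := s) hm)
      ring

/-- All descriptions with the sampled coordinates `S`. -/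
noncomputable def descList (L : ℕ) (S : Fin s → Fin m → Fin n) : List (Val F) :=
  (Finset.univ : Finset ((Fin s → Fin m) → Fin L)).toList.map (encDesc s S)

/-- The preprocessing samples `s` strings of `m` coordinates, and lists all descriptions. -/
noncomputable abbrev preAlg (F : Type*) {n : ℕ} (hn : 0 < n) (m L s : ℕ) : Alg F where
  prog := listProg ((Finset.univ : Finset ((Fin s → Fin m) → Fin L)).toList.map
    (descProg s fun a j => finProdFinEquiv (a, j)))
  tapeLen := s * m
  base := n
  base_pos := hn

/-- The tape of `s * m` coordinates as `s` strings of `m` coordinates. -/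
def tapeEquiv (n m s : ℕ) : (Fin (s * m) → Fin n) ≃ (Fin s → Fin m → Fin n) :=
  (Equiv.arrowCongr finProdFinEquiv.symm (Equiv.refl _)).trans (Equiv.curry _ _ _)

theorem length_descList (S : Fin s → Fin m → Fin n) :
    (descList L S : List (Val F)).length = L ^ m ^ s := by
  simp [descList]

/-- The factor 2 accounts for computing the list of descriptions and for writing it. -/
theorem run_preAlg [Field F] (hn : 0 < n) (hm : 1 ≤ m) (O : Val F → Val F)
    (ω : (preAlg F hn m L s).Tape) :
    ∃ τ, (preAlg F hn m L s).Run O ω .nil (encList (descList L (tapeEquiv n m s ω))) τ 0 ∧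
      τ ≤ 2 * (L ^ m ^ s * ((n.size + L.size + 6) * (s + 1) * m ^ s + 1) + 1) := by
  have hcell (a : Fin s) (j : Fin m) : (preAlg F hn m L s).cells ω (finProdFinEquiv (a, j)) =
      tapeEquiv n m s ω a j := by
    rw [Alg.cells, dif_pos (finProdFinEquiv (a, j)).2]
    rfl
  obtain ⟨x, y, h, hx, hy⟩ := Comp.listProg_map (O := O) (σ := [.nil]) (M := n)
    (Finset.univ : Finset ((Fin s → Fin m) → Fin L)).toList fun f _ =>
      comp_descProg hm (tapeEquiv n m s ω) (fun a j => finProdFinEquiv (a, j)) hcell f _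
  obtain rfl : y = 0 := by simpa using hy
  refine ⟨_, ⟨x, h, rfl⟩, ?_⟩
  have h1 := size_encList_map_le (F := F)
    (Finset.univ : Finset ((Fin s → Fin m) → Fin L)).toList
    (encDesc s (tapeEquiv n m s ω)) (size_encDesc_le hm _)
  have h2 : (Finset.univ : Finset ((Fin s → Fin m) → Fin L)).toList.length = L ^ m ^ s := by simp
  rw [h2] at h1 hx
  rw [descList]
  omega

theorem prob_preAlg (hn : 0 < n) (P : (Fin s → Fin m → Fin n) → Prop) :
    (preAlg F hn m L s).prob (fun ω => P (tapeEquiv n m s ω)) =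
      (Nat.card {S // P S} : ℝ) / Nat.card (Fin s → Fin m → Fin n) := by
  have h1 : Nat.card {ω : (preAlg F hn m L s).Tape // P (tapeEquiv n m s ω)} =
      Nat.card {S // P S} :=
    Nat.card_congr ((tapeEquiv n m s).subtypeEquiv fun _ => Iff.rfl)
  have h2 : Nat.card (preAlg F hn m L s).Tape = Nat.card (Fin s → Fin m → Fin n) :=
    Nat.card_congr (tapeEquiv n m s)
  rw [Alg.prob, h1, h2]

end Preprocessing

/-! ### Sampling -/

section Sampling

open Finset

variable {F : Type*} {n m : ℕ}

/-- A single entry of a uniform sample is uniform. The factor n on the left avoids the exponent m -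
1. -/
theorem sum_apply_eq (h : Fin n → ℝ) (j : Fin m) :
    n * ∑ S : Fin m → Fin n, h (S j) = (n : ℝ) ^ m * ∑ r, h r := by
  have h1 : ∑ S : Fin m → Fin n, h (S j) = (n : ℝ) ^ (m - 1) * ∑ r, h r := by
    rw [← (Equiv.funSplitAt j (Fin n)).symm.sum_comp, Fintype.sum_prod_type, mul_sum]
    refine sum_congr rfl fun r _ => ?_
    simp [Equiv.funSplitAt, Equiv.piSplitAt, Fintype.card_subtype_compl]
  rw [h1, ← mul_assoc, ← pow_succ', Nat.sub_add_cancel (by have := j.2; omega)]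

open Classical in
/-- Few samplings hit few of the coordinates where two distant words differ. -/
theorem card_sample_le {δ : ℝ} (c w : Fin n → F)
    (hδ : δ * n ≤ #{a | c a ≠ w a}) (b : ℕ) :
    (#{S : Fin m → Fin n | #{j | c (S j) ≠ w (S j)} ≤ b} : ℝ) ≤
      2 ^ b * ((1 - δ / 2) ^ m * (n : ℝ) ^ m) := by
  -- An exponential Markov bound: a sampling has weight 2^(-hits), the weights factor over the m
  -- draws with mean at most 1 - δ/2 each, and a sampling with at most b hits weighs at least
  -- 2^(-b).
  set φ : Fin n → ℝ := fun a => if c a ≠ w a then 1 / 2 else 1 with hφ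
  have h1 : ∑ S : Fin m → Fin n, ∏ j, φ (S j) = (∑ a, φ a) ^ m := by
    rw [← Fintype.sum_pow]
  have h2 : ∑ a, φ a ≤ (1 - δ / 2) * n := by
    have : ∀ a, φ a = 1 - (1 / 2) * (if c a ≠ w a then 1 else 0) := by
      intro a
      simp only [hφ]
      split_ifs <;> norm_num
    simp only [this, sum_sub_distrib, ← mul_sum, sum_boole]
    simp only [sum_const, card_univ, Fintype.card_fin, nsmul_eq_mul, mul_one]
    linarith
  have h3 : ∀ a, 0 ≤ φ a := by
    intro a
    simp only [hφ]
    split_ifs <;> norm_num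
  have h4 : ∀ S : Fin m → Fin n, ∏ j, φ (S j) = (1 / 2) ^ #{j | c (S j) ≠ w (S j)} := by
    intro S
    rw [← prod_const, prod_filter]
  have h5 : (#{S : Fin m → Fin n | #{j | c (S j) ≠ w (S j)} ≤ b} : ℝ) * (1 / 2) ^ b ≤
      (∑ a, φ a) ^ m := by
    rw [← h1, ← nsmul_eq_mul, ← sum_const]
    refine (sum_le_sum fun S hS => ?_).trans
      (sum_le_univ_sum_of_nonneg fun S => prod_nonneg fun j _ => h3 _)
    rw [h4]
    exact pow_le_pow_of_le_one (by norm_num) (by norm_num) (mem_filter.1 hS).2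
  have h6 : (∑ a, φ a) ^ m ≤ ((1 - δ / 2) * n) ^ m :=
    pow_le_pow_left₀ (sum_nonneg fun a _ => h3 a) h2 m
  rw [← mul_pow]
  calc _ = 2 ^ b * ((#{S : Fin m → Fin n | #{j | c (S j) ≠ w (S j)} ≤ b} : ℝ) * (1 / 2) ^ b) := by
        rw [mul_left_comm, ← mul_pow]; norm_num
    _ ≤ _ := by
        gcongr
        exact h5.trans h6

open Classical in
theorem mismatch_ofFn (c : Fin n → F) (S : Fin m → Fin n) (y : Fin m → F) :
    mismatch c (List.ofFn fun j => (S j, y j)) = #{j | c (S j) ≠ y j} := by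
  rw [mismatch, List.map_ofFn, List.sum_ofFn, card_filter]
  refine sum_congr rfl fun j _ => ?_
  simp

end Sampling

/-! ### The advice and its errors -/

section Analysis

open Finset

variable {F : Type*} [Field F] {n k m s L θ ℓ : ℕ} {α δ : ℝ}

/-- All columns of `W`, in every direction, belong to the code `A`. -/
def IsTensor (A : Set (Fin n → F)) : (s : ℕ) → ((Fin s → Fin n) → F) → Prop
  | 0, _ => True
  | s + 1, W => (∀ i', (fun a => W (Fin.cons a i')) ∈ A) ∧
      ∀ r, IsTensor A s fun i' => W (Fin.cons r i')

open Classical in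
/-- The advice that describes the word `W`. -/
noncomputable def advice (g : (Fin n → List F) → List (Fin n → F)) (hL : 0 < L) :
    (s : ℕ) → (Fin s → Fin m → Fin n) → ((Fin (s + 1) → Fin n) → List F) →
      ((Fin (s + 1) → Fin n) → F) → (Fin s → Fin m) → Fin L
  | 0, _, l, W, _ =>
    let p := (g fun a => l (Fin.cons a Fin.elim0)).idxOf fun a => W (Fin.cons a Fin.elim0)
    if h : p < L then ⟨p, h⟩ else ⟨0, hL⟩
  | s + 1, S, l, W, u => advice g hL s (Fin.tail S) (fun i' => l (Fin.cons (S 0 (u 0)) i'))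
      (fun i' => W (Fin.cons (S 0 (u 0)) i')) (Fin.tail u)

/-- The recovery at `i` with the right advice fails. -/
def Wrong (g : (Fin n → List F) → List (Fin n → F)) (θ : ℕ) (hL : 0 < L) (s : ℕ)
    (S : Fin s → Fin m → Fin n) (l : (Fin (s + 1) → Fin n) → List F)
    (W : (Fin (s + 1) → Fin n) → F) (i : Fin (s + 1) → Fin n) : Prop :=
  recover g θ s S (advice g hL s S l W) l i ≠ W i

open Classical in
/-- The column of `W` through `i'` is far from the input lists. -/
def FarColumn (α : ℝ) (l : (Fin (s + 1) → Fin n) → List F) (W : (Fin (s + 1) → Fin n) → F)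
    (i' : Fin s → Fin n) : Prop :=
  α * n < #{a | W (Fin.cons a i') ∉ l (Fin.cons a i')}

open Classical in
/-- The sampled coordinates `S` do not separate `w` from another word of the list `c`. -/
def BadSample (θ : ℕ) (c : List (Fin n → F)) (w : Fin n → F) (S : Fin m → Fin n) : Prop :=
  ∃ v ∈ c, v ≠ w ∧ #{j | v (S j) ≠ w (S j)} ≤ 2 * θ

/-- The properties of list recovery that the analysis uses. -/
structure RecoversLists (A : Set (Fin n → F)) (α δ : ℝ) (V : List F → Prop)
    (g : (Fin n → List F) → List (Fin n → F)) (L : ℕ) : Prop where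
  length_le : ∀ l : Fin n → List F, (∀ a, V (l a)) → (g l).length ≤ L
  mem_code : ∀ l : Fin n → List F, (∀ a, V (l a)) → ∀ c ∈ g l, c ∈ A
  mem : ∀ l : Fin n → List F, (∀ a, V (l a)) → ∀ c ∈ A,
    (open Classical in (#{a | c a ∉ l a} : ℝ) ≤ α * n) → c ∈ g l
  dist : ∀ c ∈ A, ∀ w ∈ A, c ≠ w → (open Classical in δ * n ≤ #{a | c a ≠ w a})

variable {A : Set (Fin n → F)} {V : List F → Prop} {g : (Fin n → List F) → List (Fin n → F)}
  {hL : 0 < L}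

/-- A near column is in the candidate list, and its index there is below L, so the advice stores
this index itself and not the default. -/
theorem farColumn_of_wrong_zero (hg : RecoversLists A α δ V g L)
    {S : Fin 0 → Fin m → Fin n} {l : (Fin 1 → Fin n) → List F} (hl : ∀ i, V (l i))
    {W : (Fin 1 → Fin n) → F} (hW : IsTensor A 1 W) {i : Fin 1 → Fin n}
    (h : Wrong g θ hL 0 S l W i) : FarColumn α l W (Fin.tail i) := by
  classical
  contrapose h
  rw [FarColumn, not_lt] at h
  have ht : Fin.tail i = Fin.elim0 := Subsingleton.elim _ _
  rw [ht] at h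
  have hm := hg.mem _ (fun a => hl (Fin.cons a Fin.elim0)) _ (hW.1 Fin.elim0) h
  have hlt := List.idxOf_lt_length_of_mem hm
  have hlt' := hlt.trans_le (hg.length_le _ fun a => hl (Fin.cons a Fin.elim0))
  rw [Wrong, not_not, recover, ht]
  simp only [advice]
  rw [dif_pos hlt']
  simp only
  rw [List.getElem?_eq_getElem hlt, List.getElem_idxOf hlt, Option.elim_some, ← ht]
  exact congrArg W (Fin.cons_self_tail i)

-- The true column is a candidate and passes the test, because its mismatches are exactly the wrong
-- recursive answers. Any other candidate that passes would agree with it too often on the sample.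
open Classical in
theorem not_wrong_succ (hg : RecoversLists A α δ V g L)
    {S : Fin (s + 1) → Fin m → Fin n} {l : (Fin (s + 2) → Fin n) → List F} (hl : ∀ i, V (l i))
    {W : (Fin (s + 2) → Fin n) → F} (hW : IsTensor A (s + 2) W) {i : Fin (s + 2) → Fin n}
    (h : ¬FarColumn α l W (Fin.tail i))
    (h' : ¬BadSample θ (g fun a => l (Fin.cons a (Fin.tail i)))
      (fun a => W (Fin.cons a (Fin.tail i))) (S 0))
    (hs : #{j | Wrong g θ hL s (Fin.tail S) (fun i' => l (Fin.cons (S 0 j) i'))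
      (fun i' => W (Fin.cons (S 0 j) i')) (Fin.tail i)} ≤ θ) :
    ¬Wrong g θ hL (s + 1) S l W i := by
  rw [FarColumn, not_lt] at h
  have hm := hg.mem _ (fun a => hl (Fin.cons a (Fin.tail i))) _ (hW.1 (Fin.tail i)) h
  set w : Fin n → F := fun a => W (Fin.cons a (Fin.tail i)) with hw
  set y : Fin m → F := fun j => recover g θ s (Fin.tail S)
    (fun u => advice g hL (s + 1) S l W (Fin.cons j u))
    (fun i' => l (Fin.cons (S 0 j) i')) (Fin.tail i) with hy
  -- The right advice for the word restricts, along a sampled row, to the right advice for the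
  -- slice, so the recursive answers are those that `Wrong` speaks of.
  have hadv : ∀ j, (fun u => advice g hL (s + 1) S l W (Fin.cons j u)) =
      advice g hL s (Fin.tail S) (fun i' => l (Fin.cons (S 0 j) i'))
        (fun i' => W (Fin.cons (S 0 j) i')) := by
    intro j
    funext u
    simp [advice]
  have hy' : ∀ j, w (S 0 j) ≠ y j ↔ Wrong g θ hL s (Fin.tail S)
      (fun i' => l (Fin.cons (S 0 j) i')) (fun i' => W (Fin.cons (S 0 j) i')) (Fin.tail i) := by
    intro j
    rw [Wrong, ← hadv j, ne_comm]
  have hmw : mismatch w (List.ofFn fun j => (S 0 j, y j)) ≤ θ := by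
    rw [mismatch_ofFn]
    simpa only [hy'] using hs
  rw [Wrong, not_not, recover]
  change (select θ _ (List.ofFn fun j => (S 0 j, y j))).elim 0 _ = _
  rcases hsel : select θ (g fun a => l (Fin.cons a (Fin.tail i)))
      (List.ofFn fun j => (S 0 j, y j)) with _ | c
  · rw [select, List.find?_eq_none] at hsel
    exact absurd (by simpa using hmw) (hsel w hm)
  · have hc1 := List.mem_of_find?_eq_some hsel
    have hc2 : mismatch c (List.ofFn fun j => (S 0 j, y j)) ≤ θ := by
      simpa using List.find?_some hsel
    -- Two words with at most θ mismatches against the same sample differ in at most 2θ sampled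
    -- rows, which is what `BadSample` excludes.
    have hcw : c = w := by
      by_contra hne
      refine h' ⟨c, hc1, hne, ?_⟩
      rw [mismatch_ofFn] at hmw hc2
      refine (card_le_card (t := univ.filter (fun j => c (S 0 j) ≠ y j) ∪
        univ.filter (fun j => w (S 0 j) ≠ y j)) fun j hj => ?_).trans
        ((card_union_le _ _).trans (by omega))
      rw [mem_filter] at hj
      simp only [mem_union, mem_filter, mem_univ, true_and]
      by_contra hcon
      push Not at hcon
      exact hj.2 (hcon.1.trans hcon.2.symm)
    rw [hcw, Option.elim_some, hw]
    simp only
    rw [Fin.cons_self_tail]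

end Analysis

/-! ### Counting the errors over all samplings -/

section Errors

open Finset

variable {F : Type*} {n k m s L θ ℓ : ℕ} {α δ κ f : ℝ}
  {A : Set (Fin n → F)} {V : List F → Prop} {g : (Fin n → List F) → List (Fin n → F)}
  {hL : 0 < L}

open Classical in
/-- The number of coordinates of `W` that are not in the input lists. -/
noncomputable def numBad (l : (Fin s → Fin n) → List F) (W : (Fin s → Fin n) → F) : ℕ :=
  #{i | W i ∉ l i}

theorem sum_cons {X : Type*} [Fintype X] {s : ℕ} (h : (Fin (s + 1) → X) → ℝ) :
    ∑ i, h i = ∑ a, ∑ i', h (Fin.cons a i') := by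
  rw [← (Fin.consEquiv fun _ : Fin (s + 1) => X).sum_comp, Fintype.sum_prod_type]
  rfl

theorem numBad_eq_sum_slices (l : (Fin (s + 1) → Fin n) → List F) (W : (Fin (s + 1) → Fin n) → F) :
    (numBad l W : ℝ) =
      ∑ r, (numBad (fun i' => l (Fin.cons r i')) fun i' => W (Fin.cons r i') : ℝ) := by
  classical
  simp only [numBad, ← sum_boole]
  rw [sum_cons]

open Classical in
theorem numBad_eq_sum_columns (l : (Fin (s + 1) → Fin n) → List F)
    (W : (Fin (s + 1) → Fin n) → F) :
    (numBad l W : ℝ) = ∑ i' : Fin s → Fin n, (#{a | W (Fin.cons a i') ∉ l (Fin.cons a i')} : ℝ) := by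
  simp only [numBad, ← sum_boole]
  rw [sum_cons, sum_comm]

open Classical in
/-- Each far column contains many coordinates that are not in the input lists. -/
theorem sum_farColumn_le (hk : k ≤ n) (l : (Fin (s + 1) → Fin n) → List F)
    (W : (Fin (s + 1) → Fin n) → F) :
    (α * n) * ∑ i' : Fin s → Fin k,
      (if FarColumn α l W (fun a => Fin.castLE hk (i' a)) then (1 : ℝ) else 0) ≤ numBad l W := by
  rw [numBad_eq_sum_columns, mul_sum]
  set φ : (Fin s → Fin n) → ℝ := fun i' => (#{a | W (Fin.cons a i') ∉ l (Fin.cons a i')} : ℝ)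
    with hφ
  -- Only columns through systematic positions are counted; the others are dropped from a sum of
  -- nonnegative terms.
  have h1 : ∑ i' : Fin s → Fin k, φ (fun a => Fin.castLE hk (i' a)) ≤ ∑ i', φ i' := by
    have hinj : Function.Injective fun (i' : Fin s → Fin k) a => Fin.castLE hk (i' a) := by
      intro i j h
      funext a
      exact Fin.castLE_injective hk (congrFun h a)
    rw [← sum_image (f := φ) (g := fun (i' : Fin s → Fin k) a => Fin.castLE hk (i' a))
      hinj.injOn]
    exact sum_le_univ_sum_of_nonneg fun i' => by simp [hφ]
  refine (sum_le_sum fun i' _ => ?_).trans h1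
  split_ifs with h
  · rw [mul_one]
    exact h.le
  · simp [hφ]

theorem castLE_cons (hk : k ≤ n) (a : Fin k) (i : Fin s → Fin k) :
    (fun b => Fin.castLE hk ((Fin.cons a i : Fin (s + 1) → Fin k) b)) =
      (Fin.cons (Fin.castLE hk a) fun b => Fin.castLE hk (i b) : Fin (s + 1) → Fin n) := by
  funext b
  cases b using Fin.cases <;> simp

-- A union bound over the at most L candidates, each of which is a codeword and hence at distance δ
-- from `w`.
open Classical in
theorem card_badSample_le (hg : RecoversLists A α δ V g L) (hδ : δ ≤ 2) (l : Fin n → List F)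
    (hl : ∀ a, V (l a)) (w : Fin n → F) (hw : w ∈ A) :
    (#{S : Fin m → Fin n | BadSample θ (g l) w S} : ℝ) ≤
      (n : ℝ) ^ m * (L * (2 ^ (2 * θ) * (1 - δ / 2) ^ m)) := by
  have h0 : 0 ≤ 1 - δ / 2 := by linarith
  set T := (g l).toFinset.filter (· ≠ w) with hT
  have hsub : (univ.filter fun S : Fin m → Fin n => BadSample θ (g l) w S) ⊆
      T.biUnion fun v => univ.filter fun S => #{j | v (S j) ≠ w (S j)} ≤ 2 * θ := by
    intro S hS
    obtain ⟨v, hv, hne, hc⟩ := (mem_filter.1 hS).2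
    exact mem_biUnion.2 ⟨v, mem_filter.2 ⟨List.mem_toFinset.2 hv, hne⟩,
      mem_filter.2 ⟨mem_univ _, hc⟩⟩
  have hTL : (#T : ℝ) ≤ L := by
    exact_mod_cast (card_filter_le _ _).trans
      ((List.toFinset_card_le _).trans (hg.length_le l hl))
  calc (#{S : Fin m → Fin n | BadSample θ (g l) w S} : ℝ)
      ≤ ((∑ v ∈ T, #{S : Fin m → Fin n | #{j | v (S j) ≠ w (S j)} ≤ 2 * θ} : ℕ) : ℝ) := by
        exact_mod_cast (card_le_card hsub).trans card_biUnion_le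
    _ ≤ ∑ v ∈ T, 2 ^ (2 * θ) * ((1 - δ / 2) ^ m * (n : ℝ) ^ m) := by
        rw [Nat.cast_sum]
        refine sum_le_sum fun v hv => card_sample_le v w ?_ _
        obtain ⟨hv1, hv2⟩ := mem_filter.1 hv
        exact hg.dist v (hg.mem_code l hl v (List.mem_toFinset.1 hv1)) w hw hv2
    _ = #T * (2 ^ (2 * θ) * ((1 - δ / 2) ^ m * (n : ℝ) ^ m)) := by simp
    _ ≤ L * (2 ^ (2 * θ) * ((1 - δ / 2) ^ m * (n : ℝ) ^ m)) := by gcongr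
    _ = _ := by ring

variable [Field F]

open Classical in
/-- The number of errors in the systematic part, over all samplings. -/
noncomputable def numWrong (hk : k ≤ n) (g : (Fin n → List F) → List (Fin n → F)) (m θ : ℕ)
    (hL : 0 < L) (s : ℕ) (l : (Fin (s + 1) → Fin n) → List F) (W : (Fin (s + 1) → Fin n) → F) : ℝ :=
  ∑ S : Fin s → Fin m → Fin n, ∑ i : Fin (s + 1) → Fin k,
    if Wrong g θ hL s S l W fun a => Fin.castLE hk (i a) then 1 else 0

/-- The coefficient of the probability of a bad sample in the bound for the errors. -/
noncomputable def sampleCoeff (κ : ℝ) : ℕ → ℝ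
  | 0 => 0
  | s + 1 => 1 + κ * sampleCoeff κ s

/-- The coefficient of the number of bad coordinates in the bound for the errors. -/
noncomputable def badCoeff (α κ : ℝ) (n k : ℕ) : ℕ → ℝ
  | 0 => 1 / (α * n)
  | s + 1 => 1 / (α * n * k ^ (s + 1)) + κ / n * badCoeff α κ n k s

theorem sampleCoeff_nonneg (hκ : 0 ≤ κ) : 0 ≤ sampleCoeff κ s := by
  induction s with
  | zero => exact le_rfl
  | succ s ih => rw [sampleCoeff]; positivity

theorem badCoeff_nonneg (hα : 0 < α) (hκ : 0 ≤ κ) : 0 ≤ badCoeff α κ n k s := by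
  induction s with
  | zero => rw [badCoeff]; positivity
  | succ s ih => rw [badCoeff]; positivity

-- The three causes of failure as a sum of indicators. The event that at least θ + 1 recursive
-- answers are wrong is replaced by their number over θ + 1, so that expectations can be taken.
open Classical in
theorem wrong_le (hg : RecoversLists A α δ V g L)
    {S : Fin (s + 1) → Fin m → Fin n} {l : (Fin (s + 2) → Fin n) → List F} (hl : ∀ i, V (l i))
    {W : (Fin (s + 2) → Fin n) → F} (hW : IsTensor A (s + 2) W) (i : Fin (s + 2) → Fin n) :
    (if Wrong g θ hL (s + 1) S l W i then (1 : ℝ) else 0) ≤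
      (if FarColumn α l W (Fin.tail i) then 1 else 0) +
      (if BadSample θ (g fun a => l (Fin.cons a (Fin.tail i)))
        (fun a => W (Fin.cons a (Fin.tail i))) (S 0) then 1 else 0) +
      1 / (θ + 1) * ∑ j, if Wrong g θ hL s (Fin.tail S) (fun i' => l (Fin.cons (S 0 j) i'))
        (fun i' => W (Fin.cons (S 0 j) i')) (Fin.tail i) then 1 else 0 := by
  rw [sum_boole]
  set N : ℕ := #{j | Wrong g θ hL s (Fin.tail S) (fun i' => l (Fin.cons (S 0 j) i'))
        (fun i' => W (Fin.cons (S 0 j) i')) (Fin.tail i)} with hN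
  have h0 : (0 : ℝ) ≤ 1 / (θ + 1) * N := by positivity
  by_cases h1 : FarColumn α l W (Fin.tail i)
  · rw [if_pos h1]
    split_ifs <;> linarith
  by_cases h2 : BadSample θ (g fun a => l (Fin.cons a (Fin.tail i)))
        (fun a => W (Fin.cons a (Fin.tail i))) (S 0)
  · rw [if_pos h2]
    split_ifs <;> linarith
  by_cases h3 : N ≤ θ
  · rw [if_neg (not_wrong_succ hg hl hW h1 h2 h3)]
    split_ifs
    linarith
  · have h4 : (1 : ℝ) ≤ 1 / (θ + 1) * N := by
      rw [one_div, ← div_eq_inv_mul, one_le_div (by positivity)]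
      exact_mod_cast not_le.1 h3
    split_ifs <;> linarith

-- Induction on the dimension, by summing `wrong_le`. Here f bounds the fraction of bad samples and
-- κ bounds m / (θ + 1). Since the rows are drawn from all n coordinates but errors are counted on
-- systematic ones only, each level pairs a factor 1/n with a new factor k.
open Classical in
theorem numWrong_le (hg : RecoversLists A α δ V g L) (hα : 0 < α) (hn : 1 ≤ n) (hk1 : 1 ≤ k)
    (hk : k ≤ n) (hκ : 0 ≤ κ) (hm : (m : ℝ) ≤ κ * (θ + 1))
    (hf : ∀ (l : Fin n → List F), (∀ a, V (l a)) → ∀ w ∈ A,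
      (#{S : Fin m → Fin n | BadSample θ (g l) w S} : ℝ) ≤ (n : ℝ) ^ m * f)
    {l : (Fin (s + 1) → Fin n) → List F} (hl : ∀ i, V (l i))
    {W : (Fin (s + 1) → Fin n) → F} (hW : IsTensor A (s + 1) W) :
    numWrong hk g m θ hL s l W ≤ ((n : ℝ) ^ m) ^ s * (k : ℝ) ^ (s + 1) *
      (sampleCoeff κ s * f + badCoeff α κ n k s * numBad l W) := by
  have hn' : (0 : ℝ) < n := by exact_mod_cast hn
  have hk' : (0 : ℝ) < k := by exact_mod_cast hk1
  induction s with
  | zero =>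
    have h1 : ∀ (S : Fin 0 → Fin m → Fin n) (i : Fin 1 → Fin k),
        (if Wrong g θ hL 0 S l W (fun a => Fin.castLE hk (i a)) then (1 : ℝ) else 0) ≤
          if FarColumn α l W (Fin.elim0) then 1 else 0 := by
      intro S i
      have ht : (Fin.tail fun a => Fin.castLE hk (i a) : Fin 0 → Fin n) = Fin.elim0 :=
        Subsingleton.elim _ _
      by_cases h : Wrong g θ hL 0 S l W fun a => Fin.castLE hk (i a)
      · have := farColumn_of_wrong_zero hg hl hW h
        rw [ht] at this
        rw [if_pos this]
        split_ifs
        norm_num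
      · rw [if_neg h]
        split_ifs <;> norm_num
    have h2 := sum_farColumn_le (α := α) hk l W
    have h3 : ∑ i' : Fin 0 → Fin k,
        (if FarColumn α l W (fun a => Fin.castLE hk (i' a)) then (1 : ℝ) else 0) =
        if FarColumn α l W (Fin.elim0) then 1 else 0 := by
      rw [Fintype.sum_eq_single Fin.elim0 fun i h => absurd (Subsingleton.elim _ _) h]
      congr
      exact Subsingleton.elim _ _
    rw [h3] at h2
    have h4 : numWrong hk g m θ hL 0 l W ≤ k * if FarColumn α l W (Fin.elim0) then 1 else 0 := by
      refine (sum_le_sum fun S _ => sum_le_sum fun i _ => h1 S i).trans (le_of_eq ?_)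
      simp
    refine h4.trans ?_
    simp only [sampleCoeff, badCoeff, pow_zero, zero_add, pow_one, one_mul, zero_mul]
    gcongr
    rw [one_div, ← div_eq_inv_mul, le_div_iff₀ (by positivity), mul_comm]
    exact h2
  | succ s ih =>
    set E := ((n : ℝ) ^ m) ^ s with hE
    have hE0 : 0 < E := by positivity
    -- The bound of `wrong_le` does not involve the first coordinate of `i`, so the sum over it will
    -- become a factor k.
    have h1 : numWrong hk g m θ hL (s + 1) l W ≤
        ∑ S0 : Fin m → Fin n, ∑ _S' : Fin s → Fin m → Fin n,
          ∑ _i0 : Fin k, ∑ i' : Fin (s + 1) → Fin k,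
          ((if FarColumn α l W (fun a => Fin.castLE hk (i' a)) then (1 : ℝ) else 0) +
          (if BadSample θ (g fun a => l (Fin.cons a fun a => Fin.castLE hk (i' a)))
            (fun a => W (Fin.cons a fun a => Fin.castLE hk (i' a))) S0 then 1 else 0) +
          1 / (θ + 1) * ∑ j, if Wrong g θ hL s _S' (fun i' => l (Fin.cons (S0 j) i'))
            (fun i' => W (Fin.cons (S0 j) i')) (fun a => Fin.castLE hk (i' a)) then 1 else 0) := by
      rw [numWrong, sum_cons]
      refine sum_le_sum fun S0 _ => sum_le_sum fun S' _ => ?_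
      rw [sum_cons]
      refine sum_le_sum fun i0 _ => sum_le_sum fun i' _ => ?_
      rw [castLE_cons]
      have := wrong_le (θ := θ) (hL := hL) (S := Fin.cons S0 S') hg hl hW
        (Fin.cons (Fin.castLE hk i0) fun b => Fin.castLE hk (i' b))
      simpa only [Fin.tail_cons, Fin.cons_zero] using this
    have h2 : ∑ S0 : Fin m → Fin n, ∑ _S' : Fin s → Fin m → Fin n,
          ∑ _i0 : Fin k, ∑ i' : Fin (s + 1) → Fin k,
          ((if FarColumn α l W (fun a => Fin.castLE hk (i' a)) then (1 : ℝ) else 0) +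
          (if BadSample θ (g fun a => l (Fin.cons a fun a => Fin.castLE hk (i' a)))
            (fun a => W (Fin.cons a fun a => Fin.castLE hk (i' a))) S0 then 1 else 0) +
          1 / (θ + 1) * ∑ j, if Wrong g θ hL s _S' (fun i' => l (Fin.cons (S0 j) i'))
            (fun i' => W (Fin.cons (S0 j) i')) (fun a => Fin.castLE hk (i' a)) then 1 else 0) =
        (n : ℝ) ^ m * E * k * (∑ i' : Fin (s + 1) → Fin k,
          if FarColumn α l W (fun a => Fin.castLE hk (i' a)) then 1 else 0) +
        E * k * (∑ i' : Fin (s + 1) → Fin k, ∑ S0 : Fin m → Fin n,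
          if BadSample θ (g fun a => l (Fin.cons a fun a => Fin.castLE hk (i' a)))
            (fun a => W (Fin.cons a fun a => Fin.castLE hk (i' a))) S0 then 1 else 0) +
        k / (θ + 1) * ∑ j : Fin m, ∑ S0 : Fin m → Fin n,
          numWrong hk g m θ hL s (fun i' => l (Fin.cons (S0 j) i'))
            (fun i' => W (Fin.cons (S0 j) i')) := by
      simp only [sum_add_distrib, sum_const, card_univ, Fintype.card_fin, Fintype.card_fun,
        nsmul_eq_mul, ← mul_sum, Nat.cast_pow]
      congr 1
      · congr 1
        · rw [hE]; ring
        · rw [sum_comm, hE]; ring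
      · have h5 : ∀ S0 : Fin m → Fin n, ∑ S' : Fin s → Fin m → Fin n,
            ∑ i' : Fin (s + 1) → Fin k, ∑ j : Fin m,
              (if Wrong g θ hL s S' (fun i' => l (Fin.cons (S0 j) i'))
              (fun i' => W (Fin.cons (S0 j) i')) (fun a => Fin.castLE hk (i' a)) then (1 : ℝ) else 0)
            = ∑ j : Fin m, numWrong hk g m θ hL s (fun i' => l (Fin.cons (S0 j) i'))
              (fun i' => W (Fin.cons (S0 j) i')) := by
          intro S0
          simp only [numWrong]
          rw [sum_comm (s := (univ : Finset (Fin m)))]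
          refine sum_congr rfl fun S' _ => ?_
          rw [sum_comm]
        simp only [h5]
        rw [sum_comm]
        ring
    have h3 := sum_farColumn_le (α := α) hk l W
    have h4 : ∀ i' : Fin (s + 1) → Fin k, ∑ S0 : Fin m → Fin n,
          (if BadSample θ (g fun a => l (Fin.cons a fun a => Fin.castLE hk (i' a)))
            (fun a => W (Fin.cons a fun a => Fin.castLE hk (i' a))) S0 then (1 : ℝ) else 0) ≤
          (n : ℝ) ^ m * f := by
      intro i'
      rw [sum_boole]
      exact hf _ (fun a => hl _) _ (hW.1 _)
    have h5 : ∑ i' : Fin (s + 1) → Fin k, ∑ S0 : Fin m → Fin n,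
          (if BadSample θ (g fun a => l (Fin.cons a fun a => Fin.castLE hk (i' a)))
            (fun a => W (Fin.cons a fun a => Fin.castLE hk (i' a))) S0 then (1 : ℝ) else 0) ≤
          (k : ℝ) ^ (s + 1) * ((n : ℝ) ^ m * f) := by
      refine (sum_le_sum fun i' _ => h4 i').trans (le_of_eq ?_)
      simp
    set B := badCoeff α κ n k s with hB
    set Cf := sampleCoeff κ s with hC
    have h6 : ∀ r, numWrong hk g m θ hL s (fun i' => l (Fin.cons r i'))
            (fun i' => W (Fin.cons r i')) ≤ E * (k : ℝ) ^ (s + 1) * (Cf * f + B *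
              numBad (fun i' => l (Fin.cons r i')) (fun i' => W (Fin.cons r i'))) :=
      fun r => ih (fun _ => hl _) (hW.2 r)
    -- For fixed j the row `S0 j` is uniform, so the errors in the sampled slice average over all
    -- slices, whose bad coordinates add up to those of W.
    have h7 : ∀ j : Fin m, ∑ S0 : Fin m → Fin n,
          numWrong hk g m θ hL s (fun i' => l (Fin.cons (S0 j) i'))
            (fun i' => W (Fin.cons (S0 j) i')) ≤
          (n : ℝ) ^ m * (E * (k : ℝ) ^ (s + 1) * (Cf * f + B / n * numBad l W)) := by
      intro j
      have h8 := sum_apply_eq (fun r => numWrong hk g m θ hL s (fun i' => l (Fin.cons r i'))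
            (fun i' => W (Fin.cons r i'))) j
      have h9 : ∑ r, numWrong hk g m θ hL s (fun i' => l (Fin.cons r i'))
            (fun i' => W (Fin.cons r i')) ≤
            E * (k : ℝ) ^ (s + 1) * (n * (Cf * f) + B * numBad l W) := by
        refine (sum_le_sum fun r _ => h6 r).trans (le_of_eq ?_)
        rw [← mul_sum, sum_add_distrib, ← mul_sum, numBad_eq_sum_slices l W, sum_const, card_univ,
          Fintype.card_fin, nsmul_eq_mul, ← mul_sum]
        ring
      rw [← mul_le_mul_iff_right₀ hn', h8]
      calc _ ≤ (n : ℝ) ^ m * (E * (k : ℝ) ^ (s + 1) * (n * (Cf * f) + B * numBad l W)) := by gcongr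
        _ = _ := by field_simp
    have h8 : 0 ≤ Cf * f + B / n * numBad l W := by
      -- The sign of f is not assumed; it follows from `hf` at any one column.
      have : 0 ≤ f := by
        by_contra hneg
        push Not at hneg
        have h1 := hf _ (fun a => hl (Fin.cons a fun _ => ⟨0, hn⟩)) _ (hW.1 fun _ => ⟨0, hn⟩)
        have h2 : (n : ℝ) ^ m * f < 0 := mul_neg_of_pos_of_neg (by positivity) hneg
        exact absurd (h1.trans_lt h2) (not_lt.2 (by positivity))
      have := sampleCoeff_nonneg (s := s) hκ
      have := badCoeff_nonneg (n := n) (k := k) (s := s) hα hκ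
      positivity
    calc _ ≤ _ := h1
      _ = _ := h2
      _ ≤ (n : ℝ) ^ m * E * k * (numBad l W / (α * n)) +
          E * k * ((k : ℝ) ^ (s + 1) * ((n : ℝ) ^ m * f)) +
          k / (θ + 1) * (m * ((n : ℝ) ^ m * (E * (k : ℝ) ^ (s + 1) *
            (Cf * f + B / n * numBad l W)))) := by
          gcongr
          · rw [le_div_iff₀ (by positivity), mul_comm]
            exact h3
          · refine (sum_le_sum fun j _ => h7 j).trans (le_of_eq ?_)
            simp
      _ ≤ (n : ℝ) ^ m * E * k * (numBad l W / (α * n)) +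
          E * k * ((k : ℝ) ^ (s + 1) * ((n : ℝ) ^ m * f)) +
          k * (κ * ((n : ℝ) ^ m * (E * (k : ℝ) ^ (s + 1) *
            (Cf * f + B / n * numBad l W)))) := by
          refine add_le_add le_rfl ?_
          rw [div_mul_eq_mul_div, div_le_iff₀ (by positivity)]
          calc _ ≤ (k : ℝ) * ((κ * (θ + 1)) * ((n : ℝ) ^ m * (E * (k : ℝ) ^ (s + 1) *
            (Cf * f + B / n * numBad l W)))) := by gcongr
            _ = _ := by ring
      _ = _ := by
          rw [sampleCoeff, badCoeff, ← hB, ← hC, pow_succ ((n : ℝ) ^ m) s, ← hE]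
          field_simp
          ring

open Classical in
/-- If there are few errors on average, then few errors occur for most samplings. -/
theorem card_few_wrong_ge {ε : ℝ} (hn : 1 ≤ n) (hk1 : 1 ≤ k) (hk : k ≤ n) (hε : 0 < ε)
    (l : (Fin (s + 1) → Fin n) → List F)
    (W : (Fin (s + 1) → Fin n) → F)
    (h : numWrong hk g m θ hL s l W ≤ ((n : ℝ) ^ m) ^ s * (k : ℝ) ^ (s + 1) * (ε / 3)) :
    2 / 3 * ((n : ℝ) ^ m) ^ s ≤ #{S : Fin s → Fin m → Fin n |
      (#{i : Fin (s + 1) → Fin k | Wrong g θ hL s S l W fun a => Fin.castLE hk (i a)} : ℝ) ≤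
        ε * k ^ (s + 1)} := by
  have hn' : (0 : ℝ) < n := by exact_mod_cast hn
  have hk' : (0 : ℝ) < k := by exact_mod_cast hk1
  set P : (Fin s → Fin m → Fin n) → Prop := fun S =>
    (#{i : Fin (s + 1) → Fin k | Wrong g θ hL s S l W fun a => Fin.castLE hk (i a)} : ℝ) ≤
        ε * k ^ (s + 1) with hP
  -- Markov's inequality: every sampling that violates `P` contributes more than ε k^(s+1) errors.
  have h1 : (#{S | ¬P S} : ℝ) * (ε * k ^ (s + 1)) ≤ numWrong hk g m θ hL s l W := by
    rw [numWrong, ← nsmul_eq_mul, ← sum_const]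
    refine (sum_le_sum fun S hS => ?_).trans
      (sum_le_univ_sum_of_nonneg fun S => sum_nonneg fun i _ => by split_ifs <;> norm_num)
    rw [sum_boole]
    exact (not_le.1 (mem_filter.1 hS).2).le
  have h2 : (#{S | P S} : ℝ) + #{S | ¬P S} = ((n : ℝ) ^ m) ^ s := by
    have := card_filter_add_card_filter_not (s := (univ : Finset (Fin s → Fin m → Fin n))) P
    rw [card_univ] at this
    have h3 := congrArg (Nat.cast (R := ℝ)) this
    push_cast at h3
    simpa using h3
  have h3 : (#{S | ¬P S} : ℝ) ≤ ((n : ℝ) ^ m) ^ s / 3 := by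
    have h4 := h1.trans h
    rw [show ((n : ℝ) ^ m) ^ s * (k : ℝ) ^ (s + 1) * (ε / 3) =
      ((n : ℝ) ^ m) ^ s / 3 * (ε * k ^ (s + 1)) by ring] at h4
    exact le_of_mul_le_mul_right h4 (by positivity)
  linarith

end Errors

/-! ### The choice of the parameters -/

section Parameters

variable {n k s L : ℕ} {α α' δ ρ : ℝ}

theorem le_two_rpow (y : ℝ) : y ≤ (2 : ℝ) ^ y := by
  rcases le_total y 0 with h | h
  · exact h.trans (by positivity)
  have h1 : y < ⌊y⌋₊ + 1 := Nat.lt_floor_add_one y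
  have h2 : ⌊y⌋₊ + 1 ≤ 2 ^ ⌊y⌋₊ := Nat.lt_two_pow_self
  have h3 : (⌊y⌋₊ : ℝ) + 1 ≤ 2 ^ ⌊y⌋₊ := by exact_mod_cast h2
  have h4 : (2 : ℝ) ^ ⌊y⌋₊ ≤ (2 : ℝ) ^ y := by
    rw [← Real.rpow_natCast]
    exact Real.rpow_le_rpow_of_exponent_le (by norm_num) (Nat.floor_le h)
  linarith

theorem exp_neg_le_two_rpow {x : ℝ} (hx : 0 ≤ x) : Real.exp (-x) ≤ (2 : ℝ) ^ (-x) := by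
  rw [Real.rpow_def_of_pos (by norm_num), Real.exp_le_exp]
  have : Real.log 2 ≤ 1 := by linarith [Real.log_two_lt_d9]
  nlinarith

theorem sampleCoeff_le {κ : ℝ} (hκ : 1 ≤ κ) : sampleCoeff κ s ≤ (2 * κ) ^ s := by
  induction s with
  | zero => simp [sampleCoeff]
  | succ s ih =>
    have h : (1 : ℝ) ≤ (2 * κ) ^ s := one_le_pow₀ (by linarith)
    rw [sampleCoeff, pow_succ]
    nlinarith

/-- In the normalization b_s = α k^(s+1) B_s, with B_s the coefficient, the recursion loses α and
the powers of k: b_0 = ρ and b_(s+1) = ρ (1 + κ b_s). -/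
theorem badCoeff_mul (hα : 0 < α) (hn : 1 ≤ n) (hk : 1 ≤ k) {κ : ℝ} :
    α * k ^ (s + 2) * badCoeff α κ n k (s + 1) =
      (k : ℝ) / n * (1 + κ * (α * k ^ (s + 1) * badCoeff α κ n k s)) := by
  have hn' : (0 : ℝ) < n := by exact_mod_cast hn
  have hk' : (0 : ℝ) < k := by exact_mod_cast hk
  rw [badCoeff]
  field_simp
  ring

/-- The systematic part of a code of rate `ρ` is so large, or its distance is so small, that few
bad coordinates remain harmless. -/
theorem badCoeff_le (hα : 0 < α) (hk : 2 ≤ k) (hkn : k ≤ n) (hδ : 0 < δ)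
    (hδ' : δ ≤ 1 - (k - 1) / n) :
    α * k ^ (s + 1) * badCoeff α (8 / δ) n k s * δ ^ (200 * (s + 1)) ≤ 1 / 6 := by
  have hn' : (0 : ℝ) < n := by exact_mod_cast (by omega : 0 < n)
  have hk' : (2 : ℝ) ≤ k := by exact_mod_cast hk
  have hkn' : (k : ℝ) ≤ n := by exact_mod_cast hkn
  set ρ : ℝ := k / n with hρ
  have hρ0 : 0 < ρ := by positivity
  have hρ1 : ρ ≤ 1 := (div_le_one hn').2 hkn'
  have hδρ : δ ≤ 1 - ρ / 2 := by
    refine hδ'.trans ?_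
    have : ρ / 2 ≤ (k - 1) / n := by
      rw [hρ, div_div, div_le_div_iff₀ (by positivity) hn']
      nlinarith
    linarith
  have hδ1 : δ ≤ 1 := by linarith
  set b : ℕ → ℝ := fun s => α * k ^ (s + 1) * badCoeff α (8 / δ) n k s with hb
  have hb0 : b 0 = ρ := by
    simp only [hb, badCoeff, hρ]
    field_simp
    ring
  have hbs : ∀ s, b (s + 1) = ρ * (1 + 8 / δ * b s) := fun s =>
    badCoeff_mul hα (by omega) (by omega)
  change b s * δ ^ (200 * (s + 1)) ≤ 1 / 6
  have hbp : ∀ s, 0 ≤ b s := fun s => by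
    have := badCoeff_nonneg (n := n) (k := k) (s := s) hα (κ := 8 / δ) (by positivity)
    positivity
  -- For small rate ρ cancels the factor 8 of the recursion, and b_s δ^s stays below 1/8 = (1 + 8 ·
  -- 1/8)/16. For large rate the Singleton bound keeps δ at most 31/32.
  by_cases h : ρ ≤ 1 / 16
  · have h1 : ∀ s, b s * δ ^ s ≤ 1 / 8 := by
      intro s
      induction s with
      | zero => rw [hb0]; linarith
      | succ s ih =>
        have e : b (s + 1) * δ ^ (s + 1) = ρ * (δ ^ (s + 1) + 8 * (b s * δ ^ s)) := by
          rw [hbs, pow_succ]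
          field_simp
        have h2 : δ ^ (s + 1) ≤ 1 := pow_le_one₀ hδ.le hδ1
        rw [e]
        have h3 := mul_nonneg (hbp s) (pow_nonneg hδ.le s)
        nlinarith [pow_nonneg hδ.le (s + 1)]
    have h2 : δ ^ (200 * (s + 1)) ≤ δ ^ s := pow_le_pow_of_le_one hδ.le hδ1 (by omega)
    have h3 := mul_le_mul_of_nonneg_left h2 (hbp s)
    linarith [h1 s]
  · push Not at h
    have hδ2 : δ ≤ 31 / 32 := by linarith
    have h1 : ∀ s, b s * δ ^ s ≤ 16 ^ s := by
      intro s
      induction s with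
      | zero => rw [hb0]; simpa using hρ1
      | succ s ih =>
        have e : b (s + 1) * δ ^ (s + 1) = ρ * (δ ^ (s + 1) + 8 * (b s * δ ^ s)) := by
          rw [hbs, pow_succ]
          field_simp
        have h2 : δ ^ (s + 1) ≤ 1 := pow_le_one₀ hδ.le hδ1
        have h3 := mul_nonneg (hbp s) (pow_nonneg hδ.le s)
        have h4 : (1 : ℝ) ≤ 16 ^ s := one_le_pow₀ (by norm_num)
        have h5 : 0 ≤ δ ^ (s + 1) + 8 * (b s * δ ^ s) := by positivity
        rw [e, pow_succ (16 : ℝ)]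
        linarith [mul_le_mul_of_nonneg_right hρ1 h5]
    -- One such block of powers per dimension pays for the growth by 16 per level, and one block is
    -- left over.
    have h2 : δ ^ 100 ≤ 1 / 16 := by
      refine (pow_le_pow_left₀ hδ.le hδ2 100).trans ?_
      norm_num
    have h3 : δ ^ (200 * (s + 1)) ≤ δ ^ s * (δ ^ 100) ^ (s + 1) := by
      rw [← pow_mul, ← pow_add]
      exact pow_le_pow_of_le_one hδ.le hδ1 (by omega)
    have h4 : (δ ^ 100) ^ (s + 1) ≤ (1 / 16) ^ (s + 1) := by gcongr
    calc b s * δ ^ (200 * (s + 1)) ≤ b s * (δ ^ s * (δ ^ 100) ^ (s + 1)) :=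
          mul_le_mul_of_nonneg_left h3 (hbp s)
      _ = (b s * δ ^ s) * (δ ^ 100) ^ (s + 1) := by ring
      _ ≤ 16 ^ s * (1 / 16) ^ (s + 1) := by
          gcongr
          exact h1 s
      _ = 1 / 16 := by rw [pow_succ, ← mul_assoc, ← mul_pow]; norm_num
      _ ≤ 1 / 6 := by norm_num

/-- By the Singleton bound with 1/n ≤ 1/2, δ ≤ 3/2 - ρ, and ρ(3/2 - ρ) is largest at ρ = 3/4. -/
theorem rate_mul_dist_le (hn : 2 ≤ n) (hδ' : δ ≤ 1 - ((k : ℝ) - 1) / n) :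
    (k : ℝ) / n * δ ≤ 9 / 16 := by
  have hn' : (2 : ℝ) ≤ n := by exact_mod_cast hn
  have h1 : (1 : ℝ) / n ≤ 1 / 2 := by gcongr
  have h2 : δ ≤ 3 / 2 - (k : ℝ) / n := by
    rw [sub_div] at hδ'
    linarith
  have h3 : (0 : ℝ) ≤ (k : ℝ) / n := by positivity
  nlinarith [sq_nonneg ((k : ℝ) / n - 3 / 4)]

/-- The sample must make bad samples rare even after amplification by `sampleCoeff`, while m^(s+1)
stays within X. The condition log L ≤ m serves to bound the logarithm of the number of descriptions
by m^(s+1). -/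
theorem exists_sampling_parameters (hn : 2 ≤ n) (hk1 : 1 ≤ k) (hkn : k ≤ n) (hL : 2 ≤ L)
    (hα : 0 < α) (hα1 : α ≤ 1) (hα' : 0 < α') (hα1' : α' ≤ 1) (hδ : 0 < δ)
    (hδ' : δ ≤ 1 - ((k : ℝ) - 1) / n) (s : ℕ) :
    ∃ m θ : ℕ, 1 ≤ m ∧ Real.logb 2 L ≤ m ∧ (m : ℝ) ≤ 8 / δ * (θ + 1) ∧
      sampleCoeff (8 / δ) s * (L * (2 ^ (2 * θ) * (1 - δ / 2) ^ m)) ≤ α' / 6 ∧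
      154 * ((s : ℝ) + 1) ^ 2 * (m : ℝ) ^ (s + 1) ≤
        Real.logb 2 L ^ (s + 1) / ((α * α') ^ (200 * (s + 1)) *
          ((k : ℝ) / n * δ) ^ (200 * (s + 1) ^ 2)) := by
  have hn' : (2 : ℝ) ≤ n := by exact_mod_cast hn
  have hk' : (1 : ℝ) ≤ k := by exact_mod_cast hk1
  have hkn' : (k : ℝ) ≤ n := by exact_mod_cast hkn
  have hL' : (2 : ℝ) ≤ L := by exact_mod_cast hL
  have hδ1 : δ ≤ 1 := by
    have : 0 ≤ ((k : ℝ) - 1) / n := div_nonneg (by linarith) (by linarith)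
    linarith
  set Λ := Real.logb 2 L with hΛ
  have hΛ1 : 1 ≤ Λ := by
    rw [hΛ, Real.le_logb_iff_rpow_le (by norm_num) (by linarith)]
    simpa using hL'
  have hΛL : (2 : ℝ) ^ Λ = L := Real.rpow_logb (by norm_num) (by norm_num) (by linarith)
  -- With θ about δm/8 and m about 4Y/δ, a bad sample has probability at most L · 2^(-Y). The
  -- summands of Y cancel in turn the list size L, the amplification (16/δ)^s and 6/α', the last two
  -- by y ≤ 2^y.
  set Y : ℝ := Λ + 16 * s / δ + 6 / α' with hY
  have hY0 : 0 < Y := by positivity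
  set m : ℕ := ⌈4 / δ * Y⌉₊ with hm
  have hmY : 4 / δ * Y ≤ m := Nat.le_ceil _
  have hmY' : (m : ℝ) < 4 / δ * Y + 1 := Nat.ceil_lt_add_one (by positivity)
  have hmδ : 4 * Y ≤ δ * m := by
    rw [div_mul_eq_mul_div, div_le_iff₀ hδ] at hmY
    linarith
  have hΛm : Λ ≤ m := by
    have h1 : Λ ≤ Y := by
      have : 0 ≤ 16 * s / δ + 6 / α' := by positivity
      linarith
    have h2 : δ * (m : ℝ) ≤ 1 * m := by gcongr
    linarith
  have hm1 : 1 ≤ m := by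
    have : (1 : ℝ) ≤ m := hΛ1.trans hΛm
    exact_mod_cast this
  set θ : ℕ := ⌊δ * m / 8⌋₊ with hθ
  refine ⟨m, θ, hm1, hΛm, ?_, ?_, ?_⟩
  · have h1 : δ * m / 8 < θ + 1 := Nat.lt_floor_add_one _
    rw [div_mul_eq_mul_div, le_div_iff₀ hδ]
    linarith
  · have h1 : (2 : ℝ) ^ (2 * θ) ≤ (2 : ℝ) ^ (δ * m / 4) := by
      rw [← Real.rpow_natCast]
      refine Real.rpow_le_rpow_of_exponent_le (by norm_num) ?_
      have : (θ : ℝ) ≤ δ * m / 8 := Nat.floor_le (by positivity)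
      push_cast
      linarith
    have h2 : (1 - δ / 2) ^ m ≤ (2 : ℝ) ^ (-(δ * m / 2)) := by
      refine le_trans ?_ (exp_neg_le_two_rpow (by positivity))
      have := Real.one_sub_le_exp_neg (δ / 2)
      calc (1 - δ / 2) ^ m ≤ Real.exp (-(δ / 2)) ^ m :=
            pow_le_pow_left₀ (by linarith) this m
        _ = _ := by
            rw [← Real.exp_nat_mul]
            congr 1
            ring
    have h3 : (2 : ℝ) ^ (2 * θ) * (1 - δ / 2) ^ m ≤ (2 : ℝ) ^ (-Y) := by
      calc (2 : ℝ) ^ (2 * θ) * (1 - δ / 2) ^ m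
          ≤ (2 : ℝ) ^ (δ * m / 4) * (2 : ℝ) ^ (-(δ * m / 2)) :=
            mul_le_mul h1 h2 (pow_nonneg (by linarith) m) (by positivity)
        _ = (2 : ℝ) ^ (-(δ * m / 4)) := by
            rw [← Real.rpow_add (by norm_num)]
            congr 1
            ring
        _ ≤ _ := Real.rpow_le_rpow_of_exponent_le (by norm_num) (by linarith)
    have h4 : (2 : ℝ) ^ (-Y) ≤ 1 / (L * ((16 / δ) ^ s * (6 / α'))) := by
      rw [Real.rpow_neg (by norm_num), ← one_div]
      refine one_div_le_one_div_of_le (by positivity) ?_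
      rw [hY, add_assoc, Real.rpow_add (by norm_num), Real.rpow_add (by norm_num), hΛL]
      gcongr
      · rw [show 16 * (s : ℝ) / δ = (16 / δ) * s by ring, Real.rpow_mul (by norm_num),
          Real.rpow_natCast]
        gcongr
        exact le_two_rpow _
      · exact le_two_rpow _
    have h5 : sampleCoeff (8 / δ) s ≤ (16 / δ) ^ s := by
      refine (sampleCoeff_le ?_).trans (le_of_eq ?_)
      · rw [le_div_iff₀ hδ]
        linarith
      · congr 1
        ring
    have h6 : 0 ≤ sampleCoeff (8 / δ) s := sampleCoeff_nonneg (by positivity)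
    calc sampleCoeff (8 / δ) s * (L * (2 ^ (2 * θ) * (1 - δ / 2) ^ m))
        ≤ (16 / δ) ^ s * (L * (1 / (L * ((16 / δ) ^ s * (6 / α'))))) := by
          have h7 : (2 : ℝ) ^ (2 * θ) * (1 - δ / 2) ^ m ≤
            1 / (L * ((16 / δ) ^ s * (6 / α'))) := h3.trans h4
          have h8 : 0 ≤ (2 : ℝ) ^ (2 * θ) * (1 - δ / 2) ^ m :=
            mul_nonneg (by positivity) (pow_nonneg (by linarith) m)
          gcongr
      _ = α' / 6 := by field_simp
  · set ρ : ℝ := k / n with hρ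
    have hρ0 : 0 < ρ := by positivity
    have hρ1 : ρ ≤ 1 := (div_le_one (by linarith)).2 hkn'
    have hρδ : ρ * δ ≤ 9 / 16 := rate_mul_dist_le hn hδ'
    have hs1 : (1 : ℝ) ≤ s + 1 := by
      have : (0 : ℝ) ≤ s := by positivity
      linarith
    -- Here 93 = 4 + 64 + 24 + 1, the coefficients in `e` below.
    have h1 : (m : ℝ) ≤ 93 * (s + 1) * Λ / (δ ^ 2 * α') := by
      rw [le_div_iff₀ (by positivity)]
      have e : (4 / δ * Y + 1) * (δ ^ 2 * α') =
        4 * Λ * (δ * α') + 64 * s * α' + 24 * δ + δ ^ 2 * α' := by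
        rw [hY]
        field_simp
        ring
      have h2 : (m : ℝ) * (δ ^ 2 * α') ≤ (4 / δ * Y + 1) * (δ ^ 2 * α') := by gcongr
      have h3 : δ * α' ≤ 1 := mul_le_one₀ hδ1 hα'.le hα1'
      have h4 : δ ^ 2 * α' ≤ 1 := mul_le_one₀ (pow_le_one₀ hδ.le hδ1) hα'.le hα1'
      have h5 : 4 * Λ * (δ * α') ≤ 4 * Λ * 1 := by gcongr
      have h6 : 64 * (s : ℝ) * α' ≤ 64 * s * 1 := by gcongr
      have h7 : (s : ℝ) * 1 ≤ s * Λ := by gcongr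
      have h8 : 0 ≤ (s : ℝ) * Λ := by positivity
      nlinarith
    have h2 : (m : ℝ) ^ (s + 1) ≤ (93 * (s + 1)) ^ (s + 1) * Λ ^ (s + 1) /
        (δ ^ (2 * (s + 1)) * α' ^ (s + 1)) := by
      refine (pow_le_pow_left₀ (by positivity) h1 _).trans (le_of_eq ?_)
      rw [div_pow, mul_pow _ Λ, mul_pow _ α', ← pow_mul]
    have h3 : (α * α') ^ (200 * (s + 1)) ≤ α' ^ (s + 1) := by
      calc (α * α') ^ (200 * (s + 1)) ≤ α' ^ (200 * (s + 1)) := by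
            gcongr
            nlinarith
        _ ≤ _ := pow_le_pow_of_le_one hα'.le hα1' (by omega)
    have h4 : (ρ * δ) ^ (200 * (s + 1) ^ 2) ≤ δ ^ (2 * (s + 1)) * (9 / 16) ^ (22 * (s + 1) ^ 2) := by
      have hρδ1 : ρ * δ ≤ 1 := by linarith
      have hsq : s + 1 ≤ (s + 1) ^ 2 := Nat.le_self_pow (by norm_num) _
      calc (ρ * δ) ^ (200 * (s + 1) ^ 2) ≤ (ρ * δ) ^ (2 * (s + 1) + 22 * (s + 1) ^ 2) :=
            pow_le_pow_of_le_one (by positivity) hρδ1 (by omega)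
        _ = (ρ * δ) ^ (2 * (s + 1)) * (ρ * δ) ^ (22 * (s + 1) ^ 2) := pow_add _ _ _
        _ ≤ _ := by
            gcongr
            nlinarith
    -- Every factor is at most a constant to the power t²; the constants multiply to 154 · 4 · 186,
    -- which is less than (16/9)^22.
    have h5 : 154 * ((s : ℝ) + 1) ^ 2 * (93 * (s + 1)) ^ (s + 1) * (9 / 16) ^ (22 * (s + 1) ^ 2) ≤
        1 := by
      have h6 : (s : ℝ) + 1 ≤ 2 ^ (s + 1) := by
        have : s + 1 < 2 ^ (s + 1) := Nat.lt_two_pow_self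
        exact_mod_cast this.le
      set t := s + 1 with ht
      have ht1 : 1 ≤ t ^ 2 := Nat.one_le_pow _ _ (by omega)
      have htt : t ≤ t ^ 2 := Nat.le_self_pow (by norm_num) _
      have h7 : (154 : ℝ) ≤ 154 ^ t ^ 2 := le_self_pow₀ (by norm_num) (by omega)
      have h8 : ((s : ℝ) + 1) ^ 2 ≤ 4 ^ t ^ 2 := by
        calc ((s : ℝ) + 1) ^ 2 ≤ (2 ^ t) ^ 2 := by gcongr
          _ = 4 ^ t := by rw [← pow_mul, mul_comm, pow_mul]; norm_num
          _ ≤ _ := pow_le_pow_right₀ (by norm_num) htt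
      have h9 : (93 * ((s : ℝ) + 1)) ^ t ≤ 186 ^ t ^ 2 := by
        calc (93 * ((s : ℝ) + 1)) ^ t ≤ (93 * 2 ^ t) ^ t := by gcongr
          _ = 93 ^ t * 2 ^ t ^ 2 := by rw [mul_pow, ← pow_mul, sq]
          _ ≤ 93 ^ t ^ 2 * 2 ^ t ^ 2 := by
              gcongr
              norm_num
          _ = _ := by rw [← mul_pow]; norm_num
      calc 154 * ((s : ℝ) + 1) ^ 2 * (93 * (s + 1)) ^ t * (9 / 16) ^ (22 * t ^ 2)
          ≤ 154 ^ t ^ 2 * 4 ^ t ^ 2 * 186 ^ t ^ 2 * (9 / 16) ^ (22 * t ^ 2) := by gcongr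
        _ = (154 * 4 * 186 * (9 / 16) ^ 22) ^ t ^ 2 := by
            rw [pow_mul]
            simp only [mul_pow]
        _ ≤ 1 := pow_le_one₀ (by positivity) (by norm_num)
    rw [le_div_iff₀ (by positivity)]
    calc 154 * ((s : ℝ) + 1) ^ 2 * (m : ℝ) ^ (s + 1) *
          ((α * α') ^ (200 * (s + 1)) * (ρ * δ) ^ (200 * (s + 1) ^ 2))
        ≤ 154 * ((s : ℝ) + 1) ^ 2 * ((93 * (s + 1)) ^ (s + 1) * Λ ^ (s + 1) /
            (δ ^ (2 * (s + 1)) * α' ^ (s + 1))) *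
          (α' ^ (s + 1) * (δ ^ (2 * (s + 1)) * (9 / 16) ^ (22 * (s + 1) ^ 2))) := by gcongr
      _ = (154 * ((s : ℝ) + 1) ^ 2 * (93 * (s + 1)) ^ (s + 1) * (9 / 16) ^ (22 * (s + 1) ^ 2)) *
            Λ ^ (s + 1) := by field_simp
      _ ≤ 1 * Λ ^ (s + 1) := by gcongr
      _ = _ := one_mul _

end Parameters

/-! ### Tables as programs -/

section Table

variable {F : Type*}

/-- With environment `u, …`: whether `u` is the given value. -/
def matchProg : Val F → Prog F
  | .nil => .ite (.var 0) .nil (.nat 1)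
  | .nat m => .op2 .eq (.var 0) (.nat m)
  | .sym a => .op2 .eq (.var 0) (.sym a)
  | .pair v w => .ite (.op2 .eq (.op1 .kind (.var 0)) (.nat 3))
      (.ite (.bind (.op1 .fst (.var 0)) (matchProg v)) (.bind (.op1 .snd (.var 0)) (matchProg w))
        .nil) .nil

/-- The program that returns a given value. -/
def constProg : Val F → Prog F
  | .nil => .nil
  | .nat m => .nat m
  | .sym a => .sym a
  | .pair v w => .op2 .pair (constProg v) (constProg w)

/-- With environment `u, …`: the value of `h` at `u`, for `u` in a given list. -/
def tableProg (h : Val F → Val F) : List (Val F) → Prog F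
  | [] => .nil
  | v :: l => .ite (matchProg v) (constProg (h v)) (tableProg h l)

/-- The string of input lists as a value. -/
def encLists {n : ℕ} (l : Fin n → List F) : Val F := encList (List.ofFn fun i => encSyms (l i))

theorem encLists_injective {n : ℕ} : Function.Injective (encLists (F := F) (n := n)) := by
  intro l l' h
  have h1 := List.ofFn_injective (encList_injective h)
  funext i
  have h2 := encList_injective (congrFun h1 i)
  exact List.map_injective_iff.2 (fun a b hab => by simpa using hab) h2

variable [Field F] {O : Val F → Val F} {R : ℕ → ℕ} {M : ℕ}

open Classical in
theorem comp_matchProg (v : Val F) :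
    ∃ τ, ∀ u σ, Comp O R M (u :: σ) (matchProg v) (.ofProp (u = v)) τ 0 := by
  induction v with
  | nil =>
    refine ⟨3, fun u σ => ?_⟩
    by_cases h : u = .nil
    · subst h
      rw [Val.ofProp, if_pos rfl]
      exact Comp.iteFalse (.var 0 rfl) (.nat 1)
    · rw [Val.ofProp, if_neg h]
      exact Comp.iteTrue (u := u) (.var 0 rfl) h .nil
  | nat m =>
    refine ⟨3, fun u σ => Comp.op2 .eq (.var 0 rfl) (.nat m) ?_⟩
    cases u <;> simp [Op2.app, Val.ofProp]
  | sym a =>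
    refine ⟨3, fun u σ => Comp.op2 .eq (.var 0 rfl) (.sym a) ?_⟩
    cases u <;> simp [Op2.app, Val.ofProp]
  | pair v w ihv ihw =>
    obtain ⟨τ, hv⟩ := ihv
    obtain ⟨τ', hw⟩ := ihw
    refine ⟨τ + τ' + 14, fun u σ => ?_⟩
    have h3 : Comp O R M (u :: σ) (.op2 .eq (.op1 .kind (.var 0)) (.nat 3))
        (Op2.eq.app (Op1.kind.app u) (.nat 3)) 4 0 :=
      .op2 .eq (.op1 .kind (.var 0 rfl) rfl) (.nat 3) rfl
    rcases u with _ | m | a | ⟨u, u'⟩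
    iterate 3
      simp only [Op1.app, Op2.app, Val.ofProp, reduceCtorEq, if_false] at h3 ⊢
      exact (Comp.iteFalse h3 .nil).mono (by omega) le_rfl
    rw [show (Op2.eq.app (Op1.kind.app (.pair u u')) (.nat 3) : Val F) = .nat 1 by
      simp [Op1.app, Op2.app, Val.ofProp]] at h3
    have h4 : Comp O R M (.pair u u' :: σ) (.bind (.op1 .fst (.var 0)) (matchProg v))
        (.ofProp (u = v)) (τ + 3) 0 :=
      (Comp.bind (.op1 .fst (.var 0 rfl) rfl) (hv u _)).mono (by omega) le_rfl
    have h5 : Comp O R M (.pair u u' :: σ) (.bind (.op1 .snd (.var 0)) (matchProg w))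
        (.ofProp (u' = w)) (τ' + 3) 0 :=
      (Comp.bind (.op1 .snd (.var 0 rfl) rfl) (hw u' _)).mono (by omega) le_rfl
    by_cases h : u = v
    · refine (Comp.iteTrue h3 (by simp) (.iteTrue h4 (by simp [Val.ofProp, h]) ?_)).mono
        (τ := 4 + (τ + 3 + (τ' + 3) + 1) + 1) (q := 0 + (0 + 0)) (by omega) le_rfl
      simpa [Val.ofProp, h] using h5
    · rw [show (Val.ofProp (u = v) : Val F) = .nil by simp [Val.ofProp, h]] at h4
      rw [show (Val.ofProp (Val.pair u u' = .pair v w) : Val F) = .nil by simp [Val.ofProp, h]]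
      exact (Comp.iteTrue h3 (by simp) (.iteFalse h4 .nil)).mono (by omega) le_rfl

theorem comp_constProg (v : Val F) : ∃ τ, ∀ σ, Comp O R M σ (constProg v) v τ 0 := by
  induction v with
  | nil => exact ⟨1, fun σ => .nil⟩
  | nat m => exact ⟨1, fun σ => .nat m⟩
  | sym a => exact ⟨1, fun σ => .sym a⟩
  | pair v w ihv ihw =>
    obtain ⟨τ, hv⟩ := ihv
    obtain ⟨τ', hw⟩ := ihw
    exact ⟨_, fun σ => .op2 .pair (hv σ) (hw σ) rfl⟩

theorem comp_tableProg (h : Val F → Val F) (l : List (Val F)) :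
    ∃ τ, ∀ u ∈ l, ∀ σ, Comp O R M (u :: σ) (tableProg h l) (h u) τ 0 := by
  induction l with
  | nil => exact ⟨0, fun u hu => by simp at hu⟩
  | cons v l ih =>
    obtain ⟨τ₁, h₁⟩ := ih
    obtain ⟨τ₂, h₂⟩ := comp_matchProg (O := O) (R := R) (M := M) v
    obtain ⟨τ₃, h₃⟩ := comp_constProg (O := O) (R := R) (M := M) (h v)
    refine ⟨τ₁ + τ₂ + τ₃ + 1, fun u hu σ => ?_⟩
    by_cases huv : u = v
    · subst huv
      exact (Comp.iteTrue (h₂ u σ) (by simp [Val.ofProp]) (h₃ _)).mono (by omega) le_rfl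
    · have h4 := h₂ u σ
      rw [Val.ofProp, if_neg huv] at h4
      exact (Comp.iteFalse h4 (h₁ u ((List.mem_cons.1 hu).resolve_left huv) σ)).mono
        (by omega) le_rfl

/-- Every list recoverable code over a finite field has a global list recovery algorithm. -/
theorem ListRecoverable.exists_globalRecoverer [Finite F] {n k ℓ L : ℕ} {α : ℝ}
    {C : (Fin k → F) → (Fin n → F)} (h : ListRecoverable C α ℓ L) :
    ∃ (T : ℕ) (G : Alg F), GlobalRecoverer C α ℓ L T G := by
  classical
  have := Fintype.ofFinite F
  set out : (Fin n → List F) → List (Fin n → F) := fun l =>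
    (Finset.univ.filter fun x : Fin k → F =>
      listDist (C x) (fun i => (l i).toFinset) ≤ α).toList.map C with hout
  -- Over a finite field there are finitely many inputs, so a table lookup serves as the algorithm,
  -- and the largest cost over the table bounds its time.
  have hfin : {l : Fin n → List F | ∀ i, (l i).length = ℓ}.Finite :=
    Set.Finite.pi' fun _ => List.finite_length_eq F ℓ
  set val : Val F → Val F := Function.extend encLists (fun l => encWords (out l)) fun _ => .nil
  obtain ⟨τ, hτ⟩ := comp_tableProg (O := noOracle) (R := fun _ => 0) (M := 1) val
    (hfin.toFinset.toList.map encLists)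
  have hsize : ∃ T, ∀ l ∈ hfin.toFinset, τ + (encWords (out l)).size ≤ T :=
    ⟨hfin.toFinset.sup fun l => τ + (encWords (out l)).size, fun l hl =>
      Finset.le_sup (f := fun l => τ + (encWords (out l)).size) hl⟩
  obtain ⟨T, hT⟩ := hsize
  refine ⟨T, ⟨tableProg val (hfin.toFinset.toList.map encLists), 0, 1, one_pos⟩, rfl,
    fun S l hl => ⟨out l, ?_, ?_, ?_, fun ω => ?_⟩⟩
  · have hS : (fun i => (l i).toFinset) = S := by
      funext i
      ext a
      simp [(hl i).2.2 a]
    have hcard : ∀ i, (S i).card = ℓ := fun i => by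
      rw [← congrFun hS i, List.toFinset_card_of_nodup (hl i).1, (hl i).2.1]
    have h1 := h S hcard
    have h2 : ({x | listDist (C x) S ≤ α} : Set (Fin k → F)) =
        ↑(Finset.univ.filter fun x : Fin k → F => listDist (C x) S ≤ α) := by simp
    rw [h2, Set.encard_coe_eq_coe_finsetCard] at h1
    simp only [hout, List.length_map, Finset.length_toList, hS]
    exact_mod_cast h1
  · intro c hc
    obtain ⟨x, _, rfl⟩ := List.mem_map.1 hc
    exact ⟨x, rfl⟩
  · intro x hx
    have hS : (fun i => (l i).toFinset) = S := by
      funext i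
      ext a
      simp [(hl i).2.2 a]
    refine List.mem_map.2 ⟨x, ?_, rfl⟩
    simpa [hS] using hx
  · have hmem : l ∈ hfin.toFinset := hfin.mem_toFinset.2 fun i => (hl i).2.1
    obtain ⟨τ', q', he, hτ', -⟩ := hτ (encLists l)
      (List.mem_map.2 ⟨l, Finset.mem_toList.2 hmem, rfl⟩) []
    have hcells : (Alg.cells ⟨tableProg val (hfin.toFinset.toList.map encLists), 0, 1, one_pos⟩ ω)
        = fun _ => 0 := by
      funext j
      simp [Alg.cells]
    rw [show val (encLists l) = encWords (out l) from encLists_injective.extend_apply _ _ l] at he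
    refine ⟨_, q', ⟨τ', ?_, rfl⟩, ?_⟩
    · rw [hcells]
      exact he
    · have := hT l hmem
      change τ' + (encWords (out l)).size ≤ T
      omega

end Table

/-! ### Local decoders -/

section Decoder

variable {F : Type*} [Field F] {k m t Q : ℕ} {α : ℝ} {E : (Fin k → F) → (Fin t → Fin m) → F}

theorem Alg.Run.det {A : Alg F} {O : Val F → Val F} {ω : A.Tape} {inp out out' : Val F}
    {τ τ' q q' : ℕ} (h : A.Run O ω inp out τ q) (h' : A.Run O ω inp out' τ' q') :
    out = out' ∧ τ = τ' ∧ q = q' := by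
  obtain ⟨s, h, rfl⟩ := h
  obtain ⟨s', h', rfl⟩ := h'
  obtain ⟨rfl, rfl, rfl⟩ := h.det h'
  simp

/-- A local decoder over a finite field has a running time. -/
theorem LocalDecoder.exists_time [Finite F] {B : Alg F} (h : LocalDecoder E Q α B) :
    ∃ T : ℕ, LocalDecoderTime k m t B T := by
  have key (x : ((Fin t → Fin m) → F) × Fin k × B.Tape) : ∃ τ : ℕ, ∃ out q,
      B.Run (wordOracle x.1) x.2.2 (.nat x.2.1) out τ q := by
    obtain ⟨out, τ, q, hr, -⟩ := h.1 x.1 x.2.1 x.2.2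
    exact ⟨τ, out, q, hr⟩
  choose τ out q hr using key
  -- There are finitely many words, inputs and tapes.
  obtain ⟨T, hT⟩ := (Set.finite_range τ).bddAbove
  exact ⟨T, fun w i ω => ⟨_, _, _, hr (w, i, ω), by exact_mod_cast hT ⟨_, rfl⟩⟩⟩

/-- Two events of probability at least 2/3 on the same tape meet, and there determinism identifies
the two outputs. -/
theorem not_two_outputs {B : Alg F} {O O' : Val F → Val F} {inp out out' : Val F}
    (hO : ∀ ω out, B.Outputs O' ω inp out → B.Outputs O ω inp out) (hne : out ≠ out')
    (h : 2 / 3 ≤ B.prob fun ω => B.Outputs O ω inp out)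
    (h' : 2 / 3 ≤ B.prob fun ω => B.Outputs O' ω inp out') : False := by
  classical
  have : Nonempty (Fin B.base) := ⟨⟨0, B.base_pos⟩⟩
  rw [Alg.prob, Nat.card_eq_fintype_card (α := B.Tape), Nat.card_eq_fintype_card,
    Fintype.card_subtype, le_div_iff₀ (by exact_mod_cast Fintype.card_pos)] at h h'
  have hdisj : Disjoint (Finset.univ.filter fun ω => B.Outputs O ω inp out)
      (Finset.univ.filter fun ω => B.Outputs O' ω inp out') := by
    rw [Finset.disjoint_filter]
    rintro ω - ⟨τ, q, h1⟩ h2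
    obtain ⟨τ', q', h3⟩ := hO _ _ h2
    exact hne (h1.det h3).1
  have hcard := Finset.card_le_univ (Finset.disjUnion _ _ hdisj)
  rw [Finset.card_disjUnion] at hcard
  have hcard' : ((Finset.univ.filter fun ω => B.Outputs O ω inp out).card : ℝ) +
      (Finset.univ.filter fun ω => B.Outputs O' ω inp out').card ≤ Fintype.card B.Tape := by
    exact_mod_cast hcard
  have hpos : (0 : ℝ) < Fintype.card B.Tape := by exact_mod_cast Fintype.card_pos
  linarith

/-- A local decoder has to make queries. -/
theorem LocalDecoder.queries_pos (hk : 1 ≤ k) (hα : 0 < α) {B : Alg F}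
    (h : LocalDecoder E Q α B) : 1 ≤ Q := by
  by_contra hQ
  obtain rfl : Q = 0 := by omega
  have hd : ∀ w : (Fin t → Fin m) → F, wordDist w w ≤ α := fun w => by
    simp [wordDist, hα.le]
  refine not_two_outputs (O := wordOracle (E fun _ => 0)) (O' := wordOracle (E fun _ => 1)) ?_ ?_
    (h.2 (fun _ => 0) _ (hd _) ⟨0, hk⟩) (h.2 (fun _ => 1) _ (hd _) ⟨0, hk⟩)
  -- A run without queries is the same for both oracles, so it cannot tell the message 0 from the
  -- message 1.
  · rintro ω out ⟨τ, q, hr⟩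
    obtain ⟨out', τ', q', hr', hq'⟩ := h.1 (E fun _ => 1) ⟨0, hk⟩ ω
    obtain ⟨rfl, rfl, rfl⟩ := hr.det hr'
    obtain ⟨s, hs, rfl⟩ := hr
    have hq0 : q = 0 := Nat.le_zero.1 (by exact_mod_cast hq')
    exact ⟨_, _, s, hs.of_queries_eq_zero hq0 _, rfl⟩
  · simp

/-- No local decoder corrects all errors. -/
theorem LocalDecoder.radius_lt_one (hk : 1 ≤ k) {B : Alg F}
    (h : LocalDecoder E Q α B) : α < 1 := by
  by_contra hα
  push Not at hα
  have hd : ∀ w v : (Fin t → Fin m) → F, wordDist w v ≤ α := fun w v => by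
    refine le_trans (div_le_one_of_le₀ ?_ (by positivity)) hα
    exact_mod_cast Nat.card_le_card_of_injective (Subtype.val) Subtype.val_injective
  exact not_two_outputs (O := wordOracle (E fun _ => 0)) (O' := wordOracle (E fun _ => 0))
    (fun _ _ h => h) (by simp) (h.2 (fun _ => 0) _ (hd _ _) ⟨0, hk⟩)
    (h.2 (fun _ => 1) _ (hd _ _) ⟨0, hk⟩)

end Decoder

/-! ### Tensor powers -/

section Tensor

variable {F : Type*} [Field F] {n k t : ℕ} {δ : ℝ} (C : (Fin k → F) →ₗ[F] (Fin n → F))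

theorem toMatrix'_sum_mul (y : Fin k → F) (a : Fin n) :
    ∑ b, LinearMap.toMatrix' C a b * y b = C y a := by
  conv_rhs => rw [← Matrix.toLin'_toMatrix' C, Matrix.toLin'_apply]
  rfl

theorem tensorPow_cons (x : (Fin (t + 1) → Fin k) → F) (a : Fin n) (i : Fin t → Fin n) :
    tensorPow C (t + 1) x (Fin.cons a i) =
      ∑ b, ∑ j, LinearMap.toMatrix' C a b * tensorGen (LinearMap.toMatrix' C) t i j *
        x (Fin.cons b j) := by
  change ∑ j, tensorGen (LinearMap.toMatrix' C) (t + 1) (Fin.cons a i) j * x j = _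
  rw [← (Fin.consEquiv (fun _ : Fin (t + 1) => Fin k)).sum_comp, Fintype.sum_prod_type]
  rfl

/-- The encoding may act last in the first direction: the column through `i` is the encoding by C of
the entries at `i` of the encoded message slices. -/
theorem tensorPow_column (x : (Fin (t + 1) → Fin k) → F) (a : Fin n) (i : Fin t → Fin n) :
    tensorPow C (t + 1) x (Fin.cons a i) =
      C (fun b => tensorPow C t (fun j => x (Fin.cons b j)) i) a := by
  rw [tensorPow_cons, ← toMatrix'_sum_mul]
  refine Finset.sum_congr rfl fun b _ => ?_
  rw [tensorPow, Matrix.mulVec, dotProduct, Finset.mul_sum]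
  exact Finset.sum_congr rfl fun j _ => mul_assoc _ _ _

/-- The encoding may also act first in the first direction: each slice of the codeword encodes a
linear combination of the message slices. Columns and slices together give the induction for
`IsTensor`. -/
theorem tensorPow_row (x : (Fin (t + 1) → Fin k) → F) (a : Fin n) (i : Fin t → Fin n) :
    tensorPow C (t + 1) x (Fin.cons a i) =
      tensorPow C t (fun j => ∑ b, LinearMap.toMatrix' C a b * x (Fin.cons b j)) i := by
  rw [tensorPow_cons, Finset.sum_comm, tensorPow, Matrix.mulVec, dotProduct]
  refine Finset.sum_congr rfl fun j _ => ?_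
  rw [Finset.mul_sum]
  exact Finset.sum_congr rfl fun b _ => by ring

theorem isTensor_tensorPow (x : (Fin t → Fin k) → F) :
    IsTensor (Set.range C) t (tensorPow C t x) := by
  induction t with
  | zero => trivial
  | succ t ih =>
    refine ⟨fun i' => ⟨fun b => tensorPow C t (fun j => x (Fin.cons b j)) i', ?_⟩, fun r => ?_⟩
    · funext a
      exact (tensorPow_column C x a i').symm
    · simp only [tensorPow_row]
      exact ih _

theorem tensorPow_castLE (hk : k ≤ n) (hC : ∀ x i, C x (Fin.castLE hk i) = x i)
    (x : (Fin t → Fin k) → F) (i : Fin t → Fin k) :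
    tensorPow C t x (fun a => Fin.castLE hk (i a)) = x i := by
  induction t with
  | zero =>
    rw [tensorPow, Matrix.mulVec, dotProduct, Fintype.sum_eq_single i
      fun j h => absurd (Subsingleton.elim _ _) h]
    simp [tensorGen]
  | succ t ih =>
    rw [← Fin.cons_self_tail i, castLE_cons, tensorPow_column, hC, ih]

variable {C}

/-- A systematic code is injective, so 1/n is an admissible lower bound and δ, the largest one, is
at least that. -/
theorem IsRelDist.pos (h : IsRelDist C δ) (hn : 1 ≤ n) (hk : k ≤ n)
    (hC : ∀ x i, C x (Fin.castLE hk i) = x i) : 0 < δ := by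
  have hn' : (0 : ℝ) < n := by exact_mod_cast hn
  refine lt_of_lt_of_le (by positivity : (0 : ℝ) < 1 / n) (h.2 fun x y hxy => ?_)
  rw [wordDist, Nat.card_eq_fintype_card (α := Fin n), Fintype.card_fin]
  gcongr
  obtain ⟨i, hi⟩ := Function.ne_iff.1 hxy
  have : Nonempty {i // C x i ≠ C y i} := ⟨⟨Fin.castLE hk i, by rwa [hC, hC]⟩⟩
  exact_mod_cast Nat.card_pos (α := {i // C x i ≠ C y i})

/-- The Singleton bound. -/
theorem IsRelDist.le (h : IsRelDist C δ) (hn : 1 ≤ n) (hk1 : 1 ≤ k) (hk : k ≤ n)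
    (hC : ∀ x i, C x (Fin.castLE hk i) = x i) : δ ≤ 1 - ((k : ℝ) - 1) / n := by
  classical
  have hn' : (0 : ℝ) < n := by exact_mod_cast hn
  obtain ⟨k, rfl⟩ : ∃ k', k = k' + 1 := ⟨k - 1, by omega⟩
  -- The codeword of this unit message vanishes at all other systematic coordinates.
  set x : Fin (k + 1) → F := Pi.single (Fin.last k) 1 with hx
  have hx0 : x ≠ 0 := by simp [hx]
  have h1 := h.1 x 0 hx0
  rw [wordDist, Nat.card_eq_fintype_card (α := Fin n), Fintype.card_fin] at h1
  have h2 : Nat.card {i // C x i ≠ C 0 i} + k ≤ n := by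
    rw [Nat.card_eq_fintype_card, Fintype.card_subtype]
    have hsub : Finset.univ.map ⟨fun j : Fin k => Fin.castLE hk j.castSucc, fun a b hab => by
        simpa using hab⟩ ⊆ (Finset.univ.filter fun i => C x i ≠ C 0 i)ᶜ := by
      intro i hi
      obtain ⟨j, -, rfl⟩ := Finset.mem_map.1 hi
      have hj : C x (Fin.castLE hk j.castSucc) = 0 := by
        rw [hC, hx, Pi.single_eq_of_ne (Fin.castSucc_ne_last j)]
      simpa using hj
    have := Finset.card_le_card hsub
    rw [Finset.card_map, Finset.card_compl, Finset.card_univ, Fintype.card_fin,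
      Fintype.card_fin] at this
    have h3 := Finset.card_le_univ (Finset.univ.filter fun i => C x i ≠ C 0 i)
    rw [Fintype.card_fin] at h3
    omega
  have h3 : (Nat.card {i // C x i ≠ C 0 i} : ℝ) + k ≤ n := by exact_mod_cast h2
  refine h1.trans ?_
  rw [div_le_iff₀ hn']
  push_cast
  field_simp
  linarith

end Tensor

/-! ### The local list recovery algorithm -/

theorem Alg.prob_mono {F : Type*} {A : Alg F} {E E' : A.Tape → Prop} (h : ∀ ω, E ω → E' ω) :
    A.prob E ≤ A.prob E' := by
  rw [Alg.prob, Alg.prob]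
  gcongr
  exact Nat.card_le_card_of_injective (fun ω : {ω // E ω} => (⟨ω.1, h _ ω.2⟩ : {ω // E' ω}))
    fun a b hab => Subtype.ext (congrArg (fun c => c.1) hab)

/-- The factor ρ^s turns a fraction of the n^s codeword coordinates into a count relative to the k^s
systematic ones. -/
theorem numBad_le {F : Type*} {n k s ℓ : ℕ} {α α' δ : ℝ} {l : (Fin s → Fin n) → List F} {S : (Fin s → Fin n) → Finset F}
    (hl : Presents l S ℓ) {W : (Fin s → Fin n) → F} (hn : 1 ≤ n)
    (h : listDist W S ≤ α * α' * ((k : ℝ) / n) ^ s * δ) :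
    (numBad l W : ℝ) ≤ α * α' * k ^ s * δ := by
  classical
  have hn' : (0 : ℝ) < n := by exact_mod_cast hn
  rw [listDist, Nat.card_eq_fintype_card (α := Fin s → Fin n), div_le_iff₀ (by simp; positivity)]
    at h
  have h1 : Nat.card {i // W i ∉ S i} = numBad l W := by
    rw [Nat.card_eq_fintype_card, Fintype.card_subtype, numBad]
    congr 1
    ext i
    simp [(hl i).2.2]
  rw [h1] at h
  refine h.trans (le_of_eq ?_)
  simp only [Fintype.card_fun, Fintype.card_fin, Nat.cast_pow, div_pow]
  field_simp

/-! ### Cost bounds in terms of `X`, and the assembly -/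

section Main

variable {F : Type*} [Field F] {n k k' s m θ ℓ L T T' Q' : ℕ} {α α' δ X : ℝ}

theorem size_le_logb (hn : 1 ≤ n) : (Nat.size n : ℝ) ≤ Real.logb 2 n + 1 := by
  have h1 : 2 ^ (Nat.size n - 1) ≤ n :=
    Nat.lt_size.1 (Nat.sub_lt (Nat.size_pos.2 hn) one_pos)
  have h2 : ((Nat.size n - 1 : ℕ) : ℝ) ≤ Real.logb 2 n := by
    rw [Real.le_logb_iff_rpow_le (by norm_num) (by exact_mod_cast hn), Real.rpow_natCast]
    exact_mod_cast h1
  have h3 : (Nat.size n : ℝ) ≤ ((Nat.size n - 1 : ℕ) : ℝ) + 1 := by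
    exact_mod_cast (by omega : Nat.size n ≤ Nat.size n - 1 + 1)
  linarith

theorem one_le_logb (hn : 2 ≤ n) : 1 ≤ Real.logb 2 n := by
  have hn' : (2 : ℝ) ≤ n := by exact_mod_cast hn
  rw [Real.le_logb_iff_rpow_le (by norm_num) (by linarith)]
  simpa using hn'

theorem pow_eq_two_rpow (hL : 2 ≤ L) (N : ℕ) :
    ((L ^ N : ℕ) : ℝ) = (2 : ℝ) ^ (Real.logb 2 L * N) := by
  have hL' : (2 : ℝ) ≤ L := by exact_mod_cast hL
  rw [Real.rpow_mul (by norm_num), Real.rpow_logb (by norm_num) (by norm_num) (by linarith),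
    Real.rpow_natCast, Nat.cast_pow]

theorem logb_mul_pow_le (hΛm : Real.logb 2 L ≤ m) :
    Real.logb 2 L * (m : ℝ) ^ s ≤ (m : ℝ) ^ (s + 1) := by
  rw [pow_succ']
  gcongr

/-- The number of descriptions is 2^(Λ m^s) with Λ = log L. All other factors except log n amount to
24 Z ≤ 2^(24 Z), and 25 Z ≤ X. The length n enters through its bit length only once, so log n stays
outside the exponential. -/
theorem preprocessing_bound (hn : 2 ≤ n) (hL : 2 ≤ L) (hm : 1 ≤ m) (hΛm : Real.logb 2 L ≤ m)
    (hX : 154 * ((s : ℝ) + 1) ^ 2 * (m : ℝ) ^ (s + 1) ≤ X) :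
    ((2 * (L ^ m ^ s * ((n.size + L.size + 6) * (s + 1) * m ^ s + 1) + 1) : ℕ) : ℝ) ≤
      (2 : ℝ) ^ X * Real.logb 2 n := by
  set Λ := Real.logb 2 L with hΛ
  set lg := Real.logb 2 n with hlg
  have hΛ1 : 1 ≤ Λ := one_le_logb hL
  have hlg1 : 1 ≤ lg := one_le_logb hn
  have h1 := size_le_logb (n := n) (by omega)
  have h2 := size_le_logb (n := L) (by omega)
  have hm' : (1 : ℝ) ≤ (m : ℝ) ^ s := one_le_pow₀ (by exact_mod_cast hm)
  have hs : (1 : ℝ) ≤ s + 1 := by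
    have : (0 : ℝ) ≤ s := by positivity
    linarith
  set Z := ((s : ℝ) + 1) * (Λ * (m : ℝ) ^ s) with hZ
  have hZ1 : 1 ≤ Z := one_le_mul_of_one_le_of_one_le hs (one_le_mul_of_one_le_of_one_le hΛ1 hm')
  have hN := pow_eq_two_rpow hL (m ^ s)
  set N : ℝ := ((L ^ m ^ s : ℕ) : ℝ) with hNdef
  have hN1 : 1 ≤ N := by
    rw [hNdef]
    exact_mod_cast Nat.one_le_pow _ _ (by omega)
  have h3 : (n.size : ℝ) + L.size + 6 ≤ 10 * (Λ * lg) := by nlinarith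
  have h4 : ((n.size : ℝ) + L.size + 6) * (s + 1) * (m : ℝ) ^ s ≤ 10 * (Z * lg) := by
    calc _ ≤ 10 * (Λ * lg) * (s + 1) * (m : ℝ) ^ s := by gcongr
      _ = _ := by rw [hZ]; ring
  have h5 : (1 : ℝ) ≤ Z * lg := one_le_mul_of_one_le_of_one_le hZ1 hlg1
  have h6 : 25 * Z ≤ X := by
    refine le_trans ?_ hX
    have h7 : Z ≤ (s + 1) * (m : ℝ) ^ (s + 1) := by
      rw [hZ]
      gcongr
      exact logb_mul_pow_le hΛm
    have h8 : ((s : ℝ) + 1) * (m : ℝ) ^ (s + 1) ≤ ((s : ℝ) + 1) ^ 2 * (m : ℝ) ^ (s + 1) := by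
      gcongr
      exact le_self_pow₀ hs (by norm_num)
    have h9 : 0 ≤ ((s : ℝ) + 1) ^ 2 * (m : ℝ) ^ (s + 1) := by positivity
    linarith
  have h7 : Λ * (m : ℝ) ^ s ≤ Z := le_mul_of_one_le_left (by positivity) hs
  push_cast
  rw [show ((L : ℝ) ^ m ^ s) = N by rw [hNdef]; push_cast; rfl]
  calc 2 * (N * (((n.size : ℝ) + L.size + 6) * (s + 1) * (m : ℝ) ^ s + 1) + 1)
      ≤ 2 * (N * (10 * (Z * lg) + Z * lg) + N * (Z * lg)) := by
        have : (1 : ℝ) ≤ N * (Z * lg) := one_le_mul_of_one_le_of_one_le hN1 h5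
        gcongr
    _ = N * (24 * Z) * lg := by ring
    _ ≤ (2 : ℝ) ^ (Λ * (m : ℝ) ^ s) * (2 : ℝ) ^ (24 * Z) * lg := by
        rw [hN]
        push_cast
        gcongr
        exact le_two_rpow _
    _ ≤ (2 : ℝ) ^ X * lg := by
        rw [← Real.rpow_add (by norm_num)]
        gcongr
        · norm_num
        · linarith

theorem numDesc_le (hL : 2 ≤ L) (hΛm : Real.logb 2 L ≤ m)
    (hX : 154 * ((s : ℝ) + 1) ^ 2 * (m : ℝ) ^ (s + 1) ≤ X) :
    ((L ^ m ^ s : ℕ) : ℝ) ≤ (2 : ℝ) ^ X := by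
  rw [pow_eq_two_rpow hL]
  refine Real.rpow_le_rpow_of_exponent_le (by norm_num) ?_
  push_cast
  refine (logb_mul_pow_le hΛm).trans (le_trans ?_ hX)
  have : (1 : ℝ) ≤ ((s : ℝ) + 1) ^ 2 := one_le_pow₀ (by linarith [s.cast_nonneg (α := ℝ)])
  have h2 : (0 : ℝ) ≤ (m : ℝ) ^ (s + 1) := by positivity
  nlinarith

theorem query_bound {q : ℕ} (hq : q ≤ Q') (hm : 1 ≤ m)
    (hX : 154 * ((s : ℝ) + 1) ^ 2 * (m : ℝ) ^ (s + 1) ≤ X) :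
    ((q * (n * (s + 1) * m ^ s) : ℕ) : ℝ) ≤ Q' * n * X := by
  have hs : (1 : ℝ) ≤ s + 1 := by linarith [s.cast_nonneg (α := ℝ)]
  have hq' : (q : ℝ) ≤ Q' := by exact_mod_cast hq
  have hm' : (1 : ℝ) ≤ m := by exact_mod_cast hm
  have h1 : ((s : ℝ) + 1) * (m : ℝ) ^ s ≤ X := by
    refine le_trans ?_ hX
    have h2 : ((s : ℝ) + 1) * (m : ℝ) ^ s ≤ ((s : ℝ) + 1) ^ 2 * (m : ℝ) ^ (s + 1) := by
      gcongr
      · exact le_self_pow₀ hs (by norm_num)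
      · omega
    have h9 : 0 ≤ ((s : ℝ) + 1) ^ 2 * (m : ℝ) ^ (s + 1) := by positivity
    linarith
  push_cast
  calc (q : ℝ) * (n * (s + 1) * (m : ℝ) ^ s) = q * n * ((s + 1) * (m : ℝ) ^ s) := by ring
    _ ≤ _ := by gcongr

/-- Since Q' and T are at least 1, the additive overheads fit under Q' * T. The constant 154 comes
from (8s + 130)(s + 1) + 8s + 24 = 8s² + 146s + 154. -/
theorem time_bound {τ q : ℕ} (hτ : (τ : ℝ) ≤ T') (hq : q ≤ Q') (hQ : 1 ≤ Q') (hT : 1 ≤ T)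
    (hm : 1 ≤ m) (hX : 154 * ((s : ℝ) + 1) ^ 2 * (m : ℝ) ^ (s + 1) ≤ X) :
    ((τ + q * (T * (8 * s + 130) * (s + 1) * m ^ (s + 1) + 8 * s + 18) + 6 : ℕ) : ℝ) ≤
      T' + Q' * T * X := by
  have h1 : T * (8 * s + 130) * (s + 1) * m ^ (s + 1) + 8 * s + 18 + 6 ≤
      T * (154 * (s + 1) ^ 2 * m ^ (s + 1)) := by
    have hM : 1 ≤ m ^ (s + 1) := Nat.one_le_pow _ _ hm
    have h2 : 1 ≤ T * m ^ (s + 1) := one_le_mul_of_one_le_of_one_le hT hM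
    calc T * (8 * s + 130) * (s + 1) * m ^ (s + 1) + 8 * s + 18 + 6
        = (8 * s + 130) * (s + 1) * (T * m ^ (s + 1)) + (8 * s + 24) * 1 := by ring
      _ ≤ (8 * s + 130) * (s + 1) * (T * m ^ (s + 1)) + (8 * s + 24) * (T * m ^ (s + 1)) := by
          gcongr
      _ = (8 * s ^ 2 + 146 * s + 154) * (T * m ^ (s + 1)) := by ring
      _ ≤ (154 * (s + 1) ^ 2) * (T * m ^ (s + 1)) := by
          refine Nat.mul_le_mul_right _ ((Nat.le_add_right _ (146 * s ^ 2 + 162 * s)).trans_eq ?_)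
          ring
      _ = _ := by ring
  have h2 : q * (T * (8 * s + 130) * (s + 1) * m ^ (s + 1) + 8 * s + 18) + 6 ≤
      Q' * (T * (154 * (s + 1) ^ 2 * m ^ (s + 1))) := by
    calc _ ≤ Q' * (T * (8 * s + 130) * (s + 1) * m ^ (s + 1) + 8 * s + 18) + Q' * 6 := by
          gcongr
          omega
      _ = Q' * (T * (8 * s + 130) * (s + 1) * m ^ (s + 1) + 8 * s + 18 + 6) := by ring
      _ ≤ _ := by gcongr
  have h3 : ((q * (T * (8 * s + 130) * (s + 1) * m ^ (s + 1) + 8 * s + 18) + 6 : ℕ) : ℝ) ≤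
      Q' * T * X := by
    calc _ ≤ ((Q' * (T * (154 * (s + 1) ^ 2 * m ^ (s + 1))) : ℕ) : ℝ) := by exact_mod_cast h2
      _ = Q' * T * (154 * ((s : ℝ) + 1) ^ 2 * (m : ℝ) ^ (s + 1)) := by push_cast; ring
      _ ≤ _ := by gcongr
  rw [add_assoc, Nat.cast_add]
  linarith

theorem ListRecovery.recoversLists {C : (Fin k → F) →ₗ[F] (Fin n → F)}
    {g : (Fin n → List F) → List (Fin n → F)} (hn : 1 ≤ n) (hg : ListRecovery C α ℓ g)
    (hδ : IsRelDist C δ)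
    (hL : ∀ l : Fin n → List F, (∀ a, IsSetList ℓ (l a)) → (g l).length ≤ L) :
    RecoversLists (Set.range C) α δ (IsSetList ℓ) g L := by
  classical
  refine ⟨hL, hg.mem_range, fun l hl c hc h => hg.mem l hl c hc ?_, ?_⟩
  · rw [Nat.card_eq_fintype_card, Fintype.card_subtype]
    convert h
  · rintro _ ⟨x, rfl⟩ _ ⟨y, rfl⟩ hne
    have h1 := hδ.1 x y fun h => hne (by rw [h])
    rw [wordDist, Nat.card_eq_fintype_card (α := Fin n), Fintype.card_fin,
      le_div_iff₀ (by exact_mod_cast hn), Nat.card_eq_fintype_card, Fintype.card_subtype] at h1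
    convert h1

/-- For k = 1 the distance may be 1, and powers of δ gain nothing; there α' < 1 leaves fewer than
one bad coordinate. For k ≥ 2 this is `badCoeff_le`. -/
theorem badCoeff_mul_numBad_le {b : ℕ} (hα : 0 < α) (hα1 : α ≤ 1) (hα' : 0 < α') (hα1' : α' < 1)
    (hk1 : 1 ≤ k) (hk : k ≤ n) (hδ : 0 < δ) (hδ' : δ ≤ 1 - ((k : ℝ) - 1) / n)
    (hb : (b : ℝ) ≤ α * α' * k ^ (s + 1) * δ ^ (200 * (s + 1))) :
    badCoeff α (8 / δ) n k s * b ≤ α' / 6 := by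
  rcases hk1.eq_or_lt with rfl | hk2
  · have hδ1 : δ ≤ 1 := by simpa using hδ'
    have h1 : (b : ℝ) < 1 := by
      refine hb.trans_lt ?_
      rw [Nat.cast_one, one_pow, mul_one]
      have h2 : δ ^ (200 * (s + 1)) ≤ 1 := pow_le_one₀ hδ.le hδ1
      calc α * α' * δ ^ (200 * (s + 1)) ≤ 1 * α' * 1 := by gcongr
        _ < 1 := by linarith
    have h2 : b = 0 := by
      have : b < 1 := by exact_mod_cast h1
      omega
    rw [h2, Nat.cast_zero, mul_zero]
    positivity
  · have h1 := badCoeff_le (s := s) hα hk2 hk hδ hδ'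
    have h2 := badCoeff_nonneg (n := n) (k := k) (s := s) hα (κ := 8 / δ) (by positivity)
    calc badCoeff α (8 / δ) n k s * b
        ≤ badCoeff α (8 / δ) n k s * (α * α' * k ^ (s + 1) * δ ^ (200 * (s + 1))) := by gcongr
      _ = α' * (α * k ^ (s + 1) * badCoeff α (8 / δ) n k s * δ ^ (200 * (s + 1))) := by ring
      _ ≤ α' * (1 / 6) := by gcongr
      _ = _ := by ring

theorem exists_localListRecoverer {C : (Fin k → F) →ₗ[F] (Fin n → F)}
    {C' : (Fin k' → F) → (Fin (s + 1) → Fin k) → F} (hn : 2 ≤ n) (hk1 : 1 ≤ k) (hk1' : 1 ≤ k')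
    (hℓ : 1 ≤ ℓ) (hL : 2 ≤ L) (hα : 0 < α) (hα1 : α ≤ 1) (hα' : 0 < α') (hα1' : α' ≤ 1)
    (hC : Systematic C) (hδ : IsRelDist C δ) {G B : Alg F} (hG : GlobalRecoverer C α ℓ L T G)
    (hB : LocalDecoder C' Q' α' B) (hB' : LocalDecoderTime k' k (s + 1) B T')
    (hX : Real.logb 2 L ^ (s + 1) / ((α * α') ^ (200 * (s + 1)) *
      ((k : ℝ) / n * δ) ^ (200 * (s + 1) ^ 2)) = X) :
    ∃ A D : Alg F,
      LocalListRecoverer (fun x => tensorPow C (s + 1) (C' x)) (Q' * n * X)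
        (α * α' * ((k : ℝ) / n) ^ (s + 1) * δ ^ (200 * (s + 1))) ℓ ((2 : ℝ) ^ X) A D ∧
      PreprocessingTime A ((2 : ℝ) ^ X * Real.logb 2 n) ∧
      LocalRecoveryTime k' n (s + 1) ℓ A D (T' + Q' * T * X) := by
  classical
  obtain ⟨hk, hsys⟩ := hC
  have hn1 : 1 ≤ n := by omega
  have hδ0 := hδ.pos hn1 hk hsys
  have hδ1 := hδ.le hn1 hk1 hk hsys
  have hQ := hB.queries_pos hk1' hα'
  have hα1'' := hB.radius_lt_one hk1'
  obtain ⟨m, θ, hm, hΛm, hmθ, hf, hmX⟩ :=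
    exists_sampling_parameters hn hk1 hk hL hα hα1 hα' hα1' hδ0 hδ1 s
  rw [hX] at hmX
  obtain ⟨g, hg, hcol⟩ := hG.exists_columnProg hn1
  have hrec := hg.recoversLists hn1 hδ (hcol noOracle (fun _ => 0) 0).length_le
  have hL0 : 0 < L := by omega
  have hn0 : 0 < n := by omega
  set A := preAlg F hn0 m L s with hA
  set D := localAlg B (pureProg G.prog) n k m L θ s with hD
  have hout : ∀ ω : A.Tape, A.Outputs noOracle ω .nil
      (encList (descList L (tapeEquiv n m s ω))) := fun ω => by
    obtain ⟨τ, h, -⟩ := run_preAlg (F := F) (L := L) hn0 hm noOracle ω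
    exact ⟨τ, 0, h⟩
  have hrun : ∀ (S : (Fin (s + 1) → Fin n) → Finset F) (l : (Fin (s + 1) → Fin n) → List F),
      Presents l S ℓ → ∀ (R : Fin s → Fin m → Fin n) (f : (Fin s → Fin m) → Fin L) (i : Fin k')
      (ω : D.Tape), ∃ out τ q, D.Run (listOracle l) ω (.pair (encDesc s R f) (.nat i)) out τ q ∧
        (q : ℝ) ≤ Q' * n * X ∧ (τ : ℝ) ≤ T' + Q' * T * X := by
    intro S l hl R f i ω
    have hl' : ∀ j, IsSetList ℓ (l j) := fun j => ⟨(hl j).1, (hl j).2.1⟩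
    have hT : n ≤ T := hg.le_time hα (hcol noOracle (fun _ => 0) 0) hℓ (hl' fun _ => ⟨0, hn0⟩)
    -- The query and time bounds of the decoder hold for every oracle word, hence for the recovered
    -- one, however wrong the advice.
    obtain ⟨out, τ, q, hr, hq⟩ := hB.1 (fun j => recover g θ s R f l fun a => Fin.castLE hk (j a))
      i ω
    obtain ⟨out', τ', q', hr', hτ⟩ :=
      hB' (fun j => recover g θ s R f l fun a => Fin.castLE hk (j a)) i ω
    obtain ⟨rfl, rfl, rfl⟩ := hr.det hr'
    obtain ⟨τ', q', hD', hτ', hq'⟩ := run_localAlg hcol hn1 hm hT hk R f l hl' hr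
    have hq2 : q ≤ Q' := by exact_mod_cast hq
    refine ⟨out, τ', q', hD', ?_, ?_⟩
    · exact le_trans (by exact_mod_cast hq') (query_bound hq2 hm hmX)
    · exact le_trans (by exact_mod_cast hτ') (time_bound hτ hq2 hQ (by omega) hm hmX)
  refine ⟨A, D, ⟨fun ω => ⟨_, hout ω, ?_, ?_⟩, ?_⟩, fun ω => ?_, ?_⟩
  · rw [length_descList]
    exact numDesc_le hL hΛm hmX
  · intro a ha S l hl i ω'
    obtain ⟨f, -, rfl⟩ := List.mem_map.1 ha
    obtain ⟨out, τ, q, h, hq, -⟩ := hrun S l hl (tapeEquiv n m s ω) f i ω'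
    exact ⟨out, τ, q, h, hq⟩
  · intro S l hl x hx
    have hl' : ∀ j, IsSetList ℓ (l j) := fun j => ⟨(hl j).1, (hl j).2.1⟩
    have hT : n ≤ T := hg.le_time hα (hcol noOracle (fun _ => 0) 0) hℓ (hl' fun _ => ⟨0, hn0⟩)
    set W := tensorPow C (s + 1) (C' x) with hW
    have hδ2 : δ ≤ 2 := by
      have : 0 ≤ ((k : ℝ) - 1) / n :=
        div_nonneg (sub_nonneg.2 (by exact_mod_cast hk1)) (by positivity)
      linarith
    have hbad := badCoeff_mul_numBad_le hα hα1 hα' hα1'' hk1 hk hδ0 hδ1 (numBad_le hl hn1 hx)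
    have hnum := numWrong_le (hL := hL0) hrec hα hn1 hk1 hk (by positivity) hmθ
      (fun l hl w hw => card_badSample_le hrec hδ2 l hl w hw) hl'
      (isTensor_tensorPow C (C' x))
    -- Bad samples and bad coordinates contribute α'/6 each, together the α'/3 that Markov's
    -- inequality needs.
    have hfew := card_few_wrong_ge (hL := hL0) (m := m) (θ := θ) (g := g) hn1 hk1 hk hα' l W
      (hnum.trans (by
        gcongr
        linarith))
    have hprob := prob_preAlg (F := F) (L := L) hn0 fun R : Fin s → Fin m → Fin n =>
      ((Finset.univ.filter fun i : Fin (s + 1) → Fin k =>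
        Wrong g θ hL0 s R l W fun a => Fin.castLE hk (i a)).card : ℝ) ≤ α' * k ^ (s + 1)
    refine le_trans ?_ (Alg.prob_mono (A := A) (E := fun ω =>
      ((Finset.univ.filter fun i : Fin (s + 1) → Fin k =>
        Wrong g θ hL0 s (tapeEquiv n m s ω) l W fun a => Fin.castLE hk (i a)).card : ℝ) ≤
        α' * k ^ (s + 1)) fun ω hω => ⟨_, hout ω, encDesc s (tapeEquiv n m s ω)
        (advice g hL0 s (tapeEquiv n m s ω) l W), ?_, fun i => ?_⟩)
    · rw [hprob, Nat.card_eq_fintype_card, Nat.card_eq_fintype_card, Fintype.card_subtype,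
        le_div_iff₀ (by
          have : Nonempty (Fin n) := ⟨⟨0, hn0⟩⟩
          exact_mod_cast Fintype.card_pos)]
      refine le_trans (le_of_eq ?_) (hfew.trans (le_of_eq ?_))
      · simp
      · congr
    · exact List.mem_map.2 ⟨_, Finset.mem_toList.2 (Finset.mem_univ _), rfl⟩
    -- For a good sampling and the right advice the recovered word is α'-close to the inner
    -- codeword, the systematic part of W, so the inner decoder applies.
    · refine (hB.2 x (fun j => recover g θ s (tapeEquiv n m s ω)
        (advice g hL0 s (tapeEquiv n m s ω) l W) l fun a => Fin.castLE hk (j a)) ?_ i).trans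
        (Alg.prob_mono (A := B) fun ω' h => ?_)
      · rw [wordDist, Nat.card_eq_fintype_card (α := Fin (s + 1) → Fin k), div_le_iff₀ (by
          have : Nonempty (Fin k) := ⟨⟨0, hk1⟩⟩
          exact_mod_cast Fintype.card_pos)]
        refine le_trans (le_of_eq ?_) (hω.trans (le_of_eq (by simp)))
        rw [Nat.card_eq_fintype_card, Fintype.card_subtype]
        congr 2
        ext j
        have hj : C' x j = W fun a => Fin.castLE hk (j a) :=
          (tensorPow_castLE C hk hsys (C' x) j).symm
        simp only [Finset.mem_filter, Finset.mem_univ, true_and]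
        rw [Wrong, hj, ne_comm]
      · obtain ⟨τ, q, h⟩ := h
        obtain ⟨τ', q', h', -⟩ := run_localAlg hcol hn1 hm hT hk _ _ l hl' h
        exact ⟨τ', q', h'⟩
  · obtain ⟨τ, h, hτ⟩ := run_preAlg (F := F) (L := L) hn0 hm noOracle ω
    exact ⟨_, τ, 0, h, le_trans (by exact_mod_cast hτ) (preprocessing_bound hn hL hm hΛm hmX)⟩
  · intro ω as has a ha S l hl i ω'
    obtain ⟨τ, q, h⟩ := has
    obtain ⟨τ', q', h'⟩ := hout ω
    -- The time bound concerns every output of the preprocessing; by determinism there is just the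
    -- list of descriptions.
    obtain rfl := encList_injective (h.det h').1
    obtain ⟨f, -, rfl⟩ := List.mem_map.1 ha
    obtain ⟨out, τ, q, h, -, hτ⟩ := hrun S l hl (tapeEquiv n m s ω) f i ω'
    exact ⟨out, τ, q, h, hτ⟩

end Main

end LocalRec

theorem lemma5p4 :
    ∃ c : ℕ, 0 < c ∧
      ∀ (F : Type*) [Field F] [Finite F] (n k k' t ℓ L Q' : ℕ) (ρ δ α α' : ℝ)
        (C : (Fin k → F) →ₗ[F] (Fin n → F)) (C' : (Fin k' → F) → (Fin t → Fin k) → F),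
        2 ≤ n → 1 ≤ k → 1 ≤ k' → 1 ≤ t → 1 ≤ ℓ → 2 ≤ L →
        0 < α → α ≤ 1 → 0 < α' → α' ≤ 1 →
        ρ = (k : ℝ) / (n : ℝ) → Systematic C → IsRelDist C δ →
        ListRecoverable C α ℓ L → LocallyDecodable C' Q' α' →
        let X : ℝ := Real.logb 2 L ^ t / ((α * α') ^ (c * t) * (ρ * δ) ^ (c * t ^ 2))
        let E : (Fin k' → F) → (Fin t → Fin n) → F := fun x => tensorPow C t (C' x)
        let Qt : ℝ := Q' * n * X
        let αt : ℝ := α * α' * ρ ^ t * δ ^ (c * t)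
        let Lt : ℝ := (2 : ℝ) ^ X
        let Tpre : ℝ := (2 : ℝ) ^ X * Real.logb 2 n
        (∃ A D : Alg F,
          LocalListRecoverer E Qt αt ℓ Lt A D ∧ PreprocessingTime A Tpre) ∧
        ∀ T T' : ℕ,
          (∃ G : Alg F, GlobalRecoverer C α ℓ L T G) →
          (∃ B : Alg F, LocalDecoder C' Q' α' B ∧ LocalDecoderTime k' k t B T') →
          ∃ A D : Alg F,
            LocalListRecoverer E Qt αt ℓ Lt A D ∧ PreprocessingTime A Tpre ∧
            LocalRecoveryTime k' n t ℓ A D (T' + Q' * T * X) := by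
  -- A generous choice: `badCoeff_le` spends 100t + s powers of δ, and the bound on m spends 2t +
  -- 22t² powers of ρδ.
  refine ⟨200, by norm_num, ?_⟩
  intro F _ _ n k k' t ℓ L Q' ρ δ α α' C C' hn hk hk' ht hℓ hL hα hα1 hα' hα1' hρ hC hδ hrec hdec
  obtain ⟨s, rfl⟩ : ∃ s, t = s + 1 := ⟨t - 1, by omega⟩
  subst hρ
  intro X E Qt αt Lt Tpre
  have main : ∀ T T' : ℕ, (∃ G : Alg F, GlobalRecoverer C α ℓ L T G) →
      (∃ B : Alg F, LocalDecoder C' Q' α' B ∧ LocalDecoderTime k' k (s + 1) B T') →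
      ∃ A D : Alg F, LocalListRecoverer E Qt αt ℓ Lt A D ∧ PreprocessingTime A Tpre ∧
        LocalRecoveryTime k' n (s + 1) ℓ A D (T' + Q' * T * X) := by
    rintro T T' ⟨G, hG⟩ ⟨B, hB, hB'⟩
    exact exists_localListRecoverer hn hk hk' hℓ hL hα hα1 hα' hα1' hC hδ hG hB hB' rfl
  refine ⟨?_, main⟩
  -- The first claim has no bound on the local running time, so a table for C and any running time
  -- of the decoder suffice.
  obtain ⟨T, G, hG⟩ := hrec.exists_globalRecoverer
  obtain ⟨B, hB⟩ := hdec
  obtain ⟨T', hB'⟩ := hB.exists_time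
  obtain ⟨A, D, h, h', -⟩ := main T T' ⟨G, hG⟩ ⟨B, hB, hB'⟩
  exact ⟨A, D, h, h'⟩
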